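/- Let $G$ be a finite group acting linearly on a complex vector space $V$ with basis $v_1,\dots,v_n$. Let $\mathbf q=(q_{ij})_{1\le i,j\le n}$ be nonzero scalars with $q_{ii}=1$ and $q_{ji}=q_{ij}^{-1}$. Let $\alpha:G\times G\to\mathbb C^\times$ be a normalized $2$-cocycle. Let $S_{\mathbf q}(V)=\mathbb C\langle v_1,\dots,v_n\mid v_iv_j=q_{ij}v_jv_i\ (1\le i,j\le n)\rangle$ and $\Lambda_{\mathbf q}(V)=\mathbb C\langle v_1,\dots,v_n\mid v_iv_j=-q_{ij}v_jv_i\ (1\le i,j\le n)\rangle$. Suppose that the action of $G$ on $V$ extends to an action by algebra automorphisms on $S_{\mathbf q}(V)$ and on $\Lambda_{\mathbf q}(V)$. For an algebra $A$ on which $G$ acts by automorphisms, $A\#_\alpha G$ is the vector space $A\otimes\mathbb CG$, with elements $a\otimes g$ written $at_g$, and with product $(at_g)(bt_h)=\alpha(g,h)\,a\,({}^gb)\,t_{gh}$; write $\mathbb C^\alpha G=\mathbb C\#_\alpha G$. Give vectors degree $1$ and group elements degree $0$; then $S_{\mathbf q}(V)\#_\alpha G$ is a graded algebra. For a bilinear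 map $\kappa:V\times V\to\mathbb C^\alpha G$ with $\kappa(v_i,v_j)=-q_{ij}\kappa(v_j,v_i)$ for all $i,j$, let $$\mathcal H_{\mathbf q,\kappa,\alpha}=T(V)\#_\alpha G\,/\,\bigl(v_iv_j-q_{ij}v_jv_i-\kappa(v_i,v_j)\mid 1\le i,j\le n\bigr),$$ a filtered algebra. It is called a twisted quantum Drinfeld Hecke algebra for $(G,V,\mathbf q,\alpha)$ if $\operatorname{gr}\mathcal H_{\mathbf q,\kappa,\alpha}\cong S_{\mathbf q}(V)\#_\alpha G$ as graded algebras. The parameter space is the set of all such $\kappa$ for which this holds. A Hochschild $2$-cocycle on an algebra $R$ is a bilinear map $\mu:R\times R\to R$ with $a\mu(b,c)+\mu(a,bc)=\mu(ab,c)+\mu(a,b)c$ for all $a,b,c\in R$. Two such cocycles are equivalent if their difference is of the form $(a,b)\mapsto af(b)-f(ab)+f(a)b$ for a linear map $f:R\to R$. A Hochschild $2$-cocycle on $S_{\mathbf q}(V)\#_\alpha G$ is called constant if it has degree $-2$ as a map between graded algebras. The quantum skew-symmetrization of a constant cocycle $\mu_1$ is the bilinear map $\kappa:V\times V\to\mathbb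 C^\alpha G$ with $$\kappa(v_i,v_j)=\mu_1(v_i,v_j)-q_{ij}\,\mu_1(v_j,v_i)\qquad(1\le i,j\le n).$$ Theorem. The assignment $\mu_1\mapsto\mathcal H_{\mathbf q,\kappa,\alpha}$, where $\kappa$ is the quantum skew-symmetrization of $\mu_1$, is well defined on equivalence classes, and it is a bijection from the space of equivalence classes of constant Hochschild $2$-cocycles on $S_{\mathbf q}(V)\#_\alpha G$ to the set of twisted quantum Drinfeld Hecke algebras for $(G,V,\mathbf q,\alpha)$. This holds both when such an algebra is specified by its parameter $\kappa$, so that $[\mu_1]\mapsto\kappa$ is a bijection onto the parameter space, and when it is regarded as a quotient of $T(V)\#_\alpha G$, so that $[\mu_1]\mapsto$ (defining ideal of $\mathcal H_{\mathbf q,\kappa,\alpha}$) is a bijection onto the set of defining ideals of the twisted quantum Drinfeld Hecke algebras. -/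

import Mathlib

open scoped DirectSum

noncomputable section

namespace TQDHA

/-! ### Normalized `2`-cocycles and twisted skew group algebras -/

/-- A normalized `2`-cocycle `α : G × G → ℂˣ` (for the trivial action of `G` on `ℂˣ`). -/
structure NormalizedTwoCocycle (G : Type*) [Group G] where
  toFun : G → G → ℂˣ
  cocycle : ∀ g₁ g₂ g₃ : G,
    toFun g₁ g₂ * toFun (g₁ * g₂) g₃ = toFun g₂ g₃ * toFun g₁ (g₂ * g₃)
  one_right : ∀ g : G, toFun g 1 = 1
  one_left : ∀ g : G, toFun 1 g = 1

section TwistedSkew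

variable {G : Type*} [Group G] {A : Type*} [Ring A] [Algebra ℂ A]

/-- The underlying vector space `A ⊗ ℂG` of the twisted skew group algebra `A #_α G`: the element
`∑ a_g t_g` is the finitely supported function `g ↦ a_g`. -/
@[nolint unusedArguments]
def TwistedSkew (_σ : G →* (A ≃ₐ[ℂ] A)) (_α : NormalizedTwoCocycle G) : Type _ := G →₀ A

namespace TwistedSkew

variable (σ : G →* (A ≃ₐ[ℂ] A)) (α : NormalizedTwoCocycle G)

instance : AddCommGroup (TwistedSkew σ α) := inferInstanceAs (AddCommGroup (G →₀ A))
instance : Module ℂ (TwistedSkew σ α) := inferInstanceAs (Module ℂ (G →₀ A))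

/-- The coefficient `a_g` of `∑ a_g t_g`. -/
def coeff (x : TwistedSkew σ α) (g : G) : A := (show G →₀ A from x) g

/-- The element `a t_g` of `A #_α G`, linearly in `a`. -/
def single (g : G) : A →ₗ[ℂ] TwistedSkew σ α := Finsupp.lsingle g

variable {σ α}

theorem induction_on {p : TwistedSkew σ α → Prop} (x : TwistedSkew σ α) (h0 : p 0)
    (hadd : ∀ x y, p x → p y → p (x + y)) (hs : ∀ g a, p (single σ α g a)) : p x :=
  Finsupp.induction_linear (motive := p) x h0 hadd hs

variable (σ α)

/-- The linear map `A #_α G → M` that sends `a t_g` to `f g a`. -/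
def lift {M : Type*} [AddCommGroup M] [Module ℂ M] (f : G → A →ₗ[ℂ] M) :
    TwistedSkew σ α →ₗ[ℂ] M := Finsupp.lsum ℂ f

theorem lift_single {M : Type*} [AddCommGroup M] [Module ℂ M] (f : G → A →ₗ[ℂ] M) (g : G)
    (a : A) : lift σ α f (single σ α g a) = f g a := by
  exact Finsupp.lsum_single ℂ f g a

/-- `(a, b) ↦ α(g,h) a (ᵍb) t_{gh}`. -/
def mulAux (g h : G) : A →ₗ[ℂ] A →ₗ[ℂ] TwistedSkew σ α :=
  LinearMap.mk₂ ℂ (fun a b => single σ α (g * h) ((α.toFun g h : ℂ) • (a * σ g b)))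
    (fun a a' b => by rw [add_mul, smul_add, map_add])
    (fun c a b => by rw [smul_mul_assoc, smul_comm, map_smul])
    (fun a b b' => by rw [map_add, mul_add, smul_add, map_add])
    (fun c a b => by
      rw [map_smul (σ g), mul_smul_comm, smul_comm, map_smul])

/-- The multiplication of `A #_α G`, the bilinear map with
`(a t_g, b t_h) ↦ α(g,h) a (ᵍb) t_{gh}`. -/
def mulBilin : TwistedSkew σ α →ₗ[ℂ] TwistedSkew σ α →ₗ[ℂ] TwistedSkew σ α :=
  lift σ α fun g => LinearMap.flip (lift σ α fun h => LinearMap.flip (mulAux σ α g h))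

instance : Mul (TwistedSkew σ α) := ⟨fun x y => mulBilin σ α x y⟩
instance : One (TwistedSkew σ α) := ⟨single σ α 1 1⟩

theorem mul_def (x y : TwistedSkew σ α) : x * y = mulBilin σ α x y := rfl
theorem one_def : (1 : TwistedSkew σ α) = single σ α 1 1 := rfl

theorem single_mul_single (g h : G) (a b : A) :
    single σ α g a * single σ α h b
      = single σ α (g * h) ((α.toFun g h : ℂ) • (a * σ g b)) := by
  rw [mul_def, mulBilin, lift_single, LinearMap.flip_apply, lift_single, LinearMap.flip_apply]
  rfl

instance : Ring (TwistedSkew σ α) :=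
  { (inferInstance : AddCommGroup (TwistedSkew σ α)) with
    mul := (· * ·)
    one := 1
    left_distrib := fun x y z => by simp only [mul_def, map_add]
    right_distrib := fun x y z => by simp only [mul_def, map_add, LinearMap.add_apply]
    zero_mul := fun x => by simp only [mul_def, map_zero, LinearMap.zero_apply]
    mul_zero := fun x => by simp only [mul_def, map_zero]
    mul_assoc := fun x y z => by
      induction x using induction_on with
      | h0 => simp only [mul_def, map_zero, LinearMap.zero_apply]
      | hadd x x' hx hx' =>
        simp only [mul_def, map_add, LinearMap.add_apply] at hx hx' ⊢
        rw [hx, hx']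
      | hs g a =>
        induction y using induction_on with
        | h0 => simp only [mul_def, map_zero, LinearMap.zero_apply]
        | hadd y y' hy hy' =>
          simp only [mul_def, map_add, LinearMap.add_apply] at hy hy' ⊢
          rw [hy, hy']
        | hs h b =>
          induction z using induction_on with
          | h0 => simp only [mul_def, map_zero]
          | hadd z z' hz hz' =>
            simp only [mul_def, map_add] at hz hz' ⊢
            rw [hz, hz']
          | hs k c =>
            have hc := congrArg (fun u : ℂˣ => (u : ℂ)) (α.cocycle g h k)
            simp only [Units.val_mul] at hc
            simp only [single_mul_single, mul_assoc g h k]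
            congr 1
            simp only [map_smul, map_mul, smul_mul_assoc, mul_smul_comm, smul_smul,
              AlgEquiv.mul_apply, mul_assoc]
            rw [mul_comm (α.toFun (g * h) k : ℂ), hc,
              mul_comm (α.toFun h k : ℂ)]
    one_mul := fun x => by
      induction x using induction_on with
      | h0 => simp only [mul_def, map_zero]
      | hadd x x' hx hx' =>
        simp only [mul_def, map_add] at hx hx' ⊢
        rw [hx, hx']
      | hs g a => rw [one_def, single_mul_single]; simp [α.one_left]
    mul_one := fun x => by
      induction x using induction_on with
      | h0 => simp only [mul_def, map_zero, LinearMap.zero_apply]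
      | hadd x x' hx hx' =>
        simp only [mul_def, map_add, LinearMap.add_apply] at hx hx' ⊢
        rw [hx, hx']
      | hs g a => rw [one_def, single_mul_single]; simp [α.one_right] }

instance : Algebra ℂ (TwistedSkew σ α) :=
  Algebra.ofModule (fun r x y => by simp only [mul_def, map_smul, LinearMap.smul_apply])
    (fun r x y => by simp only [mul_def, map_smul])

/-- For a subspace `W` of `A`, the subspace `W ⊗ ℂG` of `A #_α G`. -/
def coeffsIn (W : Submodule ℂ A) : Submodule ℂ (TwistedSkew σ α) where
  carrier := {x | ∀ g, coeff σ α x g ∈ W}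
  zero_mem' := fun _ => W.zero_mem
  add_mem' := fun hx hy g => W.add_mem (hx g) (hy g)
  smul_mem' := fun c _ hx g => W.smul_mem c (hx g)

theorem mem_coeffsIn {W : Submodule ℂ A} {x : TwistedSkew σ α} :
    x ∈ coeffsIn σ α W ↔ ∀ g, coeff σ α x g ∈ W := Iff.rfl

theorem coeffsIn_eq_iSup (W : Submodule ℂ A) :
    coeffsIn σ α W = ⨆ g, W.map (single σ α g) := by
  classical
  apply le_antisymm
  · intro x hx
    have h : x = ∑ g ∈ (show G →₀ A from x).support, single σ α g (coeff σ α x g) :=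
      (Finsupp.sum_single (show G →₀ A from x)).symm
    rw [h]
    exact Submodule.sum_mem _ fun g _ =>
      Submodule.mem_iSup_of_mem g (Submodule.mem_map_of_mem (hx g))
  · refine iSup_le fun g => ?_
    rintro _ ⟨a, ha, rfl⟩ h
    by_cases hg : g = h
    · subst hg
      have : coeff σ α (single σ α g a) g = a := Finsupp.single_eq_same
      rw [this]; exact ha
    · have : coeff σ α (single σ α g a) h = 0 := Finsupp.single_eq_of_ne (Ne.symm hg)
      rw [this]; exact W.zero_mem

end TwistedSkew

/-- The twisted group algebra `ℂ^α G`, with basis `t_g` and `t_g t_h = α(g,h) t_{gh}`. -/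
abbrev TwistedGroupAlgebra (α : NormalizedTwoCocycle G) : Type _ :=
  TwistedSkew (1 : G →* (ℂ ≃ₐ[ℂ] ℂ)) α

/-- The inclusion `ℂ^α G → A #_α G`, `c t_g ↦ (c·1) t_g`. -/
def inclGroupAlgebra (σ : G →* (A ≃ₐ[ℂ] A)) (α : NormalizedTwoCocycle G) :
    TwistedGroupAlgebra α →ₗ[ℂ] TwistedSkew σ α :=
  TwistedSkew.lift _ α fun g => TwistedSkew.single σ α g ∘ₗ Algebra.linearMap ℂ A

end TwistedSkew

/-! ### The tensor algebra, the quantum symmetric and the quantum exterior algebra -/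

section Algebras

variable {V : Type*} [AddCommGroup V] [Module ℂ V] {n : ℕ}

/-- The relations `v_i v_j = c_{ij} v_j v_i`, for all `i, j`, in `T(V)`. -/
inductive CommRel (b : Module.Basis (Fin n) ℂ V) (c : Fin n → Fin n → ℂ) :
    TensorAlgebra ℂ V → TensorAlgebra ℂ V → Prop
  | rel (i j : Fin n) : CommRel b c
      (TensorAlgebra.ι ℂ (b i) * TensorAlgebra.ι ℂ (b j))
      (c i j • (TensorAlgebra.ι ℂ (b j) * TensorAlgebra.ι ℂ (b i)))

/-- The algebra generated by `v_1, …, v_n` with relations `v_i v_j = c_{ij} v_j v_i`. -/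
abbrev CommAlg (b : Module.Basis (Fin n) ℂ V) (c : Fin n → Fin n → ℂ) : Type _ :=
  RingQuot (CommRel b c)

/-- The image of a vector `v ∈ V`. -/
def CommAlg.ι (b : Module.Basis (Fin n) ℂ V) (c : Fin n → Fin n → ℂ) :
    V →ₗ[ℂ] CommAlg b c :=
  (RingQuot.mkAlgHom ℂ (CommRel b c)).toLinearMap ∘ₗ TensorAlgebra.ι ℂ

/-- The quantum symmetric algebra `S_q(V)`: relations `v_i v_j = q_{ij} v_j v_i`. -/
abbrev QSym (b : Module.Basis (Fin n) ℂ V) (q : Fin n → Fin n → ℂ) : Type _ :=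
  CommAlg b q

/-- The quantum exterior algebra `Λ_q(V)`: relations `v_i v_j = -q_{ij} v_j v_i`. -/
abbrev QExt (b : Module.Basis (Fin n) ℂ V) (q : Fin n → Fin n → ℂ) : Type _ :=
  CommAlg b (fun i j => -q i j)

/-- The `d`-th graded piece of `S_q(V)`, spanned by products of `d` vectors. -/
def QSym.degree (b : Module.Basis (Fin n) ℂ V) (q : Fin n → Fin n → ℂ) (d : ℕ) :
    Submodule ℂ (QSym b q) :=
  LinearMap.range (CommAlg.ι b q) ^ d

/-- The linear action `ρ` of `G` on `V` extends to the action `σ`, by automorphisms, on the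
algebra generated by `V` with relations `v_i v_j = c_{ij} v_j v_i`. -/
def ExtendsAction {G : Type*} [Group G] (b : Module.Basis (Fin n) ℂ V)
    (c : Fin n → Fin n → ℂ) (ρ : Representation ℂ G V)
    (σ : G →* (CommAlg b c ≃ₐ[ℂ] CommAlg b c)) : Prop :=
  ∀ g v, σ g (CommAlg.ι b c v) = CommAlg.ι b c (ρ g v)

/-- The action of `G` on `T(V)` by algebra automorphisms induced by a linear action on `V`. -/
def tensorAction {G : Type*} [Group G] (ρ : Representation ℂ G V) :
    G →* (TensorAlgebra ℂ V ≃ₐ[ℂ] TensorAlgebra ℂ V) where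
  toFun g := AlgEquiv.ofAlgHom (TensorAlgebra.lift ℂ (TensorAlgebra.ι ℂ ∘ₗ ρ g))
    (TensorAlgebra.lift ℂ (TensorAlgebra.ι ℂ ∘ₗ ρ g⁻¹))
    (by ext v; simp) (by ext v; simp)
  map_one' := by
    apply AlgEquiv.coe_toAlgHom_injective
    ext v
    simp
  map_mul' g h := by
    apply AlgEquiv.coe_toAlgHom_injective
    ext v
    simp

theorem tensorAction_ι {G : Type*} [Group G] (ρ : Representation ℂ G V) (g : G) (v : V) :
    tensorAction ρ g (TensorAlgebra.ι ℂ v) = TensorAlgebra.ι ℂ (ρ g v) := by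
  simp [tensorAction]

/-- The tensors of degree at most `k`. -/
def tensorLE (V : Type*) [AddCommGroup V] [Module ℂ V] (k : ℕ) :
    Submodule ℂ (TensorAlgebra ℂ V) :=
  ⨆ d : Fin (k + 1), LinearMap.range (TensorAlgebra.ι ℂ : V →ₗ[ℂ] TensorAlgebra ℂ V) ^ (d : ℕ)

theorem pow_le_tensorLE {d k : ℕ} (h : d ≤ k) :
    LinearMap.range (TensorAlgebra.ι ℂ : V →ₗ[ℂ] TensorAlgebra ℂ V) ^ d ≤ tensorLE V k :=
  le_iSup (fun d : Fin (k + 1) =>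
    LinearMap.range (TensorAlgebra.ι ℂ : V →ₗ[ℂ] TensorAlgebra ℂ V) ^ (d : ℕ))
    ⟨d, Nat.lt_succ_of_le h⟩

theorem tensorLE_mono : Monotone (tensorLE V) := fun _ _ h =>
  iSup_le fun d => pow_le_tensorLE ((Nat.le_of_lt_succ d.2).trans h)

theorem one_mem_tensorLE : (1 : TensorAlgebra ℂ V) ∈ tensorLE V 0 :=
  pow_le_tensorLE (d := 0) le_rfl (by rw [pow_zero]; exact Submodule.one_le.1 le_rfl)

theorem tensorLE_mul_le (k l : ℕ) : tensorLE V k * tensorLE V l ≤ tensorLE V (k + l) := by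
  rw [tensorLE, Submodule.iSup_mul]
  refine iSup_le fun d => ?_
  rw [tensorLE, Submodule.mul_iSup]
  refine iSup_le fun e => ?_
  rw [← pow_add]
  exact pow_le_tensorLE (by omega)

theorem tensorAction_mem_tensorLE {G : Type*} [Group G] (ρ : Representation ℂ G V) (g : G)
    {k : ℕ} {x : TensorAlgebra ℂ V} (hx : x ∈ tensorLE V k) :
    tensorAction ρ g x ∈ tensorLE V k := by
  have h : (tensorLE V k).map (tensorAction ρ g : _ →ₐ[ℂ] _).toLinearMap ≤ tensorLE V k := by
    rw [tensorLE, Submodule.map_iSup]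
    refine iSup_le fun d => ?_
    rw [Submodule.map_pow]
    refine le_trans ?_ (pow_le_tensorLE (Nat.le_of_lt_succ d.2))
    refine pow_le_pow_left' ?_ d
    rintro _ ⟨_, ⟨v, rfl⟩, rfl⟩
    exact ⟨ρ g v, (tensorAction_ι ρ g v).symm⟩
  exact h (Submodule.mem_map_of_mem hx)

end Algebras

/-! ### Filtered algebras and their associated graded algebras -/

section Filtered

/-- An increasing filtration `F_0 ⊆ F_1 ⊆ ⋯` of an algebra by subspaces with `1 ∈ F_0` and
`F_k F_l ⊆ F_{k+l}`. -/
structure AlgFiltration (R : Type*) [Ring R] [Algebra ℂ R] where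
  F : ℕ → Submodule ℂ R
  mono : Monotone F
  one_mem : (1 : R) ∈ F 0
  mul_mem : ∀ {k l : ℕ} {x y : R}, x ∈ F k → y ∈ F l → x * y ∈ F (k + l)

namespace AlgFiltration

variable {R : Type*} [Ring R] [Algebra ℂ R] (𝓕 : AlgFiltration R)

/-- The subspace `F_{k-1}`, with `F_{-1} = 0`. -/
def prev : ℕ → Submodule ℂ R
  | 0 => ⊥
  | k + 1 => 𝓕.F k

theorem mul_mem_prev_left {k l : ℕ} {x y : R} (hx : x ∈ 𝓕.prev k) (hy : y ∈ 𝓕.F l) :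
    x * y ∈ 𝓕.prev (k + l) := by
  cases k with
  | zero =>
    rw [prev, Submodule.mem_bot] at hx
    rw [hx, zero_mul]
    exact Submodule.zero_mem _
  | succ k =>
    rw [Nat.add_right_comm]
    exact 𝓕.mul_mem hx hy

theorem mul_mem_prev_right {k l : ℕ} {x y : R} (hx : x ∈ 𝓕.F k) (hy : y ∈ 𝓕.prev l) :
    x * y ∈ 𝓕.prev (k + l) := by
  cases l with
  | zero =>
    rw [prev, Submodule.mem_bot] at hy
    rw [hy, mul_zero]
    exact Submodule.zero_mem _
  | succ l => exact 𝓕.mul_mem hx hy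

/-- The piece `F_k / F_{k-1}` of the associated graded algebra. -/
abbrev GrPiece (k : ℕ) : Type _ := 𝓕.F k ⧸ (𝓕.prev k).submoduleOf (𝓕.F k)

/-- The class in `F_k / F_{k-1}` of an element of `F_k`. -/
def grMk (k : ℕ) : 𝓕.F k →ₗ[ℂ] 𝓕.GrPiece k := Submodule.mkQ _

theorem grMk_eq_grMk {k : ℕ} (x y : 𝓕.F k) :
    𝓕.grMk k x = 𝓕.grMk k y ↔ (x : R) - y ∈ 𝓕.prev k :=
  Submodule.Quotient.eq _

/-- The product `F_k × F_l → F_{k+l} / F_{k+l-1}`. -/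
def preMul (k l : ℕ) : 𝓕.F k →ₗ[ℂ] 𝓕.F l →ₗ[ℂ] 𝓕.GrPiece (k + l) :=
  LinearMap.mk₂ ℂ (fun x y => 𝓕.grMk (k + l) ⟨(x : R) * y, 𝓕.mul_mem x.2 y.2⟩)
    (fun x x' y => by
      rw [← map_add]; congr 1; ext; simp [add_mul])
    (fun c x y => by
      rw [← map_smul]; congr 1; ext; simp)
    (fun x y y' => by
      rw [← map_add]; congr 1; ext; simp [mul_add])
    (fun c x y => by
      rw [← map_smul]; congr 1; ext; simp)

/-- The product of `gr`: the class of `x` in degree `k` times the class of `y` in degree `l` is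
the class of `x y` in degree `k + l`. -/
def grMul (k l : ℕ) : 𝓕.GrPiece k →ₗ[ℂ] 𝓕.GrPiece l →ₗ[ℂ] 𝓕.GrPiece (k + l) :=
  Submodule.liftQ _
    (LinearMap.flip (Submodule.liftQ _ (LinearMap.flip (𝓕.preMul k l)) (by
      intro y hy
      rw [LinearMap.mem_ker]
      ext x
      change 𝓕.grMk (k + l) ⟨(x : R) * y, _⟩ = 0
      rw [← map_zero (𝓕.grMk (k + l)), grMk_eq_grMk]
      simpa using 𝓕.mul_mem_prev_right x.2 hy)))
    (by
      intro x hx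
      rw [LinearMap.mem_ker]
      apply LinearMap.ext
      intro y
      obtain ⟨y, rfl⟩ := Submodule.mkQ_surjective _ y
      change 𝓕.grMk (k + l) ⟨(x : R) * y, _⟩ = 0
      rw [← map_zero (𝓕.grMk (k + l)), grMk_eq_grMk]
      simpa using 𝓕.mul_mem_prev_left hx y.2)

theorem grMul_mk (k l : ℕ) (x : 𝓕.F k) (y : 𝓕.F l) :
    𝓕.grMul k l (𝓕.grMk k x) (𝓕.grMk l y)
      = 𝓕.grMk (k + l) ⟨(x : R) * y, 𝓕.mul_mem x.2 y.2⟩ := rfl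

theorem grMk_sigma_ext {k l : ℕ} (h : k = l) (x : 𝓕.F k) (y : 𝓕.F l) (hxy : (x : R) = y) :
    (GradedMonoid.mk k (𝓕.grMk k x) : GradedMonoid 𝓕.GrPiece)
      = GradedMonoid.mk l (𝓕.grMk l y) := by
  subst h
  congr 2
  exact Subtype.ext hxy

instance : GradedMonoid.GMul 𝓕.GrPiece where
  mul {k l} x y := 𝓕.grMul k l x y

instance : GradedMonoid.GOne 𝓕.GrPiece where
  one := 𝓕.grMk 0 ⟨1, 𝓕.one_mem⟩

theorem gmk_mul_gmk {k l : ℕ} (x : 𝓕.F k) (y : 𝓕.F l) :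
    (GradedMonoid.mk k (𝓕.grMk k x) : GradedMonoid 𝓕.GrPiece) * GradedMonoid.mk l (𝓕.grMk l y)
      = GradedMonoid.mk (k + l) (𝓕.grMk (k + l) ⟨(x : R) * y, 𝓕.mul_mem x.2 y.2⟩) := rfl

theorem grMk_surjective (k : ℕ) : Function.Surjective (𝓕.grMk k) := Submodule.mkQ_surjective _

instance : DirectSum.GSemiring 𝓕.GrPiece where
  one_mul := by
    rintro ⟨k, x⟩
    obtain ⟨x, rfl⟩ := 𝓕.grMk_surjective k x
    exact 𝓕.grMk_sigma_ext (zero_add k) _ _ (one_mul _)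
  mul_one := by
    rintro ⟨k, x⟩
    obtain ⟨x, rfl⟩ := 𝓕.grMk_surjective k x
    exact 𝓕.grMk_sigma_ext (add_zero k) _ _ (mul_one _)
  mul_assoc := by
    rintro ⟨k, x⟩ ⟨l, y⟩ ⟨m, z⟩
    obtain ⟨x, rfl⟩ := 𝓕.grMk_surjective k x
    obtain ⟨y, rfl⟩ := 𝓕.grMk_surjective l y
    obtain ⟨z, rfl⟩ := 𝓕.grMk_surjective m z
    exact 𝓕.grMk_sigma_ext (add_assoc k l m) _ _ (mul_assoc _ _ _)
  mul_zero := fun {k l} a => map_zero (𝓕.grMul k l a)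
  zero_mul := fun {k l} b => by
    change 𝓕.grMul k l 0 b = 0
    rw [map_zero, LinearMap.zero_apply]
  mul_add := fun {k l} a b c => map_add (𝓕.grMul k l a) b c
  add_mul := fun {k l} a b c => by
    change 𝓕.grMul k l (a + b) c = 𝓕.grMul k l a c + 𝓕.grMul k l b c
    rw [map_add, LinearMap.add_apply]
  natCast m := 𝓕.grMk 0 ⟨m, by
    have := (𝓕.F 0).smul_mem (m : ℂ) 𝓕.one_mem
    rwa [Algebra.smul_def, mul_one, map_natCast] at this⟩
  natCast_zero := by
    rw [← map_zero (𝓕.grMk 0), grMk_eq_grMk]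
    simp
  natCast_succ m := by
    change _ = _ + 𝓕.grMk 0 ⟨1, 𝓕.one_mem⟩
    rw [← map_add, grMk_eq_grMk]
    simp

instance : DirectSum.GRing 𝓕.GrPiece where
  intCast m := 𝓕.grMk 0 ⟨m, by
    have := (𝓕.F 0).smul_mem (m : ℂ) 𝓕.one_mem
    rwa [Algebra.smul_def, mul_one, map_intCast] at this⟩
  intCast_ofNat m := (𝓕.grMk_eq_grMk _ _).2 (by simp)
  intCast_negSucc_ofNat m := by
    refine ((𝓕.grMk_eq_grMk _ (-⟨((m + 1 : ℕ) : R), ?_⟩)).2 ?_).trans (map_neg (𝓕.grMk 0) _)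
    · simp
    · have := (𝓕.F 0).smul_mem ((m + 1 : ℕ) : ℂ) 𝓕.one_mem
      rwa [Algebra.smul_def, mul_one, map_natCast] at this

theorem algebraMap_mem (c : ℂ) : algebraMap ℂ R c ∈ 𝓕.F 0 := by
  rw [Algebra.algebraMap_eq_smul_one]
  exact (𝓕.F 0).smul_mem c 𝓕.one_mem

instance : DirectSum.GAlgebra ℂ 𝓕.GrPiece where
  toFun :=
    { toFun := fun c => 𝓕.grMk 0 ⟨algebraMap ℂ R c, 𝓕.algebraMap_mem c⟩
      map_zero' := by
        rw [← map_zero (𝓕.grMk 0), grMk_eq_grMk]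
        simp
      map_add' := fun c d => by
        rw [← map_add, grMk_eq_grMk]
        simp }
  map_one := 𝓕.grMk_eq_grMk _ _ |>.2 (by simp)
  map_mul c d := 𝓕.grMk_sigma_ext (zero_add 0).symm _ _ (map_mul _ _ _)
  commutes := by
    rintro c ⟨k, x⟩
    obtain ⟨x, rfl⟩ := 𝓕.grMk_surjective k x
    exact 𝓕.grMk_sigma_ext (add_comm 0 k) _ _ (Algebra.commutes _ _)
  smul_def := by
    rintro c ⟨k, x⟩
    obtain ⟨x, rfl⟩ := 𝓕.grMk_surjective k x
    exact 𝓕.grMk_sigma_ext (zero_add k).symm (c • x) _ (Algebra.smul_def _ _)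

/-- The associated graded algebra `gr R = ⨁ F_k / F_{k-1}`. -/
abbrev Gr : Type _ := ⨁ k, 𝓕.GrPiece k

/-- The image of a filtration under an algebra homomorphism. -/
def map {R' : Type*} [Ring R'] [Algebra ℂ R'] (f : R →ₐ[ℂ] R') : AlgFiltration R' where
  F k := (𝓕.F k).map f.toLinearMap
  mono _ _ h := Submodule.map_mono (𝓕.mono h)
  one_mem := ⟨1, 𝓕.one_mem, map_one f⟩
  mul_mem := by
    rintro k l _ _ ⟨x, hx, rfl⟩ ⟨y, hy, rfl⟩
    exact ⟨x * y, 𝓕.mul_mem hx hy, map_mul f x y⟩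

end AlgFiltration

end Filtered

/-! ### The algebras `H_{q,κ,α}` and the Poincaré–Birkhoff–Witt condition -/

section Hecke

variable {G : Type*} [Group G] {V : Type*} [AddCommGroup V] [Module ℂ V] {n : ℕ}

/-- The twisted skew group algebra `T(V) #_α G`. -/
abbrev TensorSkew (ρ : Representation ℂ G V) (α : NormalizedTwoCocycle G) : Type _ :=
  TwistedSkew (tensorAction ρ) α

/-- The filtration of `T(V) #_α G` in which vectors have degree one and group elements have
degree zero. -/
def tensorSkewFiltration (ρ : Representation ℂ G V) (α : NormalizedTwoCocycle G) :
    AlgFiltration (TensorSkew ρ α) where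
  F k := TwistedSkew.coeffsIn _ α (tensorLE V k)
  mono _ _ h _ hx g := tensorLE_mono h (hx g)
  one_mem := by
    rw [TwistedSkew.coeffsIn_eq_iSup]
    exact Submodule.mem_iSup_of_mem 1 (Submodule.mem_map_of_mem one_mem_tensorLE)
  mul_mem := by
    intro k l x y hx hy
    have key : TwistedSkew.coeffsIn (tensorAction ρ) α (tensorLE V k)
        * TwistedSkew.coeffsIn (tensorAction ρ) α (tensorLE V l)
        ≤ TwistedSkew.coeffsIn (tensorAction ρ) α (tensorLE V (k + l)) := by
      simp only [TwistedSkew.coeffsIn_eq_iSup]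
      rw [Submodule.iSup_mul]
      refine iSup_le fun g => ?_
      rw [Submodule.mul_iSup]
      refine iSup_le fun h => ?_
      rw [Submodule.mul_le]
      rintro _ ⟨a, ha, rfl⟩ _ ⟨c, hc, rfl⟩
      rw [TwistedSkew.single_mul_single]
      refine Submodule.mem_iSup_of_mem (g * h) (Submodule.mem_map_of_mem ?_)
      exact Submodule.smul_mem _ _
        (tensorLE_mul_le k l (Submodule.mul_mem_mul ha (tensorAction_mem_tensorLE ρ g hc)))
    exact key (Submodule.mul_mem_mul hx hy)

/-- The elements `v_i v_j - q_{ij} v_j v_i - κ(v_i,v_j)` of `T(V) #_α G`. -/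
def heckeRelations (b : Module.Basis (Fin n) ℂ V) (ρ : Representation ℂ G V)
    (q : Fin n → Fin n → ℂ) (α : NormalizedTwoCocycle G)
    (κ : V →ₗ[ℂ] V →ₗ[ℂ] TwistedGroupAlgebra α) : Set (TensorSkew ρ α) :=
  {x | ∃ i j : Fin n,
    x = TwistedSkew.single _ α 1 (TensorAlgebra.ι ℂ (b i) * TensorAlgebra.ι ℂ (b j))
      - q i j • TwistedSkew.single _ α 1 (TensorAlgebra.ι ℂ (b j) * TensorAlgebra.ι ℂ (b i))
      - inclGroupAlgebra _ α (κ (b i) (b j))}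

/-- The two-sided ideal generated by these elements. -/
def heckeIdeal (b : Module.Basis (Fin n) ℂ V) (ρ : Representation ℂ G V)
    (q : Fin n → Fin n → ℂ) (α : NormalizedTwoCocycle G)
    (κ : V →ₗ[ℂ] V →ₗ[ℂ] TwistedGroupAlgebra α) : TwoSidedIdeal (TensorSkew ρ α) :=
  TwoSidedIdeal.span (heckeRelations b ρ q α κ)

/-- The algebra `H_{q,κ,α}`, the quotient of `T(V) #_α G` by that ideal. -/
abbrev HeckeAlg (b : Module.Basis (Fin n) ℂ V) (ρ : Representation ℂ G V)
    (q : Fin n → Fin n → ℂ) (α : NormalizedTwoCocycle G)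
    (κ : V →ₗ[ℂ] V →ₗ[ℂ] TwistedGroupAlgebra α) : Type _ :=
  (heckeIdeal b ρ q α κ).ringCon.Quotient

/-- The projection `T(V) #_α G → H_{q,κ,α}`. -/
def heckeMk (b : Module.Basis (Fin n) ℂ V) (ρ : Representation ℂ G V)
    (q : Fin n → Fin n → ℂ) (α : NormalizedTwoCocycle G)
    (κ : V →ₗ[ℂ] V →ₗ[ℂ] TwistedGroupAlgebra α) :
    TensorSkew ρ α →ₐ[ℂ] HeckeAlg b ρ q α κ :=
  { (heckeIdeal b ρ q α κ).ringCon.mk' with commutes' := fun _ => rfl }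

/-- The filtration of `H_{q,κ,α}` in which vectors have degree one and group elements have
degree zero. -/
def heckeFiltration (b : Module.Basis (Fin n) ℂ V) (ρ : Representation ℂ G V)
    (q : Fin n → Fin n → ℂ) (α : NormalizedTwoCocycle G)
    (κ : V →ₗ[ℂ] V →ₗ[ℂ] TwistedGroupAlgebra α) : AlgFiltration (HeckeAlg b ρ q α κ) :=
  (tensorSkewFiltration ρ α).map (heckeMk b ρ q α κ)

/-- The degree `d` piece of the graded algebra `S_q(V) #_α G`, where vectors have degree one and
group elements have degree zero. -/
def skewDegree (b : Module.Basis (Fin n) ℂ V) (q : Fin n → Fin n → ℂ)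
    (σ : G →* (QSym b q ≃ₐ[ℂ] QSym b q)) (α : NormalizedTwoCocycle G) (d : ℕ) :
    Submodule ℂ (TwistedSkew σ α) :=
  TwistedSkew.coeffsIn σ α (QSym.degree b q d)

/-- The Poincaré–Birkhoff–Witt condition: `gr H_{q,κ,α}` and `S_q(V) #_α G` are isomorphic as
graded algebras. -/
def SatisfiesPBW (b : Module.Basis (Fin n) ℂ V) (ρ : Representation ℂ G V)
    (q : Fin n → Fin n → ℂ) (α : NormalizedTwoCocycle G)
    (σ : G →* (QSym b q ≃ₐ[ℂ] QSym b q))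
    (κ : V →ₗ[ℂ] V →ₗ[ℂ] TwistedGroupAlgebra α) : Prop :=
  ∃ e : (heckeFiltration b ρ q α κ).Gr ≃ₐ[ℂ] TwistedSkew σ α,
    ∀ d : ℕ,
      (LinearMap.range (DirectSum.lof ℂ ℕ (heckeFiltration b ρ q α κ).GrPiece d)).map
        (e : (heckeFiltration b ρ q α κ).Gr →ₐ[ℂ] TwistedSkew σ α).toLinearMap
        = skewDegree b q σ α d

/-- The parameter space: the bilinear maps `κ : V × V → ℂ^α G` with
`κ(v_i,v_j) = -q_{ij} κ(v_j,v_i)` for which `H_{q,κ,α}` is a twisted quantum Drinfeld Hecke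
algebra, that is, satisfies the Poincaré–Birkhoff–Witt condition. -/
def parameterSpace (b : Module.Basis (Fin n) ℂ V) (ρ : Representation ℂ G V)
    (q : Fin n → Fin n → ℂ) (α : NormalizedTwoCocycle G)
    (σ : G →* (QSym b q ≃ₐ[ℂ] QSym b q)) : Set (V →ₗ[ℂ] V →ₗ[ℂ] TwistedGroupAlgebra α) :=
  {κ | (∀ i j, κ (b i) (b j) = -(q i j • κ (b j) (b i))) ∧ SatisfiesPBW b ρ q α σ κ}

/-- The set of twisted quantum Drinfeld Hecke algebras for `(G, V, q, α)`, where such an algebra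
is viewed as a quotient of `T(V) #_α G` and recorded through its defining ideal. -/
def heckeQuotients (b : Module.Basis (Fin n) ℂ V) (ρ : Representation ℂ G V)
    (q : Fin n → Fin n → ℂ) (α : NormalizedTwoCocycle G)
    (σ : G →* (QSym b q ≃ₐ[ℂ] QSym b q)) : Set (TwoSidedIdeal (TensorSkew ρ α)) :=
  {I | ∃ κ ∈ parameterSpace b ρ q α σ, heckeIdeal b ρ q α κ = I}

end Hecke

/-! ### Hochschild `2`-cocycles -/

section Hochschild

variable (R : Type*) [Ring R] [Algebra ℂ R]

/-- The Hochschild `2`-cocycles on `R`: bilinear maps `μ` with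
`a μ(b,c) + μ(a,bc) = μ(ab,c) + μ(a,b) c`. -/
def hochschildCocycles : Submodule ℂ (R →ₗ[ℂ] R →ₗ[ℂ] R) where
  carrier := {μ | ∀ a b c, a * μ b c + μ a (b * c) = μ (a * b) c + μ a b * c}
  zero_mem' := by intro a b c; simp
  add_mem' := by
    intro μ ν hμ hν a b c
    simp only [LinearMap.add_apply, mul_add, add_mul]
    rw [add_add_add_comm, hμ, hν, add_add_add_comm]
  smul_mem' := by
    intro r μ hμ a b c
    simp only [LinearMap.smul_apply, mul_smul_comm, smul_mul_assoc]
    rw [← smul_add, hμ, smul_add]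

/-- The Hochschild `2`-coboundaries on `R`: the maps `(a,b) ↦ a f(b) - f(ab) + f(a) b` for
linear maps `f : R → R`. -/
def hochschildCoboundaries : Submodule ℂ (R →ₗ[ℂ] R →ₗ[ℂ] R) where
  carrier := {μ | ∃ f : R →ₗ[ℂ] R, ∀ a b, μ a b = a * f b - f (a * b) + f a * b}
  zero_mem' := ⟨0, by intro a b; simp⟩
  add_mem' := by
    rintro μ ν ⟨f, hf⟩ ⟨g, hg⟩
    refine ⟨f + g, fun a b => ?_⟩
    simp only [LinearMap.add_apply, hf, hg, mul_add, add_mul]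
    abel
  smul_mem' := by
    rintro r μ ⟨f, hf⟩
    refine ⟨r • f, fun a b => ?_⟩
    simp only [LinearMap.smul_apply, hf, mul_smul_comm, smul_mul_assoc, smul_sub, smul_add]

end Hochschild

section Constant

variable {G : Type*} [Group G] {V : Type*} [AddCommGroup V] [Module ℂ V] {n : ℕ}

/-- The constant Hochschild `2`-cocycles on `S_q(V) #_α G`: those that map
(degree `d`) × (degree `e`) into degree `d + e - 2`, which is zero if `d + e < 2`. -/
def constantCocycles (b : Module.Basis (Fin n) ℂ V) (q : Fin n → Fin n → ℂ)
    (σ : G →* (QSym b q ≃ₐ[ℂ] QSym b q)) (α : NormalizedTwoCocycle G) :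
    Submodule ℂ (TwistedSkew σ α →ₗ[ℂ] TwistedSkew σ α →ₗ[ℂ] TwistedSkew σ α) where
  carrier := {μ | μ ∈ hochschildCocycles (TwistedSkew σ α) ∧
    ∀ d e : ℕ, ∀ x ∈ skewDegree b q σ α d, ∀ y ∈ skewDegree b q σ α e,
      (d + e < 2 → μ x y = 0) ∧ ∀ m : ℕ, m + 2 = d + e → μ x y ∈ skewDegree b q σ α m}
  zero_mem' := ⟨Submodule.zero_mem _, fun _ _ _ _ _ _ =>
    ⟨fun _ => rfl, fun _ _ => Submodule.zero_mem _⟩⟩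
  add_mem' := by
    rintro μ ν ⟨hμ, hμ'⟩ ⟨hν, hν'⟩
    refine ⟨Submodule.add_mem _ hμ hν, fun d e x hx y hy => ⟨fun h => ?_, fun m hm => ?_⟩⟩
    · rw [LinearMap.add_apply, LinearMap.add_apply, (hμ' d e x hx y hy).1 h,
        (hν' d e x hx y hy).1 h, add_zero]
    · exact Submodule.add_mem _ ((hμ' d e x hx y hy).2 m hm) ((hν' d e x hx y hy).2 m hm)
  smul_mem' := by
    rintro r μ ⟨hμ, hμ'⟩
    refine ⟨Submodule.smul_mem _ r hμ, fun d e x hx y hy => ⟨fun h => ?_, fun m hm => ?_⟩⟩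
    · rw [LinearMap.smul_apply, LinearMap.smul_apply, (hμ' d e x hx y hy).1 h, smul_zero]
    · exact Submodule.smul_mem _ r ((hμ' d e x hx y hy).2 m hm)

/-- Two constant Hochschild `2`-cocycles are equivalent if they are cohomologous, that is, if their
difference is a Hochschild coboundary. -/
def cohomologous (b : Module.Basis (Fin n) ℂ V) (q : Fin n → Fin n → ℂ)
    (σ : G →* (QSym b q ≃ₐ[ℂ] QSym b q)) (α : NormalizedTwoCocycle G) :
    Setoid (constantCocycles b q σ α) where
  r μ ν := μ.1 - ν.1 ∈ hochschildCoboundaries (TwistedSkew σ α)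
  iseqv :=
    { refl := fun μ => by rw [sub_self]; exact Submodule.zero_mem _
      symm := fun {μ ν} h => by rw [← neg_sub]; exact Submodule.neg_mem _ h
      trans := fun {μ ν ξ} h h' => by
        rw [← sub_add_sub_cancel μ.1 ν.1 ξ.1]; exact Submodule.add_mem _ h h' }

/-- The space of equivalence classes of constant Hochschild `2`-cocycles on `S_q(V) #_α G`. -/
abbrev ConstantClasses (b : Module.Basis (Fin n) ℂ V) (q : Fin n → Fin n → ℂ)
    (σ : G →* (QSym b q ≃ₐ[ℂ] QSym b q)) (α : NormalizedTwoCocycle G) : Type _ :=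
  Quotient (cohomologous b q σ α)

/-- The vector `v`, seen as an element of `S_q(V) #_α G`. -/
def skewVec (b : Module.Basis (Fin n) ℂ V) (q : Fin n → Fin n → ℂ)
    (σ : G →* (QSym b q ≃ₐ[ℂ] QSym b q)) (α : NormalizedTwoCocycle G) (v : V) :
    TwistedSkew σ α :=
  TwistedSkew.single σ α 1 (CommAlg.ι b q v)

/-- `κ` is the quantum skew-symmetrization of `μ`:
`κ(v_i,v_j) = μ(v_i,v_j) - q_{ij} μ(v_j,v_i)` for all `i, j`. -/
def IsQuantumSkewSymmetrization (b : Module.Basis (Fin n) ℂ V) (q : Fin n → Fin n → ℂ)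
    (σ : G →* (QSym b q ≃ₐ[ℂ] QSym b q)) (α : NormalizedTwoCocycle G)
    (μ : TwistedSkew σ α →ₗ[ℂ] TwistedSkew σ α →ₗ[ℂ] TwistedSkew σ α)
    (κ : V →ₗ[ℂ] V →ₗ[ℂ] TwistedGroupAlgebra α) : Prop :=
  ∀ i j : Fin n, inclGroupAlgebra σ α (κ (b i) (b j))
    = μ (skewVec b q σ α (b i)) (skewVec b q σ α (b j))
      - q i j • μ (skewVec b q σ α (b j)) (skewVec b q σ α (b i))

end Constant

end TQDHA

end

/-!
# Constant Hochschild cocycles and twisted quantum Drinfeld Hecke algebras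

Write `T = T(V) #_α G` and `S = S_q(V) #_α G`. The kernel of `T → S` is generated, as an ideal, by
the quadratic relations `r_{ij} = v_i v_j - q_{ij} v_j v_i`, and `H_{q,κ,α}` arises from `T` by
setting `r_{ij} = κ(v_i, v_j)`. Everything rests on a comparison of these two quotients.

**The Poincaré–Birkhoff–Witt condition concerns leading terms.** The canonical map `S → gr H_{q,κ,α}`
is surjective, because each homogeneous element of the kernel of `T → S` has lower degree in
`H_{q,κ,α}`. It is injective if and only if `LeadingTermsVanish` holds: a homogeneous element of `T`
that drops in degree modulo the defining ideal vanishes in `S`. In that case the canonical map is a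
graded isomorphism. Conversely, if there is any graded isomorphism `gr H_{q,κ,α} ≅ S`, then the
homogeneous components have equal finite dimensions, since `G` is finite, so the surjection is
injective (`leadingTermsVanish_of_satisfiesPBW`, `satisfiesPBW_of_leadingTermsVanish`).

**Cocycles give algebras.** A constant cocycle `μ` defines a square-zero extension of `S`. Since `μ`
has degree `-2`, it does not contribute to products of vectors with group elements, so `T → S` lifts
to a homomorphism from `T` to the extension, which sends `r_{ij}` to `ε κ(v_i, v_j)`, where `κ` is the
quantum skew-symmetrization of `μ`. The lift turns every identity `∑ a r_{ij} c = 0` in `T` into the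
identity `∑ a κ(v_i, v_j) c = 0` in `S`. For the action of the group on the relations and for the
overlaps `v_i v_j v_k` these identities have degree at most one, where `T` and `S` agree; they are
the conditions under which all overlaps of the rewriting rules
`v_j v_k ↦ q_{jk} v_k v_j + κ(v_j, v_k)`, for `k < j`, resolve (`overlapConditions`). Hence there is
a well-defined map from words to `S` that is compatible with all rewriting steps and has the expected
leading terms (`exists_normalForm`). It descends to `H_{q,κ,α}`, which gives `LeadingTermsVanish`
(`leadingTermsVanish_of_overlapConditions`).

**Algebras give cocycles.** If `LeadingTermsVanish` holds, then `∑ a r_{ij} c ↦ ∑ a κ(v_i, v_j) c` is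
a well-defined bimodule map from the kernel of `T → S` to `S`. Its value on the defect of
multiplicativity `s(a) s(c) - s(a c)` of a graded linear section `s` of `T → S` is a constant cocycle
with quantum skew-symmetrization `κ` (`exists_constantCocycle`).

**Classes.** Coboundaries have zero quantum skew-symmetrization, because their values on two vectors
are multiples of vectors up to a term that cancels (`skewSymm_eq_of_cohomologous`). If `μ` has zero
quantum skew-symmetrization, then the relations of `S` hold in its square-zero extension, so the
extension splits and `μ` is a coboundary (`mem_coboundaries_of_skewSymmetrization_eq_zero`). Finally,
`LeadingTermsVanish` in degree zero shows that the group algebra embeds into `H_{q,κ,α}`, so that the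
defining ideal determines `κ` (`eq_of_heckeIdeal_eq`).
-/

noncomputable section

namespace TQDHA

/-! ### Homogeneous components -/

section HomComp

variable {M : Type*} [AddCommGroup M] [Module ℂ M] (ℳ : ℕ → Submodule ℂ M)
  [DirectSum.Decomposition ℳ]

/-- The homogeneous component of degree `d`, as a linear endomorphism. -/
def homComp (d : ℕ) : M →ₗ[ℂ] M :=
  (ℳ d).subtype ∘ₗ DirectSum.component ℂ ℕ (fun i => ℳ i) d ∘ₗ
    (DirectSum.decomposeLinearEquiv ℳ).toLinearMap

theorem homComp_mem (d : ℕ) (x : M) : homComp ℳ d x ∈ ℳ d := (DirectSum.decompose ℳ x d).2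

theorem homComp_same {d : ℕ} {x : M} (hx : x ∈ ℳ d) : homComp ℳ d x = x :=
  DirectSum.decompose_of_mem_same ℳ hx

theorem homComp_ne {d e : ℕ} {x : M} (hx : x ∈ ℳ d) (h : d ≠ e) : homComp ℳ e x = 0 :=
  DirectSum.decompose_of_mem_ne ℳ hx h

theorem sum_homComp (x : M) : ∃ s : Finset ℕ, x = ∑ d ∈ s, homComp ℳ d x := by
  classical
  exact ⟨_, (DirectSum.sum_support_decompose ℳ x).symm⟩

theorem eq_zero_of_homComp {x : M} (h : ∀ d, homComp ℳ d x = 0) : x = 0 := by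
  obtain ⟨s, hs⟩ := sum_homComp ℳ x
  rw [hs]
  exact Finset.sum_eq_zero fun d _ => h d

/-- Linear maps can be prescribed independently on the homogeneous elements of each degree. -/
theorem exists_linearMap_homComp {N : Type*} [AddCommGroup N] [Module ℂ N]
    (f : ℕ → M →ₗ[ℂ] N) : ∃ F : M →ₗ[ℂ] N, ∀ d, ∀ x ∈ ℳ d, F x = f d x := by
  refine ⟨DirectSum.toModule ℂ ℕ N (fun d => f d ∘ₗ (ℳ d).subtype) ∘ₗ
    (DirectSum.decomposeLinearEquiv ℳ).toLinearMap, fun d x hx => ?_⟩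
  have : DirectSum.decompose ℳ x = DirectSum.lof ℂ ℕ (fun i => ℳ i) d ⟨x, hx⟩ :=
    DirectSum.decompose_of_mem ℳ hx
  simp only [LinearMap.comp_apply, LinearEquiv.coe_coe, DirectSum.decomposeLinearEquiv_apply,
    this, DirectSum.toModule_lof, Submodule.subtype_apply]

theorem homComp_of_mem_iSup_le {k d : ℕ} {x : M} (hx : x ∈ ⨆ e : Fin (k + 1), ℳ e) (h : k < d) :
    homComp ℳ d x = 0 := by
  have : (⨆ e : Fin (k + 1), ℳ e) ≤ LinearMap.ker (homComp ℳ d) :=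
    iSup_le fun e y hy => homComp_ne ℳ hy (by have := e.2; omega)
  exact this hx

end HomComp

namespace TwistedSkew

section Basic

variable {G : Type*} [Group G] {A : Type*} [Ring A] [Algebra ℂ A]
  (σ : G →* (A ≃ₐ[ℂ] A)) (α : NormalizedTwoCocycle G)

/-- The coefficient map `∑ a_g t_g ↦ a_g`. -/
def coeffL (g : G) : TwistedSkew σ α →ₗ[ℂ] A := Finsupp.lapply g

theorem coeffL_apply (g : G) (x : TwistedSkew σ α) : coeffL σ α g x = coeff σ α x g := rfl

theorem coeff_single_same (g : G) (a : A) : coeff σ α (single σ α g a) g = a :=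
  Finsupp.single_eq_same

theorem coeff_single_ne {g h : G} (hgh : g ≠ h) (a : A) : coeff σ α (single σ α g a) h = 0 :=
  Finsupp.single_eq_of_ne (Ne.symm hgh)

theorem coeff_zero (g : G) : coeff σ α 0 g = 0 := rfl

theorem eq_sum_single (x : TwistedSkew σ α) :
    ∃ s : Finset G, x = ∑ g ∈ s, single σ α g (coeff σ α x g) :=
  ⟨_, (Finsupp.sum_single (show G →₀ A from x)).symm⟩

variable {σ α} in
theorem linearMap_ext {M : Type*} [AddCommGroup M] [Module ℂ M] {f f' : TwistedSkew σ α →ₗ[ℂ] M}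
    (h : ∀ g a, f (single σ α g a) = f' (single σ α g a)) : f = f' :=
  Finsupp.lhom_ext h

theorem single_mem_coeffsIn (g : G) {W : Submodule ℂ A} {a : A} (ha : a ∈ W) :
    single σ α g a ∈ coeffsIn σ α W := by
  rw [coeffsIn_eq_iSup]
  exact Submodule.mem_iSup_of_mem g (Submodule.mem_map_of_mem ha)

/-- The inclusion `a ↦ a t_1` of the coefficient algebra. -/
def base : A →ₐ[ℂ] TwistedSkew σ α :=
  AlgHom.ofLinearMap (single σ α 1) rfl fun a c => by
    rw [single_mul_single]
    simp [α.one_left]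

theorem base_apply (a : A) : base σ α a = single σ α 1 a := rfl

/-- The basis element `t_g`. -/
def t (g : G) : TwistedSkew σ α := single σ α g 1

theorem t_one : t σ α 1 = 1 := rfl

theorem base_mul_t (a : A) (g : G) : base σ α a * t σ α g = single σ α g a := by
  rw [base_apply, t, single_mul_single]
  simp [α.one_left]

theorem t_mul_base (g : G) (a : A) : t σ α g * base σ α a = single σ α g (σ g a) := by
  rw [base_apply, t, single_mul_single]
  simp [α.one_right]

theorem t_mul_base' (g : G) (a : A) :
    t σ α g * base σ α a = base σ α (σ g a) * t σ α g := by
  rw [t_mul_base, base_mul_t]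

theorem t_mul_t (g h : G) : t σ α g * t σ α h = (α.toFun g h : ℂ) • t σ α (g * h) := by
  rw [t, t, t, single_mul_single, ← map_smul]
  simp

theorem single_mul_t (g h : G) (a : A) :
    single σ α g a * t σ α h = single σ α (g * h) ((α.toFun g h : ℂ) • a) := by
  rw [t, single_mul_single]
  simp

theorem t_mem_coeffsIn (g : G) {W : Submodule ℂ A} (h : (1 : A) ∈ W) :
    t σ α g ∈ coeffsIn σ α W := single_mem_coeffsIn σ α g h

theorem coeff_mul_t (x : TwistedSkew σ α) (g h : G) :
    coeff σ α (x * t σ α h) g = (α.toFun (g * h⁻¹) h : ℂ) • coeff σ α x (g * h⁻¹) := by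
  induction x using induction_on with
  | h0 => rw [zero_mul, coeff_zero, coeff_zero, smul_zero]
  | hadd x y hx hy =>
    rw [add_mul]
    change coeff σ α (x * t σ α h) g + coeff σ α (y * t σ α h) g
      = _ • (coeff σ α x _ + coeff σ α y _)
    rw [hx, hy, smul_add]
  | hs k a =>
    rw [single_mul_t]
    by_cases hk : k * h = g
    · subst hk
      rw [coeff_single_same, mul_inv_cancel_right, coeff_single_same]
    · rw [coeff_single_ne _ _ hk, coeff_single_ne, smul_zero]
      rintro rfl
      exact hk (inv_mul_cancel_right _ _)

/-- The universal property of `A #_α G`: an algebra homomorphism `f` on `A` together with elements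
`u_g` that multiply as the `t_g` do and satisfy `u_g f(a) = f(ᵍa) u_g`. -/
def liftAlgHom {E : Type*} [Ring E] [Algebra ℂ E] (f : A →ₐ[ℂ] E) (u : G → E) (h1 : u 1 = 1)
    (hmul : ∀ g h, u g * u h = (α.toFun g h : ℂ) • u (g * h))
    (hcomm : ∀ g a, u g * f a = f (σ g a) * u g) : TwistedSkew σ α →ₐ[ℂ] E :=
  AlgHom.ofLinearMap (lift σ α fun g => LinearMap.mulRight ℂ (u g) ∘ₗ f.toLinearMap)
    (by rw [one_def, lift_single]; simp [h1])
    (fun x y => by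
      induction x using induction_on with
      | h0 => simp
      | hadd x x' hx hx' => rw [add_mul, map_add, hx, hx', map_add, add_mul]
      | hs g a =>
        induction y using induction_on with
        | h0 => simp
        | hadd y y' hy hy' => rw [mul_add, map_add, hy, hy', map_add, mul_add]
        | hs h c =>
          rw [single_mul_single, lift_single, lift_single, lift_single]
          simp only [LinearMap.comp_apply, LinearMap.mulRight_apply, AlgHom.toLinearMap_apply,
            map_smul, map_mul]
          rw [mul_assoc (f a) (u g), ← mul_assoc (u g), hcomm, mul_assoc (f (σ g c)), hmul,
            mul_smul_comm, mul_smul_comm, mul_assoc])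

theorem liftAlgHom_single {E : Type*} [Ring E] [Algebra ℂ E] (f : A →ₐ[ℂ] E) (u : G → E)
    (h1 : u 1 = 1) (hmul : ∀ g h, u g * u h = (α.toFun g h : ℂ) • u (g * h))
    (hcomm : ∀ g a, u g * f a = f (σ g a) * u g) (g : G) (a : A) :
    liftAlgHom σ α f u h1 hmul hcomm (single σ α g a) = f a * u g :=
  lift_single σ α _ g a

end Basic

section Map

variable {G : Type*} [Group G] {A A' : Type*} [Ring A] [Algebra ℂ A] [Ring A'] [Algebra ℂ A']
  {σ : G →* (A ≃ₐ[ℂ] A)} {σ' : G →* (A' ≃ₐ[ℂ] A')} (α : NormalizedTwoCocycle G)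

/-- The homomorphism `A #_α G → A' #_α G` induced by a `G`-equivariant homomorphism `A → A'`. -/
def mapAlgHom (f : A →ₐ[ℂ] A') (hf : ∀ g a, f (σ g a) = σ' g (f a)) :
    TwistedSkew σ α →ₐ[ℂ] TwistedSkew σ' α :=
  liftAlgHom σ α ((base σ' α).comp f) (t σ' α) (t_one σ' α) (t_mul_t σ' α)
    (fun g a => by
      rw [AlgHom.comp_apply, t_mul_base', AlgHom.comp_apply, hf])

variable (f : A →ₐ[ℂ] A') (hf : ∀ g a, f (σ g a) = σ' g (f a))

theorem mapAlgHom_single (g : G) (a : A) :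
    mapAlgHom α f hf (single σ α g a) = single σ' α g (f a) := by
  rw [mapAlgHom, liftAlgHom_single, AlgHom.comp_apply, base_mul_t]

theorem coeff_mapAlgHom (x : TwistedSkew σ α) (g : G) :
    coeff σ' α (mapAlgHom α f hf x) g = f (coeff σ α x g) := by
  have : coeffL σ' α g ∘ₗ (mapAlgHom α f hf).toLinearMap = f.toLinearMap ∘ₗ coeffL σ α g := by
    refine linearMap_ext fun h a => ?_
    simp only [LinearMap.comp_apply, AlgHom.toLinearMap_apply, mapAlgHom_single, coeffL_apply]
    by_cases hg : h = g
    · subst hg; rw [coeff_single_same, coeff_single_same]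
    · rw [coeff_single_ne _ _ hg, coeff_single_ne _ _ hg, map_zero]
  exact LinearMap.congr_fun this x

theorem mapAlgHom_t (g : G) : mapAlgHom α f hf (t σ α g) = t σ' α g := by
  rw [t, mapAlgHom_single, map_one]; rfl

theorem map_coeffsIn (W : Submodule ℂ A) :
    (coeffsIn σ α W).map (mapAlgHom α f hf).toLinearMap
      = coeffsIn σ' α (W.map f.toLinearMap) := by
  rw [coeffsIn_eq_iSup, coeffsIn_eq_iSup, Submodule.map_iSup]
  refine iSup_congr fun g => ?_
  rw [← Submodule.map_comp, ← Submodule.map_comp]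
  congr 1
  ext a : 1
  exact mapAlgHom_single α f hf g a

end Map

section Grading

variable {G : Type*} [Group G] {A : Type*} [Ring A] [Algebra ℂ A]
  (σ : G →* (A ≃ₐ[ℂ] A)) (α : NormalizedTwoCocycle G) (𝒜 : ℕ → Submodule ℂ A)

/-- A grading of the vector space `A` induces the grading of `A #_α G` in which group elements have
degree zero. -/
instance decompositionCoeffsIn [DirectSum.Decomposition 𝒜] :
    DirectSum.Decomposition (fun d => coeffsIn σ α (𝒜 d)) :=
  DirectSum.Decomposition.ofLinearMap _
    (lift σ α fun g => DirectSum.toModule ℂ ℕ _ (fun d =>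
      DirectSum.lof ℂ ℕ (fun d => coeffsIn σ α (𝒜 d)) d ∘ₗ
        (single σ α g ∘ₗ (𝒜 d).subtype).codRestrict _
          (fun a => single_mem_coeffsIn σ α g a.2)) ∘ₗ
      (DirectSum.decomposeLinearEquiv 𝒜).toLinearMap)
    (by
      refine linearMap_ext fun g a => ?_
      simp only [LinearMap.comp_apply, lift_single, LinearMap.id_apply]
      induction a using DirectSum.Decomposition.inductionOn 𝒜 with
      | zero => simp
      | add x y hx hy => rw [map_add, map_add, map_add, hx, hy, map_add]
      | homogeneous a => simp)
    (by
      refine DirectSum.linearMap_ext ℂ fun d => ?_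
      ext1 ⟨x, hx⟩
      simp only [LinearMap.comp_apply, LinearMap.id_apply, DirectSum.coeLinearMap_lof]
      obtain ⟨s, hs⟩ := eq_sum_single σ α x
      have key : ∀ g : G, lift σ α (fun g => DirectSum.toModule ℂ ℕ _ (fun d =>
        DirectSum.lof ℂ ℕ (fun d => coeffsIn σ α (𝒜 d)) d ∘ₗ
          (single σ α g ∘ₗ (𝒜 d).subtype).codRestrict _
            (fun a => single_mem_coeffsIn σ α g a.2)) ∘ₗ
          (DirectSum.decomposeLinearEquiv 𝒜).toLinearMap) (single σ α g (coeff σ α x g))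
          = DirectSum.lof ℂ ℕ (fun d => coeffsIn σ α (𝒜 d)) d
            ⟨single σ α g (coeff σ α x g), single_mem_coeffsIn σ α g (hx g)⟩ := by
        intro g
        have : DirectSum.decompose 𝒜 (coeff σ α x g)
            = DirectSum.lof ℂ ℕ (fun i => 𝒜 i) d ⟨_, hx g⟩ :=
          DirectSum.decompose_of_mem 𝒜 (hx g)
        rw [lift_single]
        simp only [LinearMap.comp_apply, LinearEquiv.coe_coe,
          DirectSum.decomposeLinearEquiv_apply, this, DirectSum.toModule_lof]
        rfl
      conv_lhs => rw [hs]
      rw [map_sum, Finset.sum_congr rfl fun g _ => key g, ← map_sum]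
      congr 1
      ext
      simp only [AddSubmonoidClass.coe_finsetSum]
      exact hs.symm)

end Grading

end TwistedSkew

/-! ### Words, quadratic relations and the grading of the quantum symmetric algebra -/

section Words

variable {V : Type*} [AddCommGroup V] [Module ℂ V] {n : ℕ} (b : Module.Basis (Fin n) ℂ V)

/-- The homogeneous tensors of degree `d`. -/
def tensorDegree (V : Type*) [AddCommGroup V] [Module ℂ V] (d : ℕ) :
    Submodule ℂ (TensorAlgebra ℂ V) :=
  LinearMap.range (TensorAlgebra.ι ℂ : V →ₗ[ℂ] TensorAlgebra ℂ V) ^ d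

instance : GradedAlgebra (tensorDegree V) := TensorAlgebra.gradedAlgebra

theorem tensorLE_eq (k : ℕ) : tensorLE V k = ⨆ d : Fin (k + 1), tensorDegree V d := rfl

theorem ι_mem_tensorDegree (v : V) : TensorAlgebra.ι ℂ v ∈ tensorDegree V 1 := by
  rw [tensorDegree, pow_one]
  exact ⟨v, rfl⟩

theorem mul_mem_tensorDegree {d e : ℕ} {x y : TensorAlgebra ℂ V} (hx : x ∈ tensorDegree V d)
    (hy : y ∈ tensorDegree V e) : x * y ∈ tensorDegree V (d + e) :=
  SetLike.mul_mem_graded hx hy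

theorem tensorAction_mem_tensorDegree {G : Type*} [Group G] (ρ : Representation ℂ G V) (g : G)
    {d : ℕ} {x : TensorAlgebra ℂ V} (hx : x ∈ tensorDegree V d) :
    tensorAction ρ g x ∈ tensorDegree V d := by
  have h : (tensorDegree V d).map (tensorAction ρ g : _ →ₐ[ℂ] _).toLinearMap
      ≤ tensorDegree V d := by
    rw [tensorDegree, Submodule.map_pow]
    refine pow_le_pow_left' ?_ d
    rintro _ ⟨_, ⟨v, rfl⟩, rfl⟩
    exact ⟨ρ g v, (tensorAction_ι ρ g v).symm⟩
  exact h (Submodule.mem_map_of_mem hx)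

/-- The generator `v_i` of `T(V)`. -/
def gen (i : Fin n) : TensorAlgebra ℂ V := TensorAlgebra.ι ℂ (b i)

/-- The monomial `v_{i_1} ⋯ v_{i_d}` of `T(V)`. -/
def word (l : List (Fin n)) : TensorAlgebra ℂ V := (l.map (gen b)).prod

theorem word_nil : word b [] = 1 := rfl

theorem word_cons (i : Fin n) (l : List (Fin n)) : word b (i :: l) = gen b i * word b l :=
  List.prod_cons

theorem word_append (l l' : List (Fin n)) : word b (l ++ l') = word b l * word b l' := by
  rw [word, word, word, List.map_append, List.prod_append]

theorem gen_mem (i : Fin n) : gen b i ∈ tensorDegree V 1 := ι_mem_tensorDegree _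

theorem word_mem (l : List (Fin n)) : word b l ∈ tensorDegree V l.length := by
  induction l with
  | nil => exact SetLike.one_mem_graded (tensorDegree V)
  | cons i l ih =>
    rw [word_cons, List.length_cons, add_comm]
    exact mul_mem_tensorDegree (gen_mem b i) ih

/-- The basis of `T(V)` that consists of the monomials in the basis vectors of `V`. -/
def wordBasis : Module.Basis (List (Fin n)) ℂ (TensorAlgebra ℂ V) :=
  b.tensorAlgebra.reindex FreeMonoid.toList

theorem wordBasis_apply (l : List (Fin n)) : wordBasis b l = word b l := by
  rw [wordBasis, Module.Basis.reindex_apply, Module.Basis.tensorAlgebra, Module.Basis.map_apply]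
  have h : FreeAlgebra.basisFreeMonoid ℂ (Fin n) (FreeMonoid.toList.symm l)
      = (l.map (FreeAlgebra.ι ℂ)).prod := by
    simp [FreeAlgebra.basisFreeMonoid, FreeAlgebra.equivMonoidAlgebraFreeMonoid]
  rw [h]
  simp only [AlgEquiv.toLinearEquiv_apply, map_list_prod, List.map_map, word]
  congr 2
  ext i
  simp [gen]

theorem tensorDegree_eq_span (d : ℕ) :
    tensorDegree V d = Submodule.span ℂ {x | ∃ l : List (Fin n), l.length = d ∧ x = word b l} := by
  apply le_antisymm
  · induction d with
    | zero =>
      rw [tensorDegree, pow_zero, Submodule.one_eq_span]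
      refine Submodule.span_mono ?_
      rintro _ rfl
      exact ⟨[], rfl, rfl⟩
    | succ d ih =>
      rw [tensorDegree, pow_succ']
      refine (mul_le_mul_right ih _).trans ?_
      have hV : LinearMap.range (TensorAlgebra.ι ℂ : V →ₗ[ℂ] TensorAlgebra ℂ V)
          = Submodule.span ℂ (Set.range (gen b)) := by
        rw [← Submodule.map_top, ← b.span_eq, Submodule.map_span, ← Set.range_comp]
        rfl
      rw [hV, Submodule.span_mul_span]
      refine Submodule.span_mono ?_
      rintro _ ⟨_, ⟨i, rfl⟩, _, ⟨l, rfl, rfl⟩, rfl⟩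
      exact ⟨i :: l, rfl, (word_cons b i l).symm⟩
  · rw [Submodule.span_le]
    rintro _ ⟨l, rfl, rfl⟩
    exact word_mem b l

theorem span_word : Submodule.span ℂ (Set.range (word b)) = ⊤ := by
  rw [← (wordBasis b).span_eq]
  congr 2
  ext l
  exact (wordBasis_apply b l).symm

variable (q : Fin n → Fin n → ℂ)

/-- The quadratic relation `v_i v_j - q_{ij} v_j v_i`. -/
def quadRel (i j : Fin n) : TensorAlgebra ℂ V := gen b i * gen b j - q i j • (gen b j * gen b i)

theorem quadRel_mem (i j : Fin n) : quadRel b q i j ∈ tensorDegree V 2 :=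
  Submodule.sub_mem _ (mul_mem_tensorDegree (gen_mem b i) (gen_mem b j))
    (Submodule.smul_mem _ _ (mul_mem_tensorDegree (gen_mem b j) (gen_mem b i)))

/-- The span of the elements `u (v_i v_j - q_{ij} v_j v_i) w` with monomials `u`, `w`. -/
def relSpan : Submodule ℂ (TensorAlgebra ℂ V) :=
  Submodule.span ℂ {x | ∃ u i j w, x = word b u * quadRel b q i j * word b w}

theorem mul_mem_relSpan {x : TensorAlgebra ℂ V} (y : TensorAlgebra ℂ V) (hx : x ∈ relSpan b q) :
    y * x ∈ relSpan b q := by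
  have hy : y ∈ Submodule.span ℂ (Set.range (word b)) := by rw [span_word]; trivial
  have := Submodule.mul_mem_mul hy hx
  rw [relSpan, Submodule.span_mul_span] at this
  refine Submodule.span_mono ?_ this
  rintro _ ⟨_, ⟨l, rfl⟩, _, ⟨u, i, j, w, rfl⟩, rfl⟩
  exact ⟨l ++ u, i, j, w, by simp only [word_append, mul_assoc]⟩

theorem mem_relSpan_mul {x : TensorAlgebra ℂ V} (y : TensorAlgebra ℂ V) (hx : x ∈ relSpan b q) :
    x * y ∈ relSpan b q := by
  have hy : y ∈ Submodule.span ℂ (Set.range (word b)) := by rw [span_word]; trivial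
  have := Submodule.mul_mem_mul hx hy
  rw [relSpan, Submodule.span_mul_span] at this
  refine Submodule.span_mono ?_ this
  rintro _ ⟨_, ⟨u, i, j, w, rfl⟩, _, ⟨l, rfl⟩, rfl⟩
  exact ⟨u, i, j, w ++ l, by simp only [word_append, mul_assoc]⟩

/-- The projection `T(V) → S_q(V)`. -/
def symMk : TensorAlgebra ℂ V →ₐ[ℂ] QSym b q := RingQuot.mkAlgHom ℂ (CommRel b q)

theorem symMk_surjective : Function.Surjective (symMk b q) := RingQuot.mkAlgHom_surjective ℂ _

theorem symMk_ι (v : V) : symMk b q (TensorAlgebra.ι ℂ v) = CommAlg.ι b q v := rfl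

theorem symMk_quadRel (i j : Fin n) : symMk b q (quadRel b q i j) = 0 := by
  have := RingQuot.mkAlgHom_rel ℂ (CommRel.rel (b := b) (c := q) i j)
  rw [quadRel, map_sub, sub_eq_zero]
  exact this

/-- The kernel of `T(V) → S_q(V)` is spanned by the multiples of the quadratic relations. -/
theorem mem_relSpan_of_symMk_eq_zero {x : TensorAlgebra ℂ V} (hx : symMk b q x = 0) :
    x ∈ relSpan b q := by
  let I : TwoSidedIdeal (TensorAlgebra ℂ V) :=
    TwoSidedIdeal.mk' (relSpan b q) (Submodule.zero_mem _) (Submodule.add_mem _)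
      (Submodule.neg_mem _) (mul_mem_relSpan b q _) (mem_relSpan_mul b q _)
  have hI : ∀ y, y ∈ I ↔ y ∈ relSpan b q := fun y => TwoSidedIdeal.mem_mk' _ _ _ _ _ _ _
  let π : TensorAlgebra ℂ V →ₐ[ℂ] I.ringCon.Quotient :=
    { I.ringCon.mk' with commutes' := fun _ => rfl }
  have hπ : ∀ y z, π y = π z ↔ y - z ∈ relSpan b q := fun y z => by
    rw [← hI, ← TwoSidedIdeal.rel_iff]
    exact RingCon.eq _
  let f : QSym b q →ₐ[ℂ] I.ringCon.Quotient := RingQuot.liftAlgHom ℂ ⟨π, by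
    rintro _ _ ⟨i, j⟩
    rw [hπ]
    exact Submodule.subset_span ⟨[], i, j, [], by rw [word_nil, one_mul, mul_one]; rfl⟩⟩
  have hf : ∀ y, f (symMk b q y) = π y := fun y => RingQuot.liftAlgHom_mkAlgHom_apply ℂ _ _ _
  have := hf x
  rw [hx, map_zero, ← map_zero π, eq_comm, hπ, sub_zero] at this
  exact this

/-- The relations of `S_q(V)` in degree two are the linear combinations of the quadratic relations
that define it. -/
theorem exists_eq_sum_quadRel {x : TensorAlgebra ℂ V} (hx : x ∈ tensorDegree V 2)
    (h : symMk b q x = 0) :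
    ∃ C : Fin n → Fin n → ℂ, x = ∑ k, ∑ l, C k l • quadRel b q k l := by
  let W : Submodule ℂ (TensorAlgebra ℂ V) :=
    Submodule.span ℂ (Set.range fun p : Fin n × Fin n => quadRel b q p.1 p.2)
  have key : relSpan b q ≤ W.comap (homComp (tensorDegree V) 2) := by
    rw [relSpan, Submodule.span_le]
    rintro _ ⟨u, i, j, w, rfl⟩
    have hd := mul_mem_tensorDegree (mul_mem_tensorDegree (word_mem b u) (quadRel_mem b q i j))
      (word_mem b w)
    change homComp _ 2 _ ∈ W
    by_cases hl : u.length + 2 + w.length = 2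
    · have hu : u = [] := List.length_eq_zero_iff.1 (by omega)
      have hw : w = [] := List.length_eq_zero_iff.1 (by omega)
      subst hu hw
      rw [word_nil, one_mul, mul_one, homComp_same _ (quadRel_mem b q i j)]
      exact Submodule.subset_span ⟨(i, j), rfl⟩
    · rw [homComp_ne _ hd hl]
      exact Submodule.zero_mem _
  have := key (mem_relSpan_of_symMk_eq_zero b q h)
  rw [Submodule.mem_comap, homComp_same _ hx] at this
  obtain ⟨c, hc⟩ := (Submodule.mem_span_range_iff_exists_fun ℂ).1 this
  refine ⟨fun k l => c (k, l), ?_⟩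
  rw [← hc, Fintype.sum_prod_type]

theorem map_symMk_tensorDegree (d : ℕ) :
    (tensorDegree V d).map (symMk b q).toLinearMap = QSym.degree b q d := by
  rw [tensorDegree, QSym.degree, Submodule.map_pow, ← LinearMap.range_comp]
  rfl

theorem symMk_mem_degree {d : ℕ} {x : TensorAlgebra ℂ V} (hx : x ∈ tensorDegree V d) :
    symMk b q x ∈ QSym.degree b q d := by
  rw [← map_symMk_tensorDegree]
  exact Submodule.mem_map_of_mem hx

instance : SetLike.GradedMonoid (QSym.degree b q) := Submodule.nat_power_gradedMonoid _

/-- The degree one generators of `S_q(V)`, in the direct sum of its homogeneous parts. -/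
def gradedι : V →ₗ[ℂ] ⨁ d, QSym.degree b q d :=
  DirectSum.lof ℂ ℕ (fun d => QSym.degree b q d) 1 ∘ₗ (CommAlg.ι b q).codRestrict _
    (fun v => by rw [← symMk_ι]; exact symMk_mem_degree b q (ι_mem_tensorDegree v))

theorem lift_gradedι_rel ⦃x y : TensorAlgebra ℂ V⦄ (h : CommRel b q x y) :
    TensorAlgebra.lift ℂ (gradedι b q) x = TensorAlgebra.lift ℂ (gradedι b q) y := by
  obtain ⟨i, j⟩ := h
  simp only [map_mul, map_smul, TensorAlgebra.lift_ι_apply]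
  simp only [gradedι, LinearMap.comp_apply, DirectSum.lof_eq_of, DirectSum.of_mul_of]
  rw [← DirectSum.lof_eq_of ℂ, ← DirectSum.lof_eq_of ℂ, ← map_smul]
  congr 1
  ext
  have := symMk_quadRel b q i j
  rw [quadRel, map_sub, sub_eq_zero, map_smul, map_mul, map_mul] at this
  exact this

/-- `S_q(V)` is graded because its relations are homogeneous. -/
instance : GradedAlgebra (QSym.degree b q) :=
  GradedAlgebra.ofAlgHom _
    (RingQuot.liftAlgHom ℂ ⟨TensorAlgebra.lift ℂ (gradedι b q), lift_gradedι_rel b q⟩)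
    (by
      ext v
      simp only [LinearMap.comp_apply, AlgHom.toLinearMap_apply, AlgHom.comp_apply,
        AlgHom.id_apply, RingQuot.liftAlgHom_mkAlgHom_apply, TensorAlgebra.lift_ι_apply, gradedι,
        DirectSum.lof_eq_of, DirectSum.coeAlgHom_of]
      rfl)
    (fun d x => by
      obtain ⟨x, hx⟩ := x
      simp only
      induction hx using Submodule.pow_induction_on_left' with
      | algebraMap r =>
        rw [AlgHom.commutes, DirectSum.algebraMap_apply]; rfl
      | add x y i hx hy ihx ihy =>
        rw [map_add, ihx, ihy, ← map_add]
        rfl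
      | mem_mul m hm i x hx ih =>
        obtain ⟨v, rfl⟩ := hm
        have h1 := (RingQuot.liftAlgHom_mkAlgHom_apply ℂ (s := CommRel b q) _
          (lift_gradedι_rel b q) (TensorAlgebra.ι ℂ v)).trans (TensorAlgebra.lift_ι_apply _ _)
        rw [map_mul, ih]
        refine (congrArg (· * _) h1).trans ?_
        rw [gradedι, LinearMap.comp_apply, DirectSum.lof_eq_of, DirectSum.of_mul_of]
        exact DirectSum.of_eq_of_gradedMonoid_eq (Sigma.subtype_ext (add_comm _ _) rfl))

end Words

/-! ### The projection of `T(V) #_α G` onto `S_q(V) #_α G` -/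

section Skew

open TwistedSkew

variable {G : Type*} [Group G] {V : Type*} [AddCommGroup V] [Module ℂ V] {n : ℕ}
  (b : Module.Basis (Fin n) ℂ V) (ρ : Representation ℂ G V) (q : Fin n → Fin n → ℂ)
  (α : NormalizedTwoCocycle G)

/-- The homogeneous elements of degree `d` of `T(V) #_α G`. -/
def tensorSkewDegree (d : ℕ) : Submodule ℂ (TensorSkew ρ α) :=
  coeffsIn _ α (tensorDegree V d)

instance : DirectSum.Decomposition (tensorSkewDegree ρ α) :=
  decompositionCoeffsIn (tensorAction ρ) α (tensorDegree V)

instance (σ : G →* (QSym b q ≃ₐ[ℂ] QSym b q)) :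
    DirectSum.Decomposition (skewDegree b q σ α) :=
  decompositionCoeffsIn σ α (QSym.degree b q)

variable {ρ α}

theorem mul_mem_tensorSkewDegree {d e : ℕ} {x y : TensorSkew ρ α}
    (hx : x ∈ tensorSkewDegree ρ α d) (hy : y ∈ tensorSkewDegree ρ α e) :
    x * y ∈ tensorSkewDegree ρ α (d + e) := by
  obtain ⟨s, hs⟩ := eq_sum_single _ α x
  obtain ⟨s', hs'⟩ := eq_sum_single _ α y
  rw [hs, hs', Finset.sum_mul_sum]
  refine Submodule.sum_mem _ fun g _ => Submodule.sum_mem _ fun h _ => ?_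
  rw [single_mul_single]
  exact single_mem_coeffsIn _ _ _ (Submodule.smul_mem _ _
    (mul_mem_tensorDegree (hx g) (tensorAction_mem_tensorDegree ρ g (hy h))))

theorem base_mem {d : ℕ} {a : TensorAlgebra ℂ V} (ha : a ∈ tensorDegree V d) :
    base _ α a ∈ tensorSkewDegree ρ α d := single_mem_coeffsIn _ _ _ ha

theorem t_mem (g : G) : t _ α g ∈ tensorSkewDegree ρ α 0 :=
  t_mem_coeffsIn _ _ _ (SetLike.one_mem_graded (tensorDegree V))

theorem filtration_eq (k : ℕ) :
    (tensorSkewFiltration ρ α).F k = ⨆ d : Fin (k + 1), tensorSkewDegree ρ α d := by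
  change coeffsIn _ α (tensorLE V k) = ⨆ d : Fin (k + 1), coeffsIn _ α (tensorDegree V d)
  simp only [coeffsIn_eq_iSup, tensorLE_eq, Submodule.map_iSup]
  rw [iSup_comm]

theorem degree_le_filtration {d k : ℕ} (h : d ≤ k) :
    tensorSkewDegree ρ α d ≤ (tensorSkewFiltration ρ α).F k := by
  rw [filtration_eq]
  exact le_iSup (fun d : Fin (k + 1) => tensorSkewDegree ρ α d) ⟨d, Nat.lt_succ_of_le h⟩

theorem homComp_eq_zero_of_mem_filtration {d k : ℕ} {x : TensorSkew ρ α}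
    (hx : x ∈ (tensorSkewFiltration ρ α).F k) (h : k < d) :
    homComp (tensorSkewDegree ρ α) d x = 0 := by
  rw [filtration_eq] at hx
  exact homComp_of_mem_iSup_le _ hx h

theorem homComp_eq_zero_of_mem_prev {d : ℕ} {x : TensorSkew ρ α}
    (hx : x ∈ (tensorSkewFiltration ρ α).prev d) :
    homComp (tensorSkewDegree ρ α) d x = 0 := by
  cases d with
  | zero =>
    rw [AlgFiltration.prev, Submodule.mem_bot] at hx
    rw [hx, map_zero]
  | succ d => exact homComp_eq_zero_of_mem_filtration hx (Nat.lt_succ_self d)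

theorem sub_homComp_mem_prev {d : ℕ} {x : TensorSkew ρ α}
    (hx : x ∈ (tensorSkewFiltration ρ α).F d) :
    x - homComp (tensorSkewDegree ρ α) d x ∈ (tensorSkewFiltration ρ α).prev d := by
  have key : (tensorSkewFiltration ρ α).F d ≤ ((tensorSkewFiltration ρ α).prev d).comap
      (LinearMap.id - homComp (tensorSkewDegree ρ α) d) := by
    rw [filtration_eq]
    refine iSup_le fun e y hy => ?_
    change y - homComp (tensorSkewDegree ρ α) d y ∈ (tensorSkewFiltration ρ α).prev d
    rcases (Nat.le_of_lt_succ e.2).lt_or_eq with h | h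
    · rw [homComp_ne (tensorSkewDegree ρ α) hy h.ne, sub_zero]
      cases d with
      | zero => omega
      | succ d => exact degree_le_filtration (Nat.le_of_lt_succ h) hy
    · rw [h] at hy
      rw [homComp_same (tensorSkewDegree ρ α) hy, sub_self]
      exact Submodule.zero_mem _
  exact key hx

variable {q} {σ : G →* (QSym b q ≃ₐ[ℂ] QSym b q)}

theorem symMk_tensorAction (hσ : ExtendsAction b q ρ σ) (g : G) (a : TensorAlgebra ℂ V) :
    symMk b q (tensorAction ρ g a) = σ g (symMk b q a) := by
  have : (symMk b q).comp (tensorAction ρ g : _ →ₐ[ℂ] _)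
      = (σ g : _ →ₐ[ℂ] _).comp (symMk b q) := by
    apply TensorAlgebra.hom_ext
    ext v
    change symMk b q (tensorAction ρ g (TensorAlgebra.ι ℂ v))
      = σ g (symMk b q (TensorAlgebra.ι ℂ v))
    rw [tensorAction_ι, symMk_ι, symMk_ι, hσ]
  exact DFunLike.congr_fun this a

variable (α) in
/-- The projection `T(V) #_α G → S_q(V) #_α G`. -/
def skewMk (hσ : ExtendsAction b q ρ σ) : TensorSkew ρ α →ₐ[ℂ] TwistedSkew σ α :=
  mapAlgHom α (symMk b q) (symMk_tensorAction b hσ)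

variable (hσ : ExtendsAction b q ρ σ)

theorem skewMk_single (g : G) (a : TensorAlgebra ℂ V) :
    skewMk b α hσ (single _ α g a) = single σ α g (symMk b q a) := mapAlgHom_single _ _ _ _ _

theorem skewMk_base (a : TensorAlgebra ℂ V) :
    skewMk b α hσ (base _ α a) = base σ α (symMk b q a) := mapAlgHom_single _ _ _ _ _

theorem skewMk_t (g : G) : skewMk b α hσ (t _ α g) = t σ α g := mapAlgHom_t _ _ _ _

theorem map_skewMk_degree (d : ℕ) :
    (tensorSkewDegree ρ α d).map (skewMk b α hσ).toLinearMap = skewDegree b q σ α d := by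
  rw [skewDegree, ← map_symMk_tensorDegree]
  exact map_coeffsIn _ _ _ _

theorem skewMk_mem_degree {d : ℕ} {x : TensorSkew ρ α} (hx : x ∈ tensorSkewDegree ρ α d) :
    skewMk b α hσ x ∈ skewDegree b q σ α d := by
  rw [← map_skewMk_degree b hσ]
  exact Submodule.mem_map_of_mem hx

theorem skewMk_surjective : Function.Surjective (skewMk b α hσ) := by
  intro y
  induction y using induction_on with
  | h0 => exact ⟨0, map_zero _⟩
  | hadd x y hx hy =>
    obtain ⟨x, rfl⟩ := hx
    obtain ⟨y, rfl⟩ := hy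
    exact ⟨x + y, map_add _ _ _⟩
  | hs g a =>
    obtain ⟨a, rfl⟩ := symMk_surjective b q a
    exact ⟨single _ α g a, skewMk_single b hσ g a⟩

theorem homComp_skewMk (d : ℕ) (x : TensorSkew ρ α) :
    homComp (skewDegree b q σ α) d (skewMk b α hσ x)
      = skewMk b α hσ (homComp (tensorSkewDegree ρ α) d x) := by
  induction x using DirectSum.Decomposition.inductionOn (tensorSkewDegree ρ α) with
  | zero => simp
  | add x y hx hy => simp only [map_add, hx, hy]
  | @homogeneous e x =>
    by_cases h : e = d
    · subst h
      rw [homComp_same _ x.2, homComp_same _ (skewMk_mem_degree b hσ x.2)]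
    · rw [homComp_ne _ x.2 h, homComp_ne _ (skewMk_mem_degree b hσ x.2) h, map_zero]

theorem coeff_skewMk (x : TensorSkew ρ α) (g : G) :
    coeff σ α (skewMk b α hσ x) g = symMk b q (coeff _ α x g) := coeff_mapAlgHom _ _ _ _ _

/-! ### The group algebra in degree zero -/

section Incl

variable {A : Type*} [Ring A] [Algebra ℂ A] (τ : G →* (A ≃ₐ[ℂ] A))

theorem inclGroupAlgebra_single (g : G) (c : ℂ) :
    inclGroupAlgebra τ α (single _ α g c) = c • t τ α g := by
  rw [inclGroupAlgebra, lift_single, LinearMap.comp_apply, t, ← map_smul,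
    Algebra.linearMap_apply, Algebra.algebraMap_eq_smul_one]

theorem range_inclGroupAlgebra :
    LinearMap.range (inclGroupAlgebra τ α) = coeffsIn τ α 1 := by
  apply le_antisymm
  · rintro _ ⟨c, rfl⟩
    induction c using induction_on with
    | h0 => rw [map_zero]; exact Submodule.zero_mem _
    | hadd x y hx hy => rw [map_add]; exact Submodule.add_mem _ hx hy
    | hs g c =>
      rw [inclGroupAlgebra_single]
      exact Submodule.smul_mem _ _ (t_mem_coeffsIn _ _ _ (Submodule.one_le.1 le_rfl))
  · rw [coeffsIn_eq_iSup]
    refine iSup_le fun g => ?_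
    rintro _ ⟨a, ha, rfl⟩
    obtain ⟨c, rfl⟩ := Submodule.mem_one.1 ha
    refine ⟨single _ α g c, ?_⟩
    rw [inclGroupAlgebra_single, t, ← map_smul, Algebra.algebraMap_eq_smul_one]

end Incl

theorem incl_mem (c : TwistedGroupAlgebra α) :
    inclGroupAlgebra (tensorAction ρ) α c ∈ tensorSkewDegree ρ α 0 := by
  have : inclGroupAlgebra (tensorAction ρ) α c ∈ coeffsIn _ α 1 := by
    rw [← range_inclGroupAlgebra]
    exact ⟨c, rfl⟩
  rwa [tensorSkewDegree, tensorDegree, pow_zero]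

theorem skewMk_incl (c : TwistedGroupAlgebra α) :
    skewMk b α hσ (inclGroupAlgebra (tensorAction ρ) α c) = inclGroupAlgebra σ α c := by
  induction c using induction_on with
  | h0 => simp
  | hadd x y hx hy => simp only [map_add, hx, hy]
  | hs g c => rw [inclGroupAlgebra_single, inclGroupAlgebra_single, map_smul, skewMk_t]

/-! ### The augmentation `S_q(V) #_α G → ℂ^α G` -/

variable (q) in
/-- The augmentation of `S_q(V)`, which kills all vectors. -/
def symAug : QSym b q →ₐ[ℂ] ℂ :=
  RingQuot.liftAlgHom ℂ ⟨TensorAlgebra.lift ℂ (0 : V →ₗ[ℂ] ℂ), by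
    rintro _ _ ⟨i, j⟩
    simp⟩

theorem symAug_ι (v : V) : symAug b q (CommAlg.ι b q v) = 0 := by
  refine (RingQuot.liftAlgHom_mkAlgHom_apply ℂ _ _ _).trans ?_
  simp

variable (α σ) in
/-- The linear map `S_q(V) #_α G → ℂ^α G` that kills all elements of positive degree. -/
def skewAug : TwistedSkew σ α →ₗ[ℂ] TwistedGroupAlgebra α :=
  lift σ α fun g => single _ α g ∘ₗ (symAug b q).toLinearMap

theorem skewAug_single (g : G) (a : QSym b q) :
    skewAug b α σ (single σ α g a) = single _ α g (symAug b q a) := lift_single _ _ _ _ _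

theorem skewAug_incl (c : TwistedGroupAlgebra α) :
    skewAug b α σ (inclGroupAlgebra σ α c) = c := by
  induction c using induction_on with
  | h0 => simp
  | hadd x y hx hy => simp only [map_add, hx, hy]
  | hs g c => rw [inclGroupAlgebra_single, map_smul, t, skewAug_single, map_one, ← map_smul,
      smul_eq_mul, mul_one]

theorem incl_injective : Function.Injective (inclGroupAlgebra σ α) :=
  Function.LeftInverse.injective (skewAug_incl b)

theorem incl_skewAug {x : TwistedSkew σ α} (hx : x ∈ skewDegree b q σ α 0) :
    inclGroupAlgebra σ α (skewAug b α σ x) = x := by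
  have : x ∈ LinearMap.range (inclGroupAlgebra σ α) := by
    rw [range_inclGroupAlgebra, ← pow_zero (LinearMap.range (CommAlg.ι b q))]
    exact hx
  obtain ⟨c, rfl⟩ := this
  rw [skewAug_incl]

/-- A product with a vector has no component in degree zero. -/
theorem skewAug_vec_mul (v : V) (x : TwistedSkew σ α) :
    skewAug b α σ (skewVec b q σ α v * x) = 0 := by
  induction x using induction_on with
  | h0 => simp
  | hadd x y hx hy => simp only [mul_add, map_add, hx, hy, add_zero]
  | hs g a => rw [skewVec, single_mul_single, skewAug_single]; simp [symAug_ι]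

theorem skewAug_mul_vec (hσ : ExtendsAction b q ρ σ) (v : V) (x : TwistedSkew σ α) :
    skewAug b α σ (x * skewVec b q σ α v) = 0 := by
  induction x using induction_on with
  | h0 => simp
  | hadd x y hx hy => simp only [add_mul, map_add, hx, hy, add_zero]
  | hs g a => rw [skewVec, single_mul_single, skewAug_single, hσ]; simp [symAug_ι]

end Skew

/-! ### The relations of `H_{q,κ,α}` and their leading terms -/

section Ideals

open TwistedSkew

variable {G : Type*} [Group G] {V : Type*} [AddCommGroup V] [Module ℂ V] {n : ℕ}
  (b : Module.Basis (Fin n) ℂ V) (ρ : Representation ℂ G V) (q : Fin n → Fin n → ℂ)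
  (α : NormalizedTwoCocycle G) (κ : V →ₗ[ℂ] V →ₗ[ℂ] TwistedGroupAlgebra α)

/-- The value `κ(v_i, v_j)`, as an element of `T(V) #_α G`. -/
def kap (i j : Fin n) : TensorSkew ρ α := inclGroupAlgebra _ α (κ (b i) (b j))

/-- The relation `v_i v_j - q_{ij} v_j v_i - κ(v_i, v_j)` in `T(V) #_α G`. -/
def heckeRel (i j : Fin n) : TensorSkew ρ α :=
  base _ α (quadRel b q i j) - kap b ρ α κ i j

theorem heckeRelations_eq :
    heckeRelations b ρ q α κ = {x | ∃ i j, x = heckeRel b ρ q α κ i j} := by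
  ext x
  simp only [heckeRelations, heckeRel, quadRel, map_sub, map_smul, base_apply]
  rfl

theorem heckeMk_eq_zero {x : TensorSkew ρ α} :
    heckeMk b ρ q α κ x = 0 ↔ x ∈ heckeIdeal b ρ q α κ := by
  rw [TwoSidedIdeal.mem_iff]
  exact RingCon.eq _

theorem heckeMk_heckeRel (i j : Fin n) : heckeMk b ρ q α κ (heckeRel b ρ q α κ i j) = 0 := by
  rw [heckeMk_eq_zero]
  refine TwoSidedIdeal.subset_span ?_
  rw [heckeRelations_eq]
  exact ⟨i, j, rfl⟩

theorem heckeMk_quadRel (i j : Fin n) :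
    heckeMk b ρ q α κ (base _ α (quadRel b q i j)) = heckeMk b ρ q α κ (kap b ρ α κ i j) := by
  have := heckeMk_heckeRel b ρ q α κ i j
  rwa [heckeRel, map_sub, sub_eq_zero] at this

variable {ρ α}

theorem base_quadRel_mem (i j : Fin n) :
    base (tensorAction ρ) α (quadRel b q i j) ∈ tensorSkewDegree ρ α 2 :=
  base_mem (quadRel_mem b q i j)

theorem kap_mem (i j : Fin n) : kap b ρ α κ i j ∈ tensorSkewDegree ρ α 0 := incl_mem _

variable (ρ α)

/-- The bimodule generated by the pairs `(v_i v_j - q_{ij} v_j v_i, κ(v_i, v_j))` in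
`T × T` for `T = T(V) #_α G`. Its first projection is the kernel of `T → S_q(V) #_α G`, and the
two entries of each of its elements agree in `H_{q,κ,α}`. -/
def relPairs : Submodule ℂ (TensorSkew ρ α × TensorSkew ρ α) :=
  Submodule.span ℂ {z | ∃ d e, ∃ u ∈ tensorSkewDegree ρ α d, ∃ w ∈ tensorSkewDegree ρ α e, ∃ i j,
    z = (u * base _ α (quadRel b q i j) * w, u * kap b ρ α κ i j * w)}

variable {ρ α κ}

theorem relPairs_induction {p : TensorSkew ρ α → TensorSkew ρ α → Prop}
    (gen : ∀ d e, ∀ u ∈ tensorSkewDegree ρ α d, ∀ w ∈ tensorSkewDegree ρ α e, ∀ i j,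
      p (u * base _ α (quadRel b q i j) * w) (u * kap b ρ α κ i j * w))
    (zero : p 0 0) (add : ∀ x y x' y', p x y → p x' y' → p (x + x') (y + y'))
    (smul : ∀ (c : ℂ) x y, p x y → p (c • x) (c • y)) {x y : TensorSkew ρ α}
    (h : (x, y) ∈ relPairs b ρ q α κ) : p x y := by
  have key : ∀ z ∈ relPairs b ρ q α κ, p z.1 z.2 := fun z hz => by
    induction hz using Submodule.span_induction with
    | mem z hz =>
      obtain ⟨d, e, u, hu, w, hw, i, j, rfl⟩ := hz
      exact gen d e u hu w hw i j
    | zero => exact zero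
    | add z z' _ _ h h' => exact add _ _ _ _ h h'
    | smul c z _ h => exact smul c _ _ h
  exact key (x, y) h

theorem gen_mem_relPairs {d e : ℕ} {u w : TensorSkew ρ α} (hu : u ∈ tensorSkewDegree ρ α d)
    (hw : w ∈ tensorSkewDegree ρ α e) (i j : Fin n) :
    (u * base _ α (quadRel b q i j) * w, u * kap b ρ α κ i j * w) ∈ relPairs b ρ q α κ :=
  Submodule.subset_span ⟨d, e, u, hu, w, hw, i, j, rfl⟩

theorem add_mem_relPairs {x y x' y' : TensorSkew ρ α} (h : (x, y) ∈ relPairs b ρ q α κ)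
    (h' : (x', y') ∈ relPairs b ρ q α κ) : (x + x', y + y') ∈ relPairs b ρ q α κ :=
  Submodule.add_mem _ h h'

theorem smul_mem_relPairs (c : ℂ) {x y : TensorSkew ρ α} (h : (x, y) ∈ relPairs b ρ q α κ) :
    (c • x, c • y) ∈ relPairs b ρ q α κ :=
  Submodule.smul_mem _ c h

theorem zero_mem_relPairs :
    ((0, 0) : TensorSkew ρ α × TensorSkew ρ α) ∈ relPairs b ρ q α κ :=
  Submodule.zero_mem _

theorem heckeMk_eq_of_mem_relPairs {x y : TensorSkew ρ α} (h : (x, y) ∈ relPairs b ρ q α κ) :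
    heckeMk b ρ q α κ x = heckeMk b ρ q α κ y := by
  refine relPairs_induction b q (p := fun x y => heckeMk b ρ q α κ x = heckeMk b ρ q α κ y)
    ?_ rfl ?_ ?_ h
  · intro d e u _ w _ i j
    rw [map_mul, map_mul, heckeMk_quadRel, map_mul, map_mul]
  · intro x y x' y' h h'
    rw [map_add, map_add, h, h']
  · intro c x y h
    rw [map_smul, map_smul, h]

theorem mul_mem_relPairs (z : TensorSkew ρ α) {x y : TensorSkew ρ α}
    (h : (x, y) ∈ relPairs b ρ q α κ) : (z * x, z * y) ∈ relPairs b ρ q α κ := by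
  induction z using DirectSum.Decomposition.inductionOn (tensorSkewDegree ρ α) with
  | zero => simp only [zero_mul]; exact zero_mem_relPairs b q
  | add z z' hz hz' => simp only [add_mul]; exact add_mem_relPairs b q hz hz'
  | @homogeneous c z =>
    refine relPairs_induction b q (p := fun x y => ((z : TensorSkew ρ α) * x, ↑z * y) ∈
      relPairs b ρ q α κ) ?_ ?_ ?_ ?_ h
    · intro d e u hu w hw i j
      rw [← mul_assoc, ← mul_assoc, ← mul_assoc, ← mul_assoc]
      exact gen_mem_relPairs b q (mul_mem_tensorSkewDegree z.2 hu) hw i j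
    · rw [mul_zero]; exact zero_mem_relPairs b q
    · intro x y x' y' h h'
      rw [mul_add, mul_add]
      exact add_mem_relPairs b q h h'
    · intro c x y h
      rw [mul_smul_comm, mul_smul_comm]
      exact smul_mem_relPairs b q c h

theorem mem_relPairs_mul (z : TensorSkew ρ α) {x y : TensorSkew ρ α}
    (h : (x, y) ∈ relPairs b ρ q α κ) : (x * z, y * z) ∈ relPairs b ρ q α κ := by
  induction z using DirectSum.Decomposition.inductionOn (tensorSkewDegree ρ α) with
  | zero => simp only [mul_zero]; exact zero_mem_relPairs b q
  | add z z' hz hz' => simp only [mul_add]; exact add_mem_relPairs b q hz hz'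
  | @homogeneous c z =>
    refine relPairs_induction b q (p := fun x y => (x * (z : TensorSkew ρ α), y * ↑z) ∈
      relPairs b ρ q α κ) ?_ ?_ ?_ ?_ h
    · intro d e u hu w hw i j
      rw [mul_assoc _ w, mul_assoc _ w]
      exact gen_mem_relPairs b q hu (mul_mem_tensorSkewDegree hw z.2) i j
    · rw [zero_mul]; exact zero_mem_relPairs b q
    · intro x y x' y' h h'
      rw [add_mul, add_mul]
      exact add_mem_relPairs b q h h'
    · intro c x y h
      rw [smul_mul_assoc, smul_mul_assoc]
      exact smul_mem_relPairs b q c h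

theorem gen_fst_mem {d e : ℕ} {u w : TensorSkew ρ α} (hu : u ∈ tensorSkewDegree ρ α d)
    (hw : w ∈ tensorSkewDegree ρ α e) (i j : Fin n) :
    u * base _ α (quadRel b q i j) * w ∈ tensorSkewDegree ρ α (d + 2 + e) :=
  mul_mem_tensorSkewDegree (mul_mem_tensorSkewDegree hu (base_quadRel_mem b q i j)) hw

theorem gen_snd_mem {d e : ℕ} {u w : TensorSkew ρ α} (hu : u ∈ tensorSkewDegree ρ α d)
    (hw : w ∈ tensorSkewDegree ρ α e) (i j : Fin n) :
    u * kap b ρ α κ i j * w ∈ tensorSkewDegree ρ α (d + e) :=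
  mul_mem_tensorSkewDegree (d := d + 0)
    (mul_mem_tensorSkewDegree hu (kap_mem b κ i j)) hw

/-- The bimodule of pairs is graded; the second entry lies two degrees below the first one. -/
theorem homComp_mem_relPairs (m : ℕ) {x y : TensorSkew ρ α} (h : (x, y) ∈ relPairs b ρ q α κ) :
    (homComp (tensorSkewDegree ρ α) (m + 2) x, homComp (tensorSkewDegree ρ α) m y)
      ∈ relPairs b ρ q α κ := by
  refine relPairs_induction b q (p := fun x y => (homComp (tensorSkewDegree ρ α) (m + 2) x,
    homComp (tensorSkewDegree ρ α) m y) ∈ relPairs b ρ q α κ) ?_ ?_ ?_ ?_ h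
  · intro d e u hu w hw i j
    have h1 := gen_fst_mem b q hu hw i j
    have h2 := gen_snd_mem b (κ := κ) hu hw i j
    by_cases hm : d + e = m
    · subst hm
      rw [Nat.add_right_comm] at h1
      rw [homComp_same _ h1, homComp_same _ h2]
      exact gen_mem_relPairs b q hu hw i j
    · rw [homComp_ne _ h1 (by omega), homComp_ne _ h2 hm]
      exact zero_mem_relPairs b q
  · rw [map_zero, map_zero]; exact zero_mem_relPairs b q
  · intro x y x' y' h h'
    rw [map_add, map_add]
    exact add_mem_relPairs b q h h'
  · intro c x y h
    rw [map_smul, map_smul]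
    exact smul_mem_relPairs b q c h

theorem homComp_fst_relPairs {m : ℕ} (hm : m < 2) {x y : TensorSkew ρ α}
    (h : (x, y) ∈ relPairs b ρ q α κ) : homComp (tensorSkewDegree ρ α) m x = 0 := by
  refine relPairs_induction b q (p := fun x _ => homComp (tensorSkewDegree ρ α) m x = 0)
    ?_ ?_ ?_ ?_ h
  · intro d e u hu w hw i j
    exact homComp_ne _ (gen_fst_mem b q hu hw i j) (by omega)
  · rw [map_zero]
  · intro x y x' y' h h'
    rw [map_add, h, h', add_zero]
  · intro c x y h
    rw [map_smul, h, smul_zero]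

variable (κ) {q} {σ : G →* (QSym b q ≃ₐ[ℂ] QSym b q)} (hσ : ExtendsAction b q ρ σ)

/-- Every element of the kernel of `T(V) #_α G → S_q(V) #_α G` is the first entry of a pair. -/
theorem exists_mem_relPairs {x : TensorSkew ρ α} (hx : skewMk b α hσ x = 0) :
    ∃ y, (x, y) ∈ relPairs b ρ q α κ := by
  obtain ⟨s, hs⟩ := eq_sum_single _ α x
  suffices h : x ∈ (relPairs b ρ q α κ).map (LinearMap.fst ℂ _ _) by
    obtain ⟨⟨_, y⟩, hy, rfl⟩ := h
    exact ⟨y, hy⟩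
  rw [hs]
  refine Submodule.sum_mem _ fun g _ => ?_
  have key : relSpan b q ≤ ((relPairs b ρ q α κ).map (LinearMap.fst ℂ _ _)).comap
      (single _ α g) := by
    rw [relSpan, Submodule.span_le]
    rintro _ ⟨u, i, j, w, rfl⟩
    refine ⟨(base _ α (word b u) * base _ α (quadRel b q i j) * (base _ α (word b w) * t _ α g), _),
      Submodule.subset_span ⟨_, _, _, base_mem (word_mem b u), _,
        mul_mem_tensorSkewDegree (base_mem (word_mem b w)) (t_mem g), i, j, rfl⟩, ?_⟩
    rw [LinearMap.fst_apply, ← mul_assoc, ← map_mul, ← map_mul, base_mul_t]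
  refine key (mem_relSpan_of_symMk_eq_zero b q ?_)
  rw [← coeff_skewMk b hσ, hx, coeff_zero]

/-- The projection to `S_q(V) #_α G` is injective in degrees zero and one. -/
theorem eq_zero_of_skewMk_of_lt_two {d : ℕ} (hd : d < 2) {x : TensorSkew ρ α}
    (hx : x ∈ tensorSkewDegree ρ α d) (h : skewMk b α hσ x = 0) : x = 0 := by
  obtain ⟨y, hy⟩ := exists_mem_relPairs b (0 : V →ₗ[ℂ] V →ₗ[ℂ] TwistedGroupAlgebra α) hσ h
  rw [← homComp_same _ hx]
  exact homComp_fst_relPairs b q hd hy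

/-- A homogeneous element that vanishes in `S_q(V) #_α G` is, in `H_{q,κ,α}`, equal to an element of
lower degree. -/
theorem exists_lower_of_skewMk_eq_zero {d : ℕ} {x : TensorSkew ρ α}
    (hx : x ∈ tensorSkewDegree ρ α d) (h : skewMk b α hσ x = 0) :
    heckeMk b ρ q α κ x ∈ (heckeFiltration b ρ q α κ).prev d := by
  rcases d with _ | _ | m
  · rw [eq_zero_of_skewMk_of_lt_two b hσ (by norm_num) hx h, map_zero]
    exact Submodule.zero_mem _
  · rw [eq_zero_of_skewMk_of_lt_two b hσ (by norm_num) hx h, map_zero]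
    exact Submodule.zero_mem _
  · obtain ⟨y, hy⟩ := exists_mem_relPairs b κ hσ h
    have h1 := heckeMk_eq_of_mem_relPairs b q (homComp_mem_relPairs b q m hy)
    rw [homComp_same _ hx] at h1
    rw [h1]
    exact ⟨_, degree_le_filtration (Nat.le_succ m) (homComp_mem _ _ _), rfl⟩

/-- The leading terms of the relations of `H_{q,κ,α}` are relations of `S_q(V) #_α G`: a
homogeneous element of degree `d` that lies in `F_{d-1}` modulo the defining ideal vanishes in
`S_q(V) #_α G`. -/
def LeadingTermsVanish (hσ : ExtendsAction b q ρ σ) : Prop :=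
  ∀ d, ∀ x ∈ tensorSkewDegree ρ α d,
    heckeMk b ρ q α κ x ∈ (heckeFiltration b ρ q α κ).prev d → skewMk b α hσ x = 0

variable {κ}

theorem mem_map_prev {d : ℕ} {z : HeckeAlg b ρ q α κ}
    (hz : z ∈ (heckeFiltration b ρ q α κ).prev d) :
    ∃ y ∈ (tensorSkewFiltration ρ α).prev d, heckeMk b ρ q α κ y = z := by
  cases d with
  | zero =>
    rw [AlgFiltration.prev, Submodule.mem_bot] at hz
    exact ⟨0, Submodule.zero_mem _, by rw [hz, map_zero]⟩
  | succ d => exact hz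

theorem map_mem_prev {d : ℕ} {y : TensorSkew ρ α} (hy : y ∈ (tensorSkewFiltration ρ α).prev d) :
    heckeMk b ρ q α κ y ∈ (heckeFiltration b ρ q α κ).prev d := by
  cases d with
  | zero =>
    rw [AlgFiltration.prev, Submodule.mem_bot] at hy
    rw [hy, map_zero]
    exact Submodule.zero_mem _
  | succ d => exact ⟨y, hy, rfl⟩

theorem LeadingTermsVanish.skewMk_homComp_eq_zero (H : LeadingTermsVanish b κ hσ) {d : ℕ}
    {x : TensorSkew ρ α} (hx : x ∈ (tensorSkewFiltration ρ α).F d)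
    (h : heckeMk b ρ q α κ x ∈ (heckeFiltration b ρ q α κ).prev d) :
    skewMk b α hσ (homComp (tensorSkewDegree ρ α) d x) = 0 := by
  refine H d _ (homComp_mem _ _ _) ?_
  have := Submodule.sub_mem _ h
    (map_mem_prev b (κ := κ) (q := q) (sub_homComp_mem_prev hx))
  rwa [map_sub, sub_sub_cancel] at this

end Ideals

/-! ### The Poincaré–Birkhoff–Witt condition in terms of leading terms -/

section PBW

open TwistedSkew

variable {G : Type*} [Group G] {V : Type*} [AddCommGroup V] [Module ℂ V] {n : ℕ}
  (b : Module.Basis (Fin n) ℂ V) {ρ : Representation ℂ G V} {q : Fin n → Fin n → ℂ}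
  {α : NormalizedTwoCocycle G} (κ : V →ₗ[ℂ] V →ₗ[ℂ] TwistedGroupAlgebra α)
  {σ : G →* (QSym b q ≃ₐ[ℂ] QSym b q)} (hσ : ExtendsAction b q ρ σ)

/-- The class in `F_d / F_{d-1}` of a homogeneous element of `T(V) #_α G`. -/
def toGrPiece (d : ℕ) :
    tensorSkewDegree ρ α d →ₗ[ℂ] (heckeFiltration b ρ q α κ).GrPiece d :=
  (heckeFiltration b ρ q α κ).grMk d ∘ₗ
    ((heckeMk b ρ q α κ).toLinearMap ∘ₗ (tensorSkewDegree ρ α d).subtype).codRestrict _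
      (fun x => ⟨x, degree_le_filtration le_rfl x.2, rfl⟩)

theorem toGrPiece_eq_zero {d : ℕ} (x : tensorSkewDegree ρ α d) :
    toGrPiece (q := q) b κ d x = 0
      ↔ heckeMk b ρ q α κ x ∈ (heckeFiltration b ρ q α κ).prev d := by
  have := (heckeFiltration b ρ q α κ).grMk_eq_grMk
    ⟨heckeMk b ρ q α κ x, ⟨x, degree_le_filtration le_rfl x.2, rfl⟩⟩ 0
  rw [map_zero] at this
  refine this.trans ?_
  simp

theorem toGrPiece_surjective (d : ℕ) :
    Function.Surjective (toGrPiece (ρ := ρ) (q := q) b κ d) := by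
  intro z
  obtain ⟨⟨_, x, hx, rfl⟩, rfl⟩ := (heckeFiltration b ρ q α κ).grMk_surjective d z
  refine ⟨⟨homComp (tensorSkewDegree ρ α) d x, homComp_mem _ _ _⟩, ?_⟩
  refine ((heckeFiltration b ρ q α κ).grMk_eq_grMk _ _).2 ?_
  have := map_mem_prev b (κ := κ) (q := q) (sub_homComp_mem_prev hx)
  rw [map_sub] at this
  rw [← neg_sub]
  exact Submodule.neg_mem _ this

instance finiteDimensional_tensorSkewDegree [Finite G] (d : ℕ) [Module.Finite ℂ V] :
    FiniteDimensional ℂ (tensorSkewDegree ρ α d) := by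
  have h : (tensorSkewDegree ρ α d).FG := by
    rw [tensorSkewDegree, coeffsIn_eq_iSup]
    refine Submodule.fg_iSup _ fun g => Submodule.FG.map _ ?_
    refine Submodule.FG.pow ?_ d
    rw [← Submodule.map_top]
    exact Submodule.FG.map _ Module.Finite.fg_top
  exact Module.Finite.iff_fg.2 h

/-- If some graded isomorphism `gr H ≅ S_q(V) #_α G` exists, then the canonical map is one: its
homogeneous parts are surjections between spaces of equal finite dimension. -/
theorem leadingTermsVanish_of_satisfiesPBW [Finite G] (h : SatisfiesPBW b ρ q α σ κ) :
    LeadingTermsVanish b κ hσ := by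
  have : Module.Finite ℂ V := Module.Finite.of_basis b
  obtain ⟨e, he⟩ := h
  intro d x hx hxd
  -- Both `θ` and `toGrPiece` are defined on degree `d` of `T(V) #_α G`; their kernels are nested,
  -- and `e` shows that their ranges have equal dimension.
  let θ : tensorSkewDegree ρ α d →ₗ[ℂ] TwistedSkew σ α :=
    (skewMk b α hσ).toLinearMap ∘ₗ (tensorSkewDegree ρ α d).subtype
  have hle : LinearMap.ker θ ≤ LinearMap.ker (toGrPiece (ρ := ρ) (q := q) b κ d) := by
    intro y hy
    rw [LinearMap.mem_ker, toGrPiece_eq_zero]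
    exact exists_lower_of_skewMk_eq_zero b κ hσ y.2 hy
  have hθ : LinearMap.range θ = skewDegree b q σ α d := by
    rw [LinearMap.range_comp, Submodule.range_subtype, map_skewMk_degree]
  have hfr : Module.finrank ℂ (LinearMap.range θ)
      = Module.finrank ℂ (LinearMap.range (toGrPiece (ρ := ρ) (q := q) b κ d)) := by
    rw [LinearMap.range_eq_top.2 (toGrPiece_surjective b κ d), finrank_top, hθ, ← he d,
      ← LinearMap.range_comp]
    refine LinearMap.finrank_range_of_inj ?_
    exact e.injective.comp (DirectSum.of_injective (β := fun k =>
      (heckeFiltration b ρ q α κ).GrPiece k) d)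
  have h1 := LinearMap.finrank_range_add_finrank_ker θ
  have h2 := LinearMap.finrank_range_add_finrank_ker (toGrPiece (ρ := ρ) (q := q) b κ d)
  have heq := Submodule.eq_of_le_of_finrank_eq hle (by omega)
  have hmem : (⟨x, hx⟩ : tensorSkewDegree ρ α d)
      ∈ LinearMap.ker (toGrPiece (ρ := ρ) (q := q) b κ d) := by
    rw [LinearMap.mem_ker, toGrPiece_eq_zero]
    exact hxd
  rw [← heq] at hmem
  exact hmem

variable {κ}

variable (q κ) in
/-- The class in `F_d / F_{d-1}` of an element of degree at most `d` of `T(V) #_α G`. -/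
def heckeGrMk (d : ℕ) (x : TensorSkew ρ α) (hx : x ∈ (tensorSkewFiltration ρ α).F d) :
    (heckeFiltration b ρ q α κ).GrPiece d :=
  (heckeFiltration b ρ q α κ).grMk d ⟨heckeMk b ρ q α κ x, ⟨x, hx, rfl⟩⟩

theorem exists_heckeGrMk {d : ℕ} (z : (heckeFiltration b ρ q α κ).GrPiece d) :
    ∃ x hx, z = heckeGrMk b q κ d x hx := by
  obtain ⟨⟨_, x, hx, rfl⟩, rfl⟩ := (heckeFiltration b ρ q α κ).grMk_surjective d z
  exact ⟨x, hx, rfl⟩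

theorem heckeGrMk_one :
    (GradedMonoid.GOne.one : (heckeFiltration b ρ q α κ).GrPiece 0)
      = heckeGrMk b q κ 0 1 (tensorSkewFiltration ρ α).one_mem := by
  refine ((heckeFiltration b ρ q α κ).grMk_eq_grMk _ _).2 ?_
  simp

theorem heckeGrMk_mul {d e : ℕ} {x y : TensorSkew ρ α}
    (hx : x ∈ (tensorSkewFiltration ρ α).F d) (hy : y ∈ (tensorSkewFiltration ρ α).F e) :
    GradedMonoid.GMul.mul (heckeGrMk b q κ d x hx) (heckeGrMk b q κ e y hy)
      = heckeGrMk b q κ (d + e) (x * y) ((tensorSkewFiltration ρ α).mul_mem hx hy) := by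
  refine ((heckeFiltration b ρ q α κ).grMk_eq_grMk _ _).2 ?_
  simp

/-- The inverse of the canonical map in degree `d`: it sends the class of `x ∈ F_d` to the image in
`S_q(V) #_α G` of the leading term of `x`. -/
theorem exists_leadingTerm (H : LeadingTermsVanish b κ hσ) (d : ℕ) :
    ∃ f : (heckeFiltration b ρ q α κ).GrPiece d →ₗ[ℂ] TwistedSkew σ α,
      ∀ (x : TensorSkew ρ α) (hx : x ∈ (tensorSkewFiltration ρ α).F d),
        f (heckeGrMk b q κ d x hx) = skewMk b α hσ (homComp (tensorSkewDegree ρ α) d x) := by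
  let p : (tensorSkewFiltration ρ α).F d →ₗ[ℂ] (heckeFiltration b ρ q α κ).GrPiece d :=
    (heckeFiltration b ρ q α κ).grMk d ∘ₗ
      ((heckeMk b ρ q α κ).toLinearMap ∘ₗ ((tensorSkewFiltration ρ α).F d).subtype).codRestrict _
        (fun x => ⟨x, x.2, rfl⟩)
  have hp : Function.Surjective p := by
    intro z
    obtain ⟨⟨_, x, hx, rfl⟩, rfl⟩ := (heckeFiltration b ρ q α κ).grMk_surjective d z
    exact ⟨⟨x, hx⟩, rfl⟩
  let θ : (tensorSkewFiltration ρ α).F d →ₗ[ℂ] TwistedSkew σ α :=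
    (skewMk b α hσ).toLinearMap ∘ₗ homComp (tensorSkewDegree ρ α) d ∘ₗ Submodule.subtype _
  have hker : LinearMap.ker p ≤ LinearMap.ker θ := by
    intro x hx
    refine H.skewMk_homComp_eq_zero b hσ x.2 ?_
    have h0 : (heckeFiltration b ρ q α κ).grMk d ⟨heckeMk b ρ q α κ x, ⟨x, x.2, rfl⟩⟩
        = (heckeFiltration b ρ q α κ).grMk d 0 := by
      rw [map_zero]; exact hx
    rw [AlgFiltration.grMk_eq_grMk] at h0
    simpa using h0
  refine ⟨(LinearMap.ker p).liftQ θ hker ∘ₗ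
    (p.quotKerEquivOfSurjective hp).symm.toLinearMap, fun x hx => ?_⟩
  have : (p.quotKerEquivOfSurjective hp).symm (p ⟨x, hx⟩) = Submodule.Quotient.mk ⟨x, hx⟩ := by
    rw [LinearEquiv.symm_apply_eq]; rfl
  exact (congrArg ((LinearMap.ker p).liftQ θ hker) this).trans rfl

/-- Leading terms are multiplicative. -/
theorem homComp_mul {d e : ℕ} {x y : TensorSkew ρ α}
    (hx : x ∈ (tensorSkewFiltration ρ α).F d) (hy : y ∈ (tensorSkewFiltration ρ α).F e) :
    homComp (tensorSkewDegree ρ α) (d + e) (x * y)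
      = homComp (tensorSkewDegree ρ α) d x * homComp (tensorSkewDegree ρ α) e y := by
  set x' := homComp (tensorSkewDegree ρ α) d x with hx'
  set y' := homComp (tensorSkewDegree ρ α) e y with hy'
  have h1 : x * y = x' * y' + ((x - x') * y + x' * (y - y')) := by noncomm_ring
  rw [h1, map_add, map_add, homComp_same _ (mul_mem_tensorSkewDegree (homComp_mem _ _ _)
    (homComp_mem _ _ _)), homComp_eq_zero_of_mem_prev
    ((tensorSkewFiltration ρ α).mul_mem_prev_left (sub_homComp_mem_prev hx) hy),
    homComp_eq_zero_of_mem_prev ((tensorSkewFiltration ρ α).mul_mem_prev_right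
      (degree_le_filtration le_rfl (homComp_mem _ _ _)) (sub_homComp_mem_prev hy)),
    add_zero, add_zero]

/-- If leading terms of relations vanish, then taking leading terms is a graded isomorphism
`gr H_{q,κ,α} ≅ S_q(V) #_α G`. -/
theorem satisfiesPBW_of_leadingTermsVanish (H : LeadingTermsVanish b κ hσ) :
    SatisfiesPBW b ρ q α σ κ := by
  choose f hf using exists_leadingTerm b hσ H
  have hrange : ∀ d, LinearMap.range (f d) = skewDegree b q σ α d := by
    intro d
    apply le_antisymm
    · rintro _ ⟨z, rfl⟩
      obtain ⟨x, hx, rfl⟩ := exists_heckeGrMk b z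
      rw [hf d x hx]
      exact skewMk_mem_degree b hσ (homComp_mem _ _ _)
    · rw [← map_skewMk_degree b hσ]
      rintro _ ⟨x, hx, rfl⟩
      refine ⟨_, (hf d x (degree_le_filtration le_rfl hx)).trans ?_⟩
      rw [homComp_same _ hx]
      rfl
  have hinj : ∀ d, Function.Injective (f d) := by
    intro d
    rw [← LinearMap.ker_eq_bot, LinearMap.ker_eq_bot']
    intro z hz
    obtain ⟨x, rfl⟩ := toGrPiece_surjective b κ d z
    have := hf d x (degree_le_filtration le_rfl x.2)
    rw [homComp_same _ x.2] at this
    rw [toGrPiece_eq_zero]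
    exact exists_lower_of_skewMk_eq_zero b κ hσ x.2 (this.symm.trans hz)
  let F : (heckeFiltration b ρ q α κ).Gr →ₐ[ℂ] TwistedSkew σ α :=
    DirectSum.toAlgebra ℂ _ f
      (by
        have h1 : (1 : TensorSkew ρ α) ∈ tensorSkewDegree ρ α 0 := t_mem 1
        have := hf 0 1 (tensorSkewFiltration ρ α).one_mem
        rw [homComp_same _ h1, map_one] at this
        rw [heckeGrMk_one, this])
      (by
        intro d e z w
        obtain ⟨x, hx, rfl⟩ := exists_heckeGrMk b z
        obtain ⟨y, hy, rfl⟩ := exists_heckeGrMk b w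
        rw [heckeGrMk_mul, hf, hf, hf, homComp_mul hx hy, map_mul])
  have hF : ∀ d (z : (heckeFiltration b ρ q α κ).GrPiece d),
      F (DirectSum.lof ℂ ℕ (heckeFiltration b ρ q α κ).GrPiece d z) = f d z := by
    intro d z
    exact DirectSum.toAddMonoid_of _ d z
  have hFcomp : ∀ d (z : (heckeFiltration b ρ q α κ).Gr),
      homComp (skewDegree b q σ α) d (F z) = f d (z d) := by
    intro d z
    induction z using DirectSum.induction_on with
    | zero => simp
    | add z w hz hw => rw [map_add, map_add, hz, hw, DirectSum.add_apply, map_add]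
    | of e z =>
      have hz : f e z ∈ skewDegree b q σ α e := by rw [← hrange]; exact ⟨z, rfl⟩
      rw [← DirectSum.lof_eq_of ℂ, hF]
      by_cases h : e = d
      · subst h
        rw [homComp_same _ hz, DirectSum.lof_apply]
      · rw [homComp_ne _ hz h, DirectSum.lof_eq_of, DirectSum.of_eq_of_ne _ _ _ (Ne.symm h),
          map_zero]
  have hbij : Function.Bijective F := by
    constructor
    · intro z w hzw
      refine DFinsupp.ext fun d => hinj d ?_
      rw [← hFcomp, hzw, hFcomp]
    · intro y
      induction y using DirectSum.Decomposition.inductionOn (skewDegree b q σ α) with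
      | zero => exact ⟨0, map_zero _⟩
      | add x y hx hy =>
        obtain ⟨x, hx⟩ := hx
        obtain ⟨y, hy⟩ := hy
        exact ⟨x + y, by rw [map_add, hx, hy]⟩
      | @homogeneous d y =>
        obtain ⟨z, hz⟩ := (hrange d).ge y.2
        exact ⟨_, (hF d z).trans hz⟩
  refine ⟨AlgEquiv.ofBijective F hbij, fun d => ?_⟩
  rw [← hrange d, ← LinearMap.range_comp]
  congr 1
  exact LinearMap.ext (hF d)

end PBW

/-! ### Square-zero extensions defined by Hochschild cocycles -/

section SquareZero

variable {R : Type*} [Ring R] [Algebra ℂ R]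

/-- The square-zero extension `R ⊕ εR` of `R` by itself that belongs to a Hochschild `2`-cocycle
`μ`, with product `(a + εx)(b + εy) = ab + ε(ay + xb + μ(a,b))`. -/
@[nolint unusedArguments]
def SqZeroExt (_μ : hochschildCocycles R) : Type _ := R × R

namespace SqZeroExt

variable (μ : hochschildCocycles R)

instance : AddCommGroup (SqZeroExt μ) := inferInstanceAs (AddCommGroup (R × R))
instance : Module ℂ (SqZeroExt μ) := inferInstanceAs (Module ℂ (R × R))

/-- The element `a + εx`. -/
def mk (a x : R) : SqZeroExt μ := (a, x)

/-- The component `a` of `a + εx`. -/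
def fst : SqZeroExt μ →ₗ[ℂ] R := LinearMap.fst ℂ R R

/-- The component `x` of `a + εx`. -/
def snd : SqZeroExt μ →ₗ[ℂ] R := LinearMap.snd ℂ R R

theorem fst_mk (a x : R) : fst μ (mk μ a x) = a := rfl
theorem snd_mk (a x : R) : snd μ (mk μ a x) = x := rfl

variable {μ} in
theorem ext {z w : SqZeroExt μ} (h1 : fst μ z = fst μ w) (h2 : snd μ z = snd μ w) : z = w :=
  Prod.ext h1 h2

instance : Mul (SqZeroExt μ) :=
  ⟨fun z w => mk μ (fst μ z * fst μ w)
    (fst μ z * snd μ w + snd μ z * fst μ w + μ.1 (fst μ z) (fst μ w))⟩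

-- The correction term makes this a unit even if `μ` is not normalized.
instance : One (SqZeroExt μ) := ⟨mk μ 1 (-μ.1 1 1)⟩

theorem fst_mul (z w : SqZeroExt μ) : fst μ (z * w) = fst μ z * fst μ w := rfl
theorem snd_mul (z w : SqZeroExt μ) :
    snd μ (z * w) = fst μ z * snd μ w + snd μ z * fst μ w + μ.1 (fst μ z) (fst μ w) := rfl
theorem fst_one : fst μ 1 = 1 := rfl
theorem snd_one : snd μ 1 = -μ.1 1 1 := rfl

theorem cocycle_one_left (a : R) : μ.1 1 a = μ.1 1 1 * a := by
  have := μ.2 1 1 a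
  rw [one_mul, one_mul, one_mul] at this
  exact add_left_cancel this

theorem cocycle_one_right (a : R) : μ.1 a 1 = a * μ.1 1 1 := by
  have := μ.2 a 1 1
  rw [mul_one, mul_one, mul_one, add_comm] at this
  exact (add_left_cancel this).symm

instance : Ring (SqZeroExt μ) :=
  { (inferInstance : AddCommGroup (SqZeroExt μ)) with
    mul := (· * ·)
    one := 1
    left_distrib := fun x y z => ext
      (by simp only [fst_mul, map_add, mul_add])
      (by simp only [snd_mul, map_add, mul_add]; abel)
    right_distrib := fun x y z => ext
      (by simp only [fst_mul, map_add, add_mul])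
      (by simp only [snd_mul, map_add, add_mul, LinearMap.add_apply]; abel)
    zero_mul := fun x => ext (by simp [fst_mul]) (by simp [snd_mul])
    mul_zero := fun x => ext (by simp [fst_mul]) (by simp [snd_mul])
    mul_assoc := fun x y z => ext (by simp only [fst_mul, mul_assoc]) (by
      have h := μ.2 (fst μ x) (fst μ y) (fst μ z)
      simp only [fst_mul, snd_mul, mul_add, add_mul, mul_assoc] at h ⊢
      have h' := eq_sub_of_add_eq h
      rw [h']
      abel)
    one_mul := fun x => ext (by simp [fst_mul, fst_one]) (by
      rw [snd_mul, fst_one, snd_one, cocycle_one_left μ (fst μ x), one_mul, neg_mul,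
        neg_add_cancel_right])
    mul_one := fun x => ext (by simp [fst_mul, fst_one]) (by
      rw [snd_mul, fst_one, snd_one, cocycle_one_right μ (fst μ x), mul_one, mul_neg,
        add_right_comm, neg_add_cancel, zero_add]) }

instance : Algebra ℂ (SqZeroExt μ) :=
  Algebra.ofModule
    (fun r x y => ext (by simp only [fst_mul, map_smul, smul_mul_assoc])
      (by simp only [snd_mul, map_smul, smul_mul_assoc, smul_add, LinearMap.smul_apply]))
    (fun r x y => ext (by simp only [fst_mul, map_smul, mul_smul_comm])
      (by simp only [snd_mul, map_smul, mul_smul_comm, smul_add]))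

/-- The projection `R ⊕ εR → R`. -/
def fstHom : SqZeroExt μ →ₐ[ℂ] R := AlgHom.ofLinearMap (fst μ) rfl (fst_mul μ)

theorem fstHom_apply (z : SqZeroExt μ) : fstHom μ z = fst μ z := rfl

/-- The inclusion `x ↦ εx`. -/
def eps : R →ₗ[ℂ] SqZeroExt μ := LinearMap.inr ℂ R R

theorem fst_eps (x : R) : fst μ (eps μ x) = 0 := rfl
theorem snd_eps (x : R) : snd μ (eps μ x) = x := rfl

theorem eps_injective : Function.Injective (eps μ) := fun _ _ h => congrArg (snd μ) h

theorem mul_eps (z : SqZeroExt μ) (x : R) : z * eps μ x = eps μ (fst μ z * x) :=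
  ext (by simp [fst_mul, fst_eps]) (by simp [snd_mul, fst_eps, snd_eps])

theorem eps_mul (z : SqZeroExt μ) (x : R) : eps μ x * z = eps μ (x * fst μ z) :=
  ext (by simp [fst_mul, fst_eps]) (by simp [snd_mul, fst_eps, snd_eps])

/-- A cocycle whose square-zero extension splits is a coboundary. -/
theorem mem_coboundaries_of_section (s : R →ₐ[ℂ] SqZeroExt μ) (hs : ∀ a, fst μ (s a) = a) :
    μ.1 ∈ hochschildCoboundaries R := by
  refine ⟨-(snd μ ∘ₗ s.toLinearMap), fun a c => ?_⟩
  have := congrArg (snd μ) (map_mul s a c)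
  rw [snd_mul, hs, hs] at this
  simp only [LinearMap.neg_apply, LinearMap.comp_apply, AlgHom.toLinearMap_apply, this]
  rw [mul_neg, neg_mul]
  abel

end SqZeroExt

end SquareZero

/-! ### First-order deformations and quantum skew-symmetrization -/

section Constant

open TwistedSkew

variable {G : Type*} [Group G] {V : Type*} [AddCommGroup V] [Module ℂ V] {n : ℕ}
  (b : Module.Basis (Fin n) ℂ V) {ρ : Representation ℂ G V} {q : Fin n → Fin n → ℂ}
  {α : NormalizedTwoCocycle G} {σ : G →* (QSym b q ≃ₐ[ℂ] QSym b q)}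

theorem TwistedSkew.algHom_ext {A : Type*} [Ring A] [Algebra ℂ A] {τ : G →* (A ≃ₐ[ℂ] A)}
    {E : Type*} [Ring E] [Algebra ℂ E] {f f' : TwistedSkew τ α →ₐ[ℂ] E}
    (h : ∀ a, f (base τ α a) = f' (base τ α a)) (ht : ∀ g, f (t τ α g) = f' (t τ α g)) :
    f = f' := by
  refine AlgHom.toLinearMap_injective (linearMap_ext fun g a => ?_)
  rw [AlgHom.toLinearMap_apply, AlgHom.toLinearMap_apply, ← base_mul_t, map_mul, map_mul, h, ht]

theorem tensor_commutes {E : Type*} [Ring E] [Algebra ℂ E] (f : TensorAlgebra ℂ V →ₐ[ℂ] E) (u : E)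
    (g : G) (h : ∀ v, u * f (TensorAlgebra.ι ℂ v) = f (TensorAlgebra.ι ℂ (ρ g v)) * u)
    (a : TensorAlgebra ℂ V) : u * f a = f (tensorAction ρ g a) * u := by
  induction a using TensorAlgebra.induction with
  | algebraMap r => rw [AlgEquiv.commutes, AlgHom.commutes]; exact (Algebra.commutes _ _).symm
  | ι v => rw [tensorAction_ι, h]
  | mul x y hx hy => rw [map_mul, map_mul, map_mul, ← mul_assoc, hx, mul_assoc, hy, mul_assoc]
  | add x y hx hy => rw [map_add, map_add, map_add, mul_add, add_mul, hx, hy]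

theorem skewVec_mem (v : V) : skewVec b q σ α v ∈ skewDegree b q σ α 1 :=
  single_mem_coeffsIn _ _ _ (by rw [← symMk_ι]; exact symMk_mem_degree b q (ι_mem_tensorDegree v))

theorem skew_t_mem (g : G) : t σ α g ∈ skewDegree b q σ α 0 :=
  t_mem_coeffsIn _ _ _ (SetLike.one_mem_graded (QSym.degree b q))

theorem t_mul_skewVec (hσ : ExtendsAction b q ρ σ) (g : G) (v : V) :
    t σ α g * skewVec b q σ α v = skewVec b q σ α (ρ g v) * t σ α g := by
  have := t_mul_base' σ α g (CommAlg.ι b q v)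
  rw [hσ] at this
  exact this

variable (μ : constantCocycles b q σ α)

/-- A constant cocycle, as a Hochschild cocycle. -/
def toHochschild : hochschildCocycles (TwistedSkew σ α) := ⟨μ.1, μ.2.1⟩

theorem constant_eq_zero {d e : ℕ} (h : d + e < 2) {x y : TwistedSkew σ α}
    (hx : x ∈ skewDegree b q σ α d) (hy : y ∈ skewDegree b q σ α e) : μ.1 x y = 0 :=
  (μ.2.2 d e x hx y hy).1 h

/-- A product in the square-zero extension to which `μ` does not contribute, having degree `-2`. -/
theorem mk_mul_mk_of_lt_two {d e : ℕ} (h : d + e < 2) {x y : TwistedSkew σ α}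
    (hx : x ∈ skewDegree b q σ α d) (hy : y ∈ skewDegree b q σ α e) :
    SqZeroExt.mk (toHochschild b μ) x 0 * SqZeroExt.mk (toHochschild b μ) y 0
      = SqZeroExt.mk (toHochschild b μ) (x * y) 0 := by
  refine SqZeroExt.ext rfl ?_
  have : (toHochschild b μ).1 x y = 0 := constant_eq_zero b μ h hx hy
  simp [SqZeroExt.snd_mul, SqZeroExt.fst_mk, SqZeroExt.snd_mk, this]

/-- The lift of `T(V) → S_q(V)` to the square-zero extension of `S_q(V) #_α G`. -/
def extTensor : TensorAlgebra ℂ V →ₐ[ℂ] SqZeroExt (toHochschild b μ) :=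
  TensorAlgebra.lift ℂ (LinearMap.inl ℂ (TwistedSkew σ α) (TwistedSkew σ α) ∘ₗ
    TwistedSkew.single σ α 1 ∘ₗ CommAlg.ι b q :
      V →ₗ[ℂ] SqZeroExt (toHochschild b μ))

theorem extTensor_ι (v : V) : extTensor b μ (TensorAlgebra.ι ℂ v)
    = SqZeroExt.mk (toHochschild b μ) (skewVec b q σ α v) 0 :=
  TensorAlgebra.lift_ι_apply _ _

/-- The lifts of the group elements to the square-zero extension. -/
def extT (g : G) : SqZeroExt (toHochschild b μ) := SqZeroExt.mk _ (t σ α g) 0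

theorem extT_one : extT b μ 1 = 1 := by
  refine SqZeroExt.ext rfl ?_
  have : (toHochschild b μ).1 1 1 = 0 :=
    constant_eq_zero b μ (by norm_num) (skew_t_mem b 1) (skew_t_mem b 1)
  rw [SqZeroExt.snd_one, this, neg_zero]
  rfl

theorem extT_mul (g h : G) : extT b μ g * extT b μ h = (α.toFun g h : ℂ) • extT b μ (g * h) := by
  rw [extT, extT, mk_mul_mk_of_lt_two b μ (by norm_num) (skew_t_mem b g) (skew_t_mem b h), t_mul_t]
  exact SqZeroExt.ext rfl (smul_zero _).symm

theorem extT_extTensor (hσ : ExtendsAction b q ρ σ) (g : G) (a : TensorAlgebra ℂ V) :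
    extT b μ g * extTensor b μ a = extTensor b μ (tensorAction ρ g a) * extT b μ g := by
  refine tensor_commutes _ _ g (fun v => ?_) a
  rw [extTensor_ι, extTensor_ι, extT,
    mk_mul_mk_of_lt_two b μ (by norm_num) (skew_t_mem b g) (skewVec_mem b v),
    mk_mul_mk_of_lt_two b μ (by norm_num) (skewVec_mem b _) (skew_t_mem b g), t_mul_skewVec b hσ]

theorem fst_extTensor (a : TensorAlgebra ℂ V) :
    SqZeroExt.fst _ (extTensor b μ a) = base σ α (symMk b q a) := by
  have : (SqZeroExt.fstHom _).comp (extTensor b μ) = (base σ α).comp (symMk b q) := by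
    apply TensorAlgebra.hom_ext
    ext v : 1
    exact (congrArg (SqZeroExt.fst _) (extTensor_ι b μ v)).trans rfl
  exact DFunLike.congr_fun this a

/-- In the square-zero extension, the quadratic relations are deformed by the quantum
skew-symmetrization of `μ`. -/
theorem extTensor_quadRel (i j : Fin n) :
    extTensor b μ (quadRel b q i j) = SqZeroExt.eps _
      (μ.1 (skewVec b q σ α (b i)) (skewVec b q σ α (b j))
        - q i j • μ.1 (skewVec b q σ α (b j)) (skewVec b q σ α (b i))) := by
  refine SqZeroExt.ext ?_ ?_
  · rw [fst_extTensor, symMk_quadRel, map_zero, SqZeroExt.fst_eps]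
  · rw [quadRel, map_sub, map_smul, map_mul, map_mul, gen, gen, extTensor_ι, extTensor_ι, map_sub,
      map_smul, SqZeroExt.snd_mul, SqZeroExt.snd_mul, SqZeroExt.snd_eps]
    simp only [SqZeroExt.fst_mk, SqZeroExt.snd_mk, mul_zero, zero_mul, zero_add]
    rfl

/-- The lift of `T(V) #_α G → S_q(V) #_α G` to the square-zero extension. -/
def extSkew (hσ : ExtendsAction b q ρ σ) : TensorSkew ρ α →ₐ[ℂ] SqZeroExt (toHochschild b μ) :=
  liftAlgHom _ α (extTensor b μ) (extT b μ) (extT_one b μ) (extT_mul b μ) (extT_extTensor b μ hσ)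

theorem extSkew_single (hσ : ExtendsAction b q ρ σ) (g : G) (a : TensorAlgebra ℂ V) :
    extSkew b μ hσ (single _ α g a) = extTensor b μ a * extT b μ g :=
  liftAlgHom_single _ _ _ _ _ _ _ _ _

theorem extSkew_base (hσ : ExtendsAction b q ρ σ) (a : TensorAlgebra ℂ V) :
    extSkew b μ hσ (base _ α a) = extTensor b μ a := by
  rw [base_apply, extSkew_single, extT_one, mul_one]

theorem extSkew_t (hσ : ExtendsAction b q ρ σ) (g : G) :
    extSkew b μ hσ (t _ α g) = extT b μ g := by
  rw [t, extSkew_single, map_one, one_mul]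

theorem fst_extSkew (hσ : ExtendsAction b q ρ σ) (x : TensorSkew ρ α) :
    SqZeroExt.fst _ (extSkew b μ hσ x) = skewMk b α hσ x := by
  have : (SqZeroExt.fstHom _).comp (extSkew b μ hσ) = skewMk b α hσ := by
    apply TwistedSkew.algHom_ext
    · intro a
      rw [AlgHom.comp_apply, extSkew_base, SqZeroExt.fstHom_apply, fst_extTensor, skewMk_base]
    · intro g
      rw [AlgHom.comp_apply, extSkew_t, skewMk_t]
      rfl
  exact DFunLike.congr_fun this x

/-- A constant cocycle with vanishing quantum skew-symmetrization is a coboundary: all the relations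
of `S_q(V) #_α G` hold in its square-zero extension, which therefore splits. -/
theorem mem_coboundaries_of_skewSymmetrization_eq_zero (hσ : ExtendsAction b q ρ σ)
    (h : ∀ i j, μ.1 (skewVec b q σ α (b i)) (skewVec b q σ α (b j))
      - q i j • μ.1 (skewVec b q σ α (b j)) (skewVec b q σ α (b i)) = 0) :
    μ.1 ∈ hochschildCoboundaries (TwistedSkew σ α) := by
  let f : QSym b q →ₐ[ℂ] SqZeroExt (toHochschild b μ) :=
    RingQuot.liftAlgHom ℂ ⟨extTensor b μ, by
      rintro _ _ ⟨i, j⟩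
      have := extTensor_quadRel b μ i j
      rw [h, map_zero, quadRel, map_sub, sub_eq_zero] at this
      exact this⟩
  have hf : ∀ a, f (symMk b q a) = extTensor b μ a := fun a =>
    RingQuot.liftAlgHom_mkAlgHom_apply ℂ _ _ _
  let s : TwistedSkew σ α →ₐ[ℂ] SqZeroExt (toHochschild b μ) :=
    liftAlgHom σ α f (extT b μ) (extT_one b μ) (extT_mul b μ) (fun g a => by
      obtain ⟨a, rfl⟩ := symMk_surjective b q a
      rw [← symMk_tensorAction b hσ, hf, hf, extT_extTensor b μ hσ])
  refine SqZeroExt.mem_coboundaries_of_section (toHochschild b μ) s fun x => ?_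
  have : (SqZeroExt.fstHom _).comp s = AlgHom.id ℂ _ := by
    apply TwistedSkew.algHom_ext
    · intro a
      obtain ⟨a, rfl⟩ := symMk_surjective b q a
      rw [AlgHom.comp_apply, base_apply, liftAlgHom_single, extT_one, mul_one, hf,
        SqZeroExt.fstHom_apply, fst_extTensor]
      rfl
    · intro g
      rw [AlgHom.comp_apply, t, liftAlgHom_single, map_one, one_mul]
      rfl
  exact DFunLike.congr_fun this x

/-! ### The conditions that a skew-symmetrization satisfies -/

variable (ρ q) in
/-- The conditions on `κ` that make the overlaps of the relations
`v_i v_j - q_{ij} v_j v_i - κ(v_i, v_j)` with the group elements and with each other resolve. -/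
structure OverlapConditions (κ : V →ₗ[ℂ] V →ₗ[ℂ] TwistedGroupAlgebra α) : Prop where
  /-- The relations for `(i, j)` and `(j, i)` are proportional. -/
  antisymm : ∀ i j, kap b ρ α κ i j = -(q i j • kap b ρ α κ j i)
  /-- Conjugation with `t_g` preserves the span of the relations. -/
  equivariant : ∀ g i j, ∃ C : Fin n → Fin n → ℂ, t _ α g * heckeRel b ρ q α κ i j
    = ∑ k, ∑ l, C k l • (heckeRel b ρ q α κ k l * t _ α g)
  /-- The values of `κ` satisfy the syzygy that compares the two ways to reverse the order of the
  letters of `v_i v_j v_k`. -/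
  jacobi : ∀ i j k, kap b ρ α κ i j * base _ α (gen b k)
      + q i j • (base _ α (gen b j) * kap b ρ α κ i k)
      + (q i j * q i k) • (kap b ρ α κ j k * base _ α (gen b i))
      - base _ α (gen b i) * kap b ρ α κ j k
      - q j k • (kap b ρ α κ i k * base _ α (gen b j))
      - (q j k * q i k) • (base _ α (gen b k) * kap b ρ α κ i j) = 0

variable (q) in
/-- The syzygy among the quadratic relations that compares the two ways to reverse the order of the
letters of `v_i v_j v_k`. -/
theorem quadRel_jacobi (i j k : Fin n) : quadRel b q i j * gen b k
      + q i j • (gen b j * quadRel b q i k) + (q i j * q i k) • (quadRel b q j k * gen b i)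
      - gen b i * quadRel b q j k - q j k • (quadRel b q i k * gen b j)
      - (q j k * q i k) • (gen b k * quadRel b q i j) = 0 := by
  simp only [quadRel, sub_mul, mul_sub, smul_mul_assoc, mul_smul_comm, mul_assoc]
  module

variable {μ}

theorem extSkew_quadRel (hσ : ExtendsAction b q ρ σ)
    {κ : V →ₗ[ℂ] V →ₗ[ℂ] TwistedGroupAlgebra α}
    (h : IsQuantumSkewSymmetrization b q σ α μ.1 κ) (i j : Fin n) :
    extSkew b μ hσ (base _ α (quadRel b q i j))
      = SqZeroExt.eps _ (skewMk b α hσ (kap b ρ α κ i j)) := by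
  rw [extSkew_base, extTensor_quadRel, ← h, kap, skewMk_incl]

theorem kap_antisymm (hq_ne : ∀ i j, q i j ≠ 0) (hq_inv : ∀ i j, q j i = (q i j)⁻¹)
    {κ : V →ₗ[ℂ] V →ₗ[ℂ] TwistedGroupAlgebra α}
    (h : IsQuantumSkewSymmetrization b q σ α μ.1 κ) (i j : Fin n) :
    κ (b i) (b j) = -(q i j • κ (b j) (b i)) := by
  apply incl_injective b (σ := σ)
  rw [map_neg, map_smul, h, h, smul_sub, smul_smul, hq_inv i j, mul_inv_cancel₀ (hq_ne i j),
    one_smul, neg_sub]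

/-- The action permutes the quadratic relations up to linear combinations, since it preserves
`S_q(V)`; the lift to the square-zero extension transfers this to the values of `κ`. -/
theorem heckeRel_equivariant (hσ : ExtendsAction b q ρ σ)
    {κ : V →ₗ[ℂ] V →ₗ[ℂ] TwistedGroupAlgebra α}
    (h : IsQuantumSkewSymmetrization b q σ α μ.1 κ) (g : G) (i j : Fin n) :
    ∃ C : Fin n → Fin n → ℂ, t _ α g * heckeRel b ρ q α κ i j
      = ∑ k, ∑ l, C k l • (heckeRel b ρ q α κ k l * t _ α g) := by
  obtain ⟨C, hC⟩ := exists_eq_sum_quadRel b q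
    (tensorAction_mem_tensorDegree ρ g (quadRel_mem b q i j))
    (by rw [symMk_tensorAction b hσ, symMk_quadRel, map_zero])
  have h1 : t (tensorAction ρ) α g * base _ α (quadRel b q i j)
      = ∑ k, ∑ l, C k l • (base _ α (quadRel b q k l) * t _ α g) := by
    rw [t_mul_base', hC]
    simp only [map_sum, map_smul, Finset.sum_mul, smul_mul_assoc]
  have h2 : t _ α g * kap b ρ α κ i j = ∑ k, ∑ l, C k l • (kap b ρ α κ k l * t _ α g) := by
    have h3 := congrArg (extSkew b μ hσ) h1
    simp only [map_mul, map_sum, map_smul, extSkew_quadRel b hσ h, SqZeroExt.mul_eps,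
      SqZeroExt.eps_mul, fst_extSkew] at h3
    simp only [← map_smul, ← map_sum, ← map_mul] at h3
    rw [← sub_eq_zero]
    refine eq_zero_of_skewMk_of_lt_two b hσ (d := 0) (by norm_num) ?_ ?_
    · refine Submodule.sub_mem _ (mul_mem_tensorSkewDegree (t_mem g) (kap_mem b κ i j)) ?_
      exact Submodule.sum_mem _ fun k _ => Submodule.sum_mem _ fun l _ =>
        Submodule.smul_mem _ _ (mul_mem_tensorSkewDegree (kap_mem b κ k l) (t_mem g))
    · rw [map_sub, SqZeroExt.eps_injective _ h3, sub_self]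
  refine ⟨C, ?_⟩
  simp only [heckeRel, mul_sub, sub_mul, smul_sub, Finset.sum_sub_distrib, h1, h2]

/-- The image of `quadRel_jacobi` in the square-zero extension. The resulting identity has degree
one, and hence holds in `T(V) #_α G` as well. -/
theorem kap_jacobi (hσ : ExtendsAction b q ρ σ) {κ : V →ₗ[ℂ] V →ₗ[ℂ] TwistedGroupAlgebra α}
    (h : IsQuantumSkewSymmetrization b q σ α μ.1 κ) (i j k : Fin n) :
    kap b ρ α κ i j * base _ α (gen b k)
      + q i j • (base _ α (gen b j) * kap b ρ α κ i k)
      + (q i j * q i k) • (kap b ρ α κ j k * base _ α (gen b i))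
      - base _ α (gen b i) * kap b ρ α κ j k
      - q j k • (kap b ρ α κ i k * base _ α (gen b j))
      - (q j k * q i k) • (base _ α (gen b k) * kap b ρ α κ i j) = 0 := by
  have hv : ∀ i, base (tensorAction ρ) α (gen b i) ∈ tensorSkewDegree ρ α 1 := fun i =>
    base_mem (gen_mem b i)
  have hl : ∀ i j k, base (tensorAction ρ) α (gen b i) * kap b ρ α κ j k
      ∈ tensorSkewDegree ρ α 1 := fun i j k => mul_mem_tensorSkewDegree (hv i) (kap_mem b κ j k)
  have hr : ∀ i j k, kap b ρ α κ j k * base (tensorAction ρ) α (gen b i)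
      ∈ tensorSkewDegree ρ α 1 := fun i j k =>
    mul_mem_tensorSkewDegree (d := 0) (kap_mem b κ j k) (hv i)
  refine eq_zero_of_skewMk_of_lt_two b hσ (d := 1) (by norm_num) ?_ ?_
  · exact Submodule.sub_mem _ (Submodule.sub_mem _ (Submodule.sub_mem _ (Submodule.add_mem _
      (Submodule.add_mem _ (hr _ _ _) (Submodule.smul_mem _ _ (hl _ _ _)))
      (Submodule.smul_mem _ _ (hr _ _ _))) (hl _ _ _)) (Submodule.smul_mem _ _ (hr _ _ _)))
      (Submodule.smul_mem _ _ (hl _ _ _))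
  · have h3 := congrArg (fun x => extSkew b μ hσ (base _ α x)) (quadRel_jacobi b q i j k)
    simp only [map_sub, map_add, map_smul, map_mul, map_zero, extSkew_quadRel b hσ h,
      SqZeroExt.mul_eps, SqZeroExt.eps_mul, fst_extSkew] at h3
    simp only [← map_smul, ← map_mul, ← map_sub, ← map_add] at h3
    exact SqZeroExt.eps_injective _ (h3.trans (map_zero _).symm)

theorem overlapConditions (hq_ne : ∀ i j, q i j ≠ 0) (hq_inv : ∀ i j, q j i = (q i j)⁻¹)
    (hσ : ExtendsAction b q ρ σ) {κ : V →ₗ[ℂ] V →ₗ[ℂ] TwistedGroupAlgebra α}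
    (h : IsQuantumSkewSymmetrization b q σ α μ.1 κ) : OverlapConditions b ρ q κ where
  antisymm i j := by
    rw [kap, kap, kap_antisymm b hq_ne hq_inv h i j, map_neg, map_smul]
  equivariant := heckeRel_equivariant b hσ h
  jacobi := kap_jacobi b hσ h

/-! ### The map from classes of constant cocycles to parameters -/

variable (μ)

/-- The quantum skew-symmetrization of a constant cocycle. -/
def skewSymm : V →ₗ[ℂ] V →ₗ[ℂ] TwistedGroupAlgebra α :=
  b.constr ℂ fun i => b.constr ℂ fun j =>
    skewAug b α σ (μ.1 (skewVec b q σ α (b i)) (skewVec b q σ α (b j))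
      - q i j • μ.1 (skewVec b q σ α (b j)) (skewVec b q σ α (b i)))

theorem isQuantumSkewSymmetrization_skewSymm :
    IsQuantumSkewSymmetrization b q σ α μ.1 (skewSymm b μ) := by
  intro i j
  rw [skewSymm, Module.Basis.constr_basis, Module.Basis.constr_basis, incl_skewAug]
  have h0 : ∀ v w, μ.1 (skewVec b q σ α v) (skewVec b q σ α w) ∈ skewDegree b q σ α 0 :=
    fun v w => (μ.2.2 1 1 _ (skewVec_mem b v) _ (skewVec_mem b w)).2 0 rfl
  exact Submodule.sub_mem _ (h0 _ _) (Submodule.smul_mem _ _ (h0 _ _))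

theorem isQuantumSkewSymmetrization_iff (κ : V →ₗ[ℂ] V →ₗ[ℂ] TwistedGroupAlgebra α) :
    IsQuantumSkewSymmetrization b q σ α μ.1 κ ↔ κ = skewSymm b μ := by
  constructor
  · intro h
    refine b.ext fun i => b.ext fun j => incl_injective b (σ := σ) ?_
    rw [h, isQuantumSkewSymmetrization_skewSymm]
  · rintro rfl
    exact isQuantumSkewSymmetrization_skewSymm b μ

/-- Cohomologous constant cocycles have the same quantum skew-symmetrization: for a coboundary
`(a,b) ↦ a f(b) - f(ab) + f(a) b` the terms with `f(v_i v_j)` cancel, and the others are left or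
right multiples of vectors. -/
theorem skewSymm_eq_of_cohomologous (hσ : ExtendsAction b q ρ σ) {μ ν : constantCocycles b q σ α}
    (h : μ.1 - ν.1 ∈ hochschildCoboundaries (TwistedSkew σ α)) :
    skewSymm b μ = skewSymm b ν := by
  obtain ⟨f, hf⟩ := h
  refine b.ext fun i => b.ext fun j => ?_
  simp only [skewSymm, Module.Basis.constr_basis]
  rw [← sub_eq_zero, ← map_sub]
  have hrel : skewVec b q σ α (b i) * skewVec b q σ α (b j)
      = q i j • (skewVec b q σ α (b j) * skewVec b q σ α (b i)) := by
    have := congrArg (base σ α) (symMk_quadRel b q i j)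
    rw [quadRel] at this
    simp only [map_sub, map_smul, map_mul, map_zero, sub_eq_zero] at this
    exact this
  have h1 : ∀ v w, μ.1 v w = ν.1 v w + (v * f w - f (v * w) + f v * w) := fun v w => by
    rw [← hf]; simp
  rw [h1, h1, hrel, map_smul]
  have h2 : ∀ v w x y z x' y' : TwistedSkew σ α,
      v + (x - q i j • z + y) - q i j • (w + (x' - z + y')) - (v - q i j • w)
        = x + y - q i j • (x' + y') := by
    intros; module
  rw [h2]
  simp only [map_sub, map_add, map_smul, skewAug_vec_mul, skewAug_mul_vec b hσ, add_zero, smul_zero,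
    sub_zero]

end Constant

/-! ### The constant cocycle of a twisted quantum Drinfeld Hecke algebra -/

/-- A linear relation `J ⊆ M × N` composed with a linear map `f` on `N` that kills its indeterminacy
is given by a linear map on `M`. -/
theorem exists_linearMap_of_relation {M N P : Type*} [AddCommGroup M] [Module ℂ M] [AddCommGroup N]
    [Module ℂ N] [AddCommGroup P] [Module ℂ P] (J : Submodule ℂ (M × N)) (f : N →ₗ[ℂ] P)
    (h : ∀ y, (0, y) ∈ J → f y = 0) : ∃ D : M →ₗ[ℂ] P, ∀ x y, (x, y) ∈ J → D x = f y := by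
  let p : J →ₗ[ℂ] M := LinearMap.fst ℂ M N ∘ₗ J.subtype
  let g : J →ₗ[ℂ] P := f ∘ₗ LinearMap.snd ℂ M N ∘ₗ J.subtype
  obtain ⟨s, hs⟩ := LinearMap.exists_rightInverse_of_surjective p.rangeRestrict
    (LinearMap.range_rangeRestrict p)
  obtain ⟨D, hD⟩ := LinearMap.exists_extend (g ∘ₗ s)
  refine ⟨D, fun x y hxy => ?_⟩
  have h1 : D x = g (s (p.rangeRestrict ⟨(x, y), hxy⟩)) :=
    LinearMap.congr_fun hD (p.rangeRestrict ⟨(x, y), hxy⟩)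
  have h2 : p (s (p.rangeRestrict ⟨(x, y), hxy⟩)) = x :=
    congrArg Subtype.val (LinearMap.congr_fun hs (p.rangeRestrict ⟨(x, y), hxy⟩))
  rw [h1]
  generalize s (p.rangeRestrict ⟨(x, y), hxy⟩) = z at h2
  obtain ⟨⟨x', y'⟩, hz⟩ := z
  change x' = x at h2
  subst h2
  change f y' = f y
  rw [← sub_eq_zero, ← map_sub]
  refine h _ ?_
  have := Submodule.sub_mem _ hz hxy
  rwa [Prod.mk_sub_mk, sub_self] at this

section Surjective

open TwistedSkew

variable {G : Type*} [Group G] {V : Type*} [AddCommGroup V] [Module ℂ V] {n : ℕ}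
  (b : Module.Basis (Fin n) ℂ V) {ρ : Representation ℂ G V} {q : Fin n → Fin n → ℂ}
  {α : NormalizedTwoCocycle G} {κ : V →ₗ[ℂ] V →ₗ[ℂ] TwistedGroupAlgebra α}
  {σ : G →* (QSym b q ≃ₐ[ℂ] QSym b q)} (hσ : ExtendsAction b q ρ σ)

/-- The second entry of a pair is determined by the first one, up to elements that vanish in
`S_q(V) #_α G`. -/
theorem LeadingTermsVanish.skewMk_snd_eq_zero (H : LeadingTermsVanish b κ hσ) {y : TensorSkew ρ α}
    (hy : (0, y) ∈ relPairs b ρ q α κ) : skewMk b α hσ y = 0 := by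
  refine eq_zero_of_homComp (skewDegree b q σ α) fun d => ?_
  have h1 := homComp_mem_relPairs b q d hy
  rw [map_zero] at h1
  rw [homComp_skewMk]
  refine H d _ (homComp_mem _ _ _) ?_
  rw [← heckeMk_eq_of_mem_relPairs b q h1, map_zero]
  exact Submodule.zero_mem _

variable (α) in
theorem exists_graded_section : ∃ s : TwistedSkew σ α →ₗ[ℂ] TensorSkew ρ α,
    (∀ x, skewMk b α hσ (s x) = x) ∧
      ∀ d, ∀ x ∈ skewDegree b q σ α d, s x ∈ tensorSkewDegree ρ α d := by
  obtain ⟨s₀, hs₀⟩ := LinearMap.exists_rightInverse_of_surjective (skewMk b α hσ).toLinearMap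
    (LinearMap.range_eq_top.2 (skewMk_surjective b hσ))
  obtain ⟨s, hs⟩ := exists_linearMap_homComp (skewDegree b q σ α)
    (fun d => homComp (tensorSkewDegree ρ α) d ∘ₗ s₀)
  refine ⟨s, fun x => ?_, fun d x hx => ?_⟩
  · induction x using DirectSum.Decomposition.inductionOn (skewDegree b q σ α) with
    | zero => simp
    | add x y hx hy => rw [map_add, map_add, hx, hy]
    | @homogeneous d x =>
      have : skewMk b α hσ (s₀ x) = x := LinearMap.congr_fun hs₀ _
      rw [hs d x x.2, LinearMap.comp_apply, ← homComp_skewMk, this, homComp_same _ x.2]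
  · rw [hs d x hx]
    exact homComp_mem _ _ _

/-- If the leading terms of the relations of `H_{q,κ,α}` are relations of `S_q(V) #_α G`, then `κ`
is the quantum skew-symmetrization of a constant cocycle. The map from the kernel of
`T(V) #_α G → S_q(V) #_α G` to `S_q(V) #_α G` that rewrites a relation by its lower-order part is a
well-defined bimodule map; the cocycle is its value on the defect of multiplicativity of a graded
linear section. -/
theorem exists_constantCocycle (H : LeadingTermsVanish b κ hσ) :
    ∃ μ : constantCocycles b q σ α, IsQuantumSkewSymmetrization b q σ α μ.1 κ := by
  obtain ⟨D, hD⟩ := exists_linearMap_of_relation (relPairs b ρ q α κ)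
    (skewMk b α hσ).toLinearMap (fun y hy => H.skewMk_snd_eq_zero b hσ hy)
  replace hD : ∀ x y, (x, y) ∈ relPairs b ρ q α κ → D x = skewMk b α hσ y := hD
  obtain ⟨s, hs, hsd⟩ := exists_graded_section b α hσ
  -- `D` is a bimodule map on the kernel of the projection.
  have hDl : ∀ a z, skewMk b α hσ z = 0 → D (s a * z) = a * D z := fun a z hz => by
    obtain ⟨y, hy⟩ := exists_mem_relPairs b κ hσ hz
    rw [hD _ _ hy, hD _ _ (mul_mem_relPairs b q (s a) hy), map_mul, hs]
  have hDr : ∀ a z, skewMk b α hσ z = 0 → D (z * s a) = D z * a := fun a z hz => by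
    obtain ⟨y, hy⟩ := exists_mem_relPairs b κ hσ hz
    rw [hD _ _ hy, hD _ _ (mem_relPairs_mul b q (s a) hy), map_mul, hs]
  have hker : ∀ a c, skewMk b α hσ (s a * s c - s (a * c)) = 0 := fun a c => by
    rw [map_sub, map_mul, hs, hs, hs, sub_self]
  have hdeg : ∀ m, ∀ z ∈ tensorSkewDegree ρ α m, skewMk b α hσ z = 0 →
      (m < 2 → D z = 0) ∧ ∀ m', m' + 2 = m → D z ∈ skewDegree b q σ α m' := by
    intro m z hz hz0
    refine ⟨fun hm => ?_, fun m' hm => ?_⟩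
    · rw [eq_zero_of_skewMk_of_lt_two b hσ hm hz hz0, map_zero]
    · subst hm
      obtain ⟨y, hy⟩ := exists_mem_relPairs b κ hσ hz0
      have h1 := homComp_mem_relPairs b q m' hy
      rw [homComp_same _ hz] at h1
      rw [hD _ _ h1]
      exact skewMk_mem_degree b hσ (homComp_mem _ _ _)
  let μ : TwistedSkew σ α →ₗ[ℂ] TwistedSkew σ α →ₗ[ℂ] TwistedSkew σ α :=
    LinearMap.mk₂ ℂ (fun a c => D (s a * s c - s (a * c)))
      (fun a a' c => by
        rw [← map_add]; congr 1; rw [map_add, add_mul, add_mul, map_add]; abel)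
      (fun r a c => by
        rw [← map_smul]; congr 1
        rw [map_smul, smul_mul_assoc, smul_mul_assoc, map_smul, smul_sub])
      (fun a c c' => by
        rw [← map_add]; congr 1; rw [map_add, mul_add, mul_add, map_add]; abel)
      (fun r a c => by
        rw [← map_smul]; congr 1
        rw [map_smul, mul_smul_comm, mul_smul_comm, map_smul, smul_sub])
  have hμ : ∀ a c, μ a c = D (s a * s c - s (a * c)) := fun a c => rfl
  refine ⟨⟨μ, fun x y z => ?_, fun d e x hx y hy => ?_⟩, fun i j => ?_⟩
  -- Both sides of the cocycle identity are values of `D` on the same element.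
  · rw [hμ, hμ, hμ, hμ, ← hDl _ _ (hker _ _), ← hDr _ _ (hker _ _), ← map_add, ← map_add,
      mul_assoc x y z]
    congr 1
    noncomm_ring
  · have hmul : x * y ∈ skewDegree b q σ α (d + e) := by
      rw [← hs x, ← hs y, ← map_mul]
      exact skewMk_mem_degree b hσ (mul_mem_tensorSkewDegree (hsd d x hx) (hsd e y hy))
    exact hdeg (d + e) _ (Submodule.sub_mem _ (mul_mem_tensorSkewDegree (hsd d x hx) (hsd e y hy))
      (hsd _ _ hmul)) (hker x y)
  -- In degree one the section `s` is the only one, so it sends `v_i` to `v_i`.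
  · have hv : ∀ i, s (skewVec b q σ α (b i)) = base _ α (gen b i) := fun i => by
      rw [← sub_eq_zero]
      refine eq_zero_of_skewMk_of_lt_two b hσ (d := 1) (by norm_num)
        (Submodule.sub_mem _ (hsd _ _ (skewVec_mem b _)) (base_mem (gen_mem b i))) ?_
      rw [map_sub, hs, skewMk_base, gen, symMk_ι]
      exact sub_self _
    have hrel : skewVec b q σ α (b i) * skewVec b q σ α (b j)
        - q i j • (skewVec b q σ α (b j) * skewVec b q σ α (b i)) = 0 := by
      have := congrArg (base σ α) (symMk_quadRel b q i j)
      rw [quadRel] at this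
      simp only [map_sub, map_smul, map_mul, map_zero] at this
      exact this
    have hmem : (base _ α (quadRel b q i j), kap b ρ α κ i j) ∈ relPairs b ρ q α κ := by
      have := gen_mem_relPairs b q (κ := κ) (t_mem (ρ := ρ) (α := α) 1) (t_mem 1) i j
      rwa [t_one, one_mul, one_mul, mul_one, mul_one] at this
    have h1 := hD _ _ hmem
    rw [kap, skewMk_incl] at h1
    rw [← h1]
    change _ = μ _ _ - q i j • μ _ _
    rw [hμ, hμ, ← map_smul, ← map_sub, hv, hv]
    congr 1
    rw [smul_sub, sub_sub_sub_comm, ← map_smul, ← map_sub, hrel, map_zero, sub_zero, quadRel,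
      map_sub, map_smul, map_mul, map_mul]

end Surjective

/-! ### Recursion along a confluent rewriting system -/

/-- A function that is prescribed along the rewriting steps `e` starting at `x`, by an expression
`Φ x e` in its values at smaller points, exists as soon as the system is locally confluent: two
steps from the same point prescribe the same value to every function that obeys all steps at smaller
points. -/
theorem exists_of_confluent {X P : Type*} {r : X → X → Prop} (wf : WellFounded r) {E : X → Type*}
    (Φ : ∀ x, E x → (X → P) → P) (ν₀ : X → P)
    (hloc : ∀ x e ν ν', (∀ y, r y x → ν y = ν' y) → Φ x e ν = Φ x e ν')
    (hconf : ∀ x e e' ν, (∀ y, r y x → ∀ e, ν y = Φ y e ν) → Φ x e ν = Φ x e' ν) :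
    ∃ ν : X → P, (∀ x, IsEmpty (E x) → ν x = ν₀ x) ∧ ∀ x e, ν x = Φ x e ν := by
  classical
  let ν : X → P := wf.fix fun x rec =>
    if h : Nonempty (E x) then Φ x h.some (fun y => if hy : r y x then rec y hy else ν₀ y)
    else ν₀ x
  have hν : ∀ x, ν x = if h : Nonempty (E x) then
      Φ x h.some (fun y => if r y x then ν y else ν₀ y) else ν₀ x := fun x => by
    have := wf.fix_eq (fun x rec => if h : Nonempty (E x) then
      Φ x h.some (fun y => if hy : r y x then rec y hy else ν₀ y) else ν₀ x) x
    refine this.trans ?_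
    congr
  refine ⟨ν, fun x hx => ?_, fun x => ?_⟩
  · rw [hν, dif_neg (not_nonempty_iff.2 hx)]
  · induction x using wf.induction with
    | _ x ih =>
      intro e
      have h : Nonempty (E x) := ⟨e⟩
      rw [hν, dif_pos h, hloc x h.some _ ν (fun y hy => if_pos hy)]
      exact hconf x _ _ ν ih

/-! ### Inversions of words -/

section Inversions

variable {n : ℕ}

/-- The number of inversions of a word. -/
def inversions : List (Fin n) → ℕ
  | [] => 0
  | i :: l => l.countP (· < i) + inversions l

theorem inversions_swap_lt (u w : List (Fin n)) {j k : Fin n} (h : k < j) :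
    inversions (u ++ k :: j :: w) < inversions (u ++ j :: k :: w) := by
  induction u with
  | nil =>
    have h' : ¬ j < k := not_lt.2 h.le
    simp only [List.nil_append, inversions, List.countP_cons, h, h', decide_true, decide_false]
    simp
    omega
  | cons i u ih =>
    have hp : List.Perm (u ++ k :: j :: w) (u ++ j :: k :: w) :=
      List.Perm.append_left u (List.Perm.swap _ _ _)
    simp only [List.cons_append, inversions]
    rw [hp.countP_eq]
    omega

/-- Words are ordered by length, and words of equal length by the number of inversions. -/
def wordLT (l l' : List (Fin n)) : Prop :=
  l.length < l'.length ∨ (l.length = l'.length ∧ inversions l < inversions l')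

theorem wordLT_wf : WellFounded (wordLT (n := n)) := by
  refine Subrelation.wf (r := InvImage (Prod.Lex (· < ·) (· < ·))
    (fun l : List (Fin n) => (l.length, inversions l))) ?_
    (InvImage.wf _ (WellFounded.prod_lex Nat.lt_wfRel.wf Nat.lt_wfRel.wf))
  intro l l' h
  exact Prod.lex_def.2 h

theorem wordLT_trans {l l' l'' : List (Fin n)} (h : wordLT l l') (h' : wordLT l' l'') :
    wordLT l l'' := by
  unfold wordLT at *
  omega

theorem wordLT_swap (u w : List (Fin n)) {j k : Fin n} (h : k < j) :
    wordLT (u ++ k :: j :: w) (u ++ j :: k :: w) :=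
  Or.inr ⟨by simp, inversions_swap_lt u w h⟩

end Inversions

/-! ### Functions on words that obey the rewriting steps -/

section NormalForm

open TwistedSkew

variable {G : Type*} [Group G] {V : Type*} [AddCommGroup V] [Module ℂ V] {n : ℕ}
  (b : Module.Basis (Fin n) ℂ V) {ρ : Representation ℂ G V} {q : Fin n → Fin n → ℂ}
  {α : NormalizedTwoCocycle G} {κ : V →ₗ[ℂ] V →ₗ[ℂ] TwistedGroupAlgebra α}
  {σ : G →* (QSym b q ≃ₐ[ℂ] QSym b q)}

variable (ρ α) in
/-- The element `v_{i_1} ⋯ v_{i_d}` of `T(V) #_α G`. -/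
def skewWord (l : List (Fin n)) : TensorSkew ρ α := base _ α (word b l)

variable (ρ α) in
/-- The element `v_i` of `T(V) #_α G`. -/
def skewGen (i : Fin n) : TensorSkew ρ α := base _ α (gen b i)

theorem skewWord_nil : skewWord b ρ α [] = 1 := map_one _

theorem skewWord_cons (i : Fin n) (l : List (Fin n)) :
    skewWord b ρ α (i :: l) = skewGen b ρ α i * skewWord b ρ α l := by
  rw [skewWord, word_cons, map_mul]; rfl

theorem skewWord_append (l l' : List (Fin n)) :
    skewWord b ρ α (l ++ l') = skewWord b ρ α l * skewWord b ρ α l' := by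
  rw [skewWord, word_append, map_mul]; rfl

theorem skewWord_mem (l : List (Fin n)) : skewWord b ρ α l ∈ tensorSkewDegree ρ α l.length :=
  base_mem (word_mem b l)

theorem heckeRel_eq (i j : Fin n) : heckeRel b ρ q α κ i j
    = skewGen b ρ α i * skewGen b ρ α j
      - (q i j • (skewGen b ρ α j * skewGen b ρ α i) + kap b ρ α κ i j) := by
  rw [heckeRel, quadRel, map_sub, map_smul, map_mul, map_mul, sub_sub]; rfl

theorem tensorSkewDegree_le_span (d : ℕ) : tensorSkewDegree ρ α d ≤ Submodule.span ℂ
    {x | ∃ (l : List (Fin n)) (g : G), l.length = d ∧ x = skewWord b ρ α l * t _ α g} := by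
  rw [tensorSkewDegree, coeffsIn_eq_iSup]
  refine iSup_le fun g => ?_
  rw [tensorDegree_eq_span b, Submodule.map_span, Submodule.span_le]
  rintro _ ⟨_, ⟨l, hl, rfl⟩, rfl⟩
  refine Submodule.subset_span ⟨l, g, hl, ?_⟩
  rw [skewWord, base_mul_t]

theorem filtration_le_span (m : ℕ) : (tensorSkewFiltration ρ α).F m ≤ Submodule.span ℂ
    {x | ∃ (l : List (Fin n)) (g : G), l.length ≤ m ∧ x = skewWord b ρ α l * t _ α g} := by
  rw [filtration_eq]
  refine iSup_le fun d => (tensorSkewDegree_le_span b d).trans (Submodule.span_mono ?_)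
  rintro _ ⟨l, g, hl, rfl⟩
  exact ⟨l, g, hl.le.trans (Nat.le_of_lt_succ d.2), rfl⟩

theorem eq_of_mem_filtration {M : Type*} [AddCommGroup M] [Module ℂ M] {m : ℕ}
    (f f' : TensorSkew ρ α →ₗ[ℂ] M)
    (h : ∀ l g, l.length ≤ m → f (skewWord b ρ α l * t _ α g) = f' (skewWord b ρ α l * t _ α g))
    {x : TensorSkew ρ α} (hx : x ∈ (tensorSkewFiltration ρ α).F m) : f x = f' x := by
  have key : (tensorSkewFiltration ρ α).F m ≤ LinearMap.eqLocus f f' := by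
    refine (filtration_le_span b m).trans (Submodule.span_le.2 ?_)
    rintro _ ⟨l, g, hl, rfl⟩
    exact h l g hl
  exact key hx

variable (ρ) in
/-- The map on `T(V) #_α G` that extends a function on words, linearly and compatibly with right
multiplication by group elements. -/
def extendWords (ν : List (Fin n) → TwistedSkew σ α) : TensorSkew ρ α →ₗ[ℂ] TwistedSkew σ α :=
  lift _ α fun g => LinearMap.mulRight ℂ (t σ α g) ∘ₗ (wordBasis b).constr ℂ ν

variable (ν : List (Fin n) → TwistedSkew σ α)

theorem extendWords_mul_t (x : TensorSkew ρ α) (g : G) :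
    extendWords b ρ ν (x * t _ α g) = extendWords b ρ ν x * t σ α g := by
  induction x using induction_on with
  | h0 => simp
  | hadd x y hx hy => rw [add_mul, map_add, map_add, add_mul, hx, hy]
  | hs h a =>
    rw [single_mul_t, extendWords, lift_single, lift_single]
    simp only [LinearMap.comp_apply, LinearMap.mulRight_apply, map_smul]
    rw [mul_assoc, t_mul_t, mul_smul_comm]

theorem extendWords_skewWord (l : List (Fin n)) :
    extendWords b ρ ν (skewWord b ρ α l) = ν l := by
  rw [skewWord, base_apply, extendWords, lift_single, LinearMap.comp_apply,
    LinearMap.mulRight_apply, t_one, mul_one, ← wordBasis_apply, Module.Basis.constr_basis]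

theorem extendWords_congr {ν ν' : List (Fin n) → TwistedSkew σ α} {m : ℕ}
    (h : ∀ l, l.length ≤ m → ν l = ν' l) {x : TensorSkew ρ α}
    (hx : x ∈ (tensorSkewFiltration ρ α).F m) :
    extendWords b ρ ν x = extendWords b ρ ν' x := by
  refine eq_of_mem_filtration b _ _ (fun l g hl => ?_) hx
  rw [extendWords_mul_t, extendWords_mul_t, extendWords_skewWord, extendWords_skewWord, h l hl]

variable (ρ κ) in
/-- The value that rewriting the descent `j k` in the word `u j k w` prescribes. -/
def rewriteValue (u : List (Fin n)) (j k : Fin n) (w : List (Fin n)) : TwistedSkew σ α :=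
  q j k • ν (u ++ k :: j :: w)
    + extendWords b ρ ν (skewWord b ρ α u * kap b ρ α κ j k * skewWord b ρ α w)

theorem extendWords_heckeRel (u : List (Fin n)) (j k : Fin n) (w : List (Fin n)) :
    extendWords b ρ ν (skewWord b ρ α u * heckeRel b ρ q α κ j k * skewWord b ρ α w)
      = ν (u ++ j :: k :: w) - rewriteValue b ρ κ ν u j k w := by
  rw [heckeRel_eq, rewriteValue, ← extendWords_skewWord b (ρ := ρ) ν,
    ← extendWords_skewWord b (ρ := ρ) ν, ← map_smul, ← map_add, ← map_sub]
  congr 1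
  simp only [skewWord_append, skewWord_cons, mul_sub, sub_mul, mul_add, add_mul, mul_assoc,
    mul_smul_comm, smul_mul_assoc]

variable (ρ κ) in
/-- The function `ν` on words obeys all rewriting steps on words of length at most `m`. -/
def ObeysUpTo (m : ℕ) : Prop :=
  ∀ u j k w, k < j → (u ++ j :: k :: w).length ≤ m →
    ν (u ++ j :: k :: w) = rewriteValue b ρ κ ν u j k w

variable {ν}

theorem ObeysUpTo.word_eq_zero (hq_diag : ∀ i, q i i = 1) (hq_ne : ∀ i j, q i j ≠ 0)
    (hq_inv : ∀ i j, q j i = (q i j)⁻¹) (hκ : OverlapConditions b ρ q κ) {m : ℕ}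
    (h : ObeysUpTo b ρ κ ν m) (u : List (Fin n)) (j k : Fin n) (w : List (Fin n))
    (hm : u.length + 2 + w.length ≤ m) :
    extendWords b ρ ν (skewWord b ρ α u * heckeRel b ρ q α κ j k * skewWord b ρ α w) = 0 := by
  have hl : ∀ j k, (u ++ j :: k :: w).length ≤ m := fun j k => by simp; omega
  have hlt : ∀ j k, k < j → extendWords b ρ ν
      (skewWord b ρ α u * heckeRel b ρ q α κ j k * skewWord b ρ α w) = 0 := fun j k hjk => by
    rw [extendWords_heckeRel, h u j k w hjk (hl j k), sub_self]
  have hanti : ∀ j k, heckeRel b ρ q α κ j k = -(q j k • heckeRel b ρ q α κ k j) := fun j k => by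
    rw [heckeRel_eq, heckeRel_eq, hκ.antisymm j k]
    have : q j k * q k j = 1 := by rw [hq_inv j k, mul_inv_cancel₀ (hq_ne j k)]
    simp only [smul_sub, smul_add, smul_smul, this, one_smul]
    abel
  rcases lt_trichotomy k j with hjk | rfl | hjk
  · exact hlt j k hjk
  · have h0 := hanti k k
    rw [hq_diag, one_smul] at h0
    have h2 : (2 : ℂ) • heckeRel b ρ q α κ k k = 0 := by
      rw [two_smul]
      nth_rewrite 1 [h0]
      exact neg_add_cancel _
    rw [(smul_eq_zero.1 h2).resolve_left two_ne_zero, mul_zero, zero_mul, map_zero]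
  · rw [hanti j k, mul_neg, neg_mul, mul_smul_comm, smul_mul_assoc, map_neg, map_smul,
      hlt k j hjk, smul_zero, neg_zero]

/-- A function that obeys all rewriting steps on words of length at most `m` kills the part of the
defining ideal that these words see. Equivariance moves the group elements to the right. -/
theorem ObeysUpTo.eq_zero (hq_diag : ∀ i, q i i = 1) (hq_ne : ∀ i j, q i j ≠ 0)
    (hq_inv : ∀ i j, q j i = (q i j)⁻¹) (hκ : OverlapConditions b ρ q κ) {m : ℕ}
    (h : ObeysUpTo b ρ κ ν m) (j k : Fin n) {c d : ℕ} {x y : TensorSkew ρ α}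
    (hx : x ∈ (tensorSkewFiltration ρ α).F c) (hy : y ∈ (tensorSkewFiltration ρ α).F d)
    (hm : c + 2 + d ≤ m) :
    extendWords b ρ ν (x * heckeRel b ρ q α κ j k * y) = 0 := by
  -- left factors without group elements
  have h1 : ∀ u : List (Fin n), u.length ≤ c → ∀ j k, ∀ y ∈ (tensorSkewFiltration ρ α).F d,
      extendWords b ρ ν (skewWord b ρ α u * heckeRel b ρ q α κ j k * y) = 0 := by
    intro u hu j k y hy
    refine eq_of_mem_filtration b (extendWords b ρ ν ∘ₗ
      LinearMap.mulLeft ℂ (skewWord b ρ α u * heckeRel b ρ q α κ j k)) 0 (fun w g hw => ?_) hy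
    rw [LinearMap.comp_apply, LinearMap.mulLeft_apply, ← mul_assoc, extendWords_mul_t,
      h.word_eq_zero b hq_diag hq_ne hq_inv hκ u j k w (by omega), zero_mul, LinearMap.zero_apply]
  rw [mul_assoc]
  refine eq_of_mem_filtration b (extendWords b ρ ν ∘ₗ
    LinearMap.mulRight ℂ (heckeRel b ρ q α κ j k * y)) 0 (fun u g hu => ?_) hx
  rw [LinearMap.comp_apply, LinearMap.mulRight_apply, LinearMap.zero_apply]
  obtain ⟨C, hC⟩ := hκ.equivariant g j k
  have hty : t _ α g * y ∈ (tensorSkewFiltration ρ α).F d := by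
    have := (tensorSkewFiltration ρ α).mul_mem
      (degree_le_filtration le_rfl (t_mem (ρ := ρ) (α := α) g)) hy
    rwa [zero_add] at this
  rw [mul_assoc, ← mul_assoc (t _ α g), hC]
  simp only [Finset.sum_mul, Finset.mul_sum, smul_mul_assoc, mul_smul_comm, map_sum, map_smul]
  refine Finset.sum_eq_zero fun j' _ => Finset.sum_eq_zero fun k' _ => ?_
  rw [mul_assoc, ← mul_assoc (skewWord b ρ α u), h1 u hu j' k' _ hty, smul_zero]

end NormalForm

/-! ### Confluence -/

section Confluence

open TwistedSkew

variable {G : Type*} [Group G] {V : Type*} [AddCommGroup V] [Module ℂ V] {n : ℕ}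
  (b : Module.Basis (Fin n) ℂ V) {ρ : Representation ℂ G V} {q : Fin n → Fin n → ℂ}
  {α : NormalizedTwoCocycle G} {κ : V →ₗ[ℂ] V →ₗ[ℂ] TwistedGroupAlgebra α}
  {σ : G →* (QSym b q ≃ₐ[ℂ] QSym b q)} {ν : List (Fin n) → TwistedSkew σ α}

theorem rewriteValue_eq (u : List (Fin n)) (j k : Fin n) (w : List (Fin n)) :
    rewriteValue b ρ κ ν u j k w = extendWords b ρ ν (skewWord b ρ α u *
      (q j k • (skewGen b ρ α k * skewGen b ρ α j) + kap b ρ α κ j k) * skewWord b ρ α w) := by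
  rw [rewriteValue, ← extendWords_skewWord b (ρ := ρ) ν, ← map_smul, ← map_add]
  congr 1
  simp only [skewWord_append, skewWord_cons, mul_add, add_mul, mul_assoc, mul_smul_comm,
    smul_mul_assoc]

theorem extendWords_heckeRel_eq_zero {u : List (Fin n)} {j k : Fin n} {w : List (Fin n)}
    (h : ν (u ++ j :: k :: w) = rewriteValue b ρ κ ν u j k w) :
    extendWords b ρ ν (skewWord b ρ α u * heckeRel b ρ q α κ j k * skewWord b ρ α w) = 0 := by
  rw [extendWords_heckeRel, h, sub_self]

/-- Two rewriting steps at disjoint positions are confluent. -/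
theorem rewriteValue_eq_of_disjoint (hq_diag : ∀ i, q i i = 1) (hq_ne : ∀ i j, q i j ≠ 0)
    (hq_inv : ∀ i j, q j i = (q i j)⁻¹) (hκ : OverlapConditions b ρ q κ)
    {u : List (Fin n)} {j k : Fin n} {m : List (Fin n)} {l p : Fin n} {w : List (Fin n)}
    (hν : ObeysUpTo b ρ κ ν (u.length + m.length + 2 + w.length))
    (h1 : ν ((u ++ k :: j :: m) ++ l :: p :: w) = rewriteValue b ρ κ ν (u ++ k :: j :: m) l p w)
    (h2 : ν (u ++ j :: k :: (m ++ p :: l :: w))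
      = rewriteValue b ρ κ ν u j k (m ++ p :: l :: w)) :
    rewriteValue b ρ κ ν u j k (m ++ l :: p :: w)
      = rewriteValue b ρ κ ν (u ++ j :: k :: m) l p w := by
  have hF : ∀ x : List (Fin n), skewWord b ρ α x ∈ (tensorSkewFiltration ρ α).F x.length :=
    fun x => degree_le_filtration le_rfl (skewWord_mem b x)
  have hK : ∀ j k, kap b ρ α κ j k ∈ (tensorSkewFiltration ρ α).F 0 :=
    fun j k => degree_le_filtration le_rfl (kap_mem b κ j k)
  have e1 := extendWords_heckeRel_eq_zero b h1
  have e2 := extendWords_heckeRel_eq_zero b h2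
  have e3 := hν.eq_zero b hq_diag hq_ne hq_inv hκ l p
    ((tensorSkewFiltration ρ α).mul_mem ((tensorSkewFiltration ρ α).mul_mem (hF u) (hK j k)) (hF m))
    (hF w) (by omega)
  have e4 := hν.eq_zero b hq_diag hq_ne hq_inv hκ j k (hF u)
    ((tensorSkewFiltration ρ α).mul_mem ((tensorSkewFiltration ρ α).mul_mem (hF m) (hK l p)) (hF w))
    (by omega)
  rw [heckeRel_eq] at e1 e2 e3 e4
  rw [rewriteValue_eq, rewriteValue_eq]
  simp only [skewWord_append, skewWord_cons, ← mul_assoc] at e1 e2 e3 e4 ⊢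
  rw [← sub_eq_zero, ← map_sub]
  generalize extendWords b ρ ν = P at *
  generalize skewWord b ρ α u = U at *
  generalize skewWord b ρ α m = M at *
  generalize skewWord b ρ α w = W at *
  generalize kap b ρ α κ j k = K at *
  generalize kap b ρ α κ l p = K' at *
  generalize skewGen b ρ α j = J at *
  generalize skewGen b ρ α k = J' at *
  generalize skewGen b ρ α l = L at *
  generalize skewGen b ρ α p = L' at *
  -- The two values differ by a combination of relations that occur at smaller words.
  have e : P (q j k • (U * J' * J * M * (L * L' - (q l p • (L' * L) + K')) * W)
      + U * K * M * (L * L' - (q l p • (L' * L) + K')) * W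
      - q l p • (U * (J * J' - (q j k • (J' * J) + K)) * M * L' * L * W)
      - U * (J * J' - (q j k • (J' * J) + K)) * M * K' * W) = 0 := by
    simp only [map_sub, map_add, map_smul]
    rw [e1, e2, e3, e4]
    simp
  rw [← e]
  congr 1
  simp only [mul_sub, sub_mul, mul_add, add_mul, smul_mul_assoc, mul_smul_comm, mul_assoc, smul_sub,
    smul_add]
  rw [smul_comm (q l p) (q j k)]
  abel

/-- Two rewriting steps at overlapping positions are confluent, by the Jacobi-type identity. -/
theorem rewriteValue_eq_of_overlap (hκ : OverlapConditions b ρ q κ)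
    {u : List (Fin n)} {i j k : Fin n} {w : List (Fin n)}
    (h1 : ν ((u ++ [j]) ++ i :: k :: w) = rewriteValue b ρ κ ν (u ++ [j]) i k w)
    (h2 : ν (u ++ j :: k :: (i :: w)) = rewriteValue b ρ κ ν u j k (i :: w))
    (h3 : ν (u ++ i :: k :: (j :: w)) = rewriteValue b ρ κ ν u i k (j :: w))
    (h4 : ν ((u ++ [k]) ++ i :: j :: w) = rewriteValue b ρ κ ν (u ++ [k]) i j w) :
    rewriteValue b ρ κ ν u i j (k :: w) = rewriteValue b ρ κ ν (u ++ [i]) j k w := by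
  have e1 := extendWords_heckeRel_eq_zero b h1
  have e2 := extendWords_heckeRel_eq_zero b h2
  have e3 := extendWords_heckeRel_eq_zero b h3
  have e4 := extendWords_heckeRel_eq_zero b h4
  have hJ : kap b ρ α κ i j * skewGen b ρ α k + q i j • (skewGen b ρ α j * kap b ρ α κ i k)
      + (q i j * q i k) • (kap b ρ α κ j k * skewGen b ρ α i) - skewGen b ρ α i * kap b ρ α κ j k
      - q j k • (kap b ρ α κ i k * skewGen b ρ α j)
      - (q j k * q i k) • (skewGen b ρ α k * kap b ρ α κ i j) = 0 := hκ.jacobi i j k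
  rw [heckeRel_eq] at e1 e2 e3 e4
  rw [rewriteValue_eq, rewriteValue_eq]
  simp only [skewWord_append, skewWord_cons, skewWord_nil, mul_one, ← mul_assoc]
    at e1 e2 e3 e4 ⊢
  rw [← sub_eq_zero, ← map_sub]
  generalize extendWords b ρ ν = P at *
  generalize skewWord b ρ α u = U at *
  generalize skewWord b ρ α w = W at *
  generalize kap b ρ α κ i j = K₁ at *
  generalize kap b ρ α κ i k = K₂ at *
  generalize kap b ρ α κ j k = K₃ at *
  generalize skewGen b ρ α i = X at *
  generalize skewGen b ρ α j = Y at *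
  generalize skewGen b ρ α k = Z at *
  -- The two values differ by a combination of relations at smaller words and the Jacobi identity.
  have e : P (q i j • (U * Y * (X * Z - (q i k • (Z * X) + K₂)) * W)
      + (q i j * q i k) • (U * (Y * Z - (q j k • (Z * Y) + K₃)) * X * W)
      - q j k • (U * (X * Z - (q i k • (Z * X) + K₂)) * Y * W)
      - (q j k * q i k) • (U * Z * (X * Y - (q i j • (Y * X) + K₁)) * W)
      + U * (K₁ * Z + q i j • (Y * K₂) + (q i j * q i k) • (K₃ * X) - X * K₃ - q j k • (K₂ * Y)
        - (q j k * q i k) • (Z * K₁)) * W) = 0 := by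
    rw [hJ]
    simp only [map_sub, map_add, map_smul]
    rw [e1, e2, e3, e4]
    simp
  rw [← e]
  congr 1
  simp only [mul_sub, sub_mul, mul_add, add_mul, smul_mul_assoc, mul_smul_comm, mul_assoc]
  module

/-- Normal forms: a function on words can be prescribed on words without descents, and then extended
so that it obeys all rewriting steps. -/
theorem exists_normalForm (hq_diag : ∀ i, q i i = 1) (hq_ne : ∀ i j, q i j ≠ 0)
    (hq_inv : ∀ i j, q j i = (q i j)⁻¹) (hκ : OverlapConditions b ρ q κ)
    (ν₀ : List (Fin n) → TwistedSkew σ α) :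
    ∃ ν : List (Fin n) → TwistedSkew σ α,
      (∀ x, (∀ u j k w, k < j → x ≠ u ++ j :: k :: w) → ν x = ν₀ x) ∧
      ∀ u j k w, k < j → ν (u ++ j :: k :: w) = rewriteValue b ρ κ ν u j k w := by
  let E : List (Fin n) → Type := fun x =>
    {e : List (Fin n) × Fin n × Fin n × List (Fin n) //
      e.2.2.1 < e.2.1 ∧ x = e.1 ++ e.2.1 :: e.2.2.1 :: e.2.2.2}
  let Φ : ∀ x, E x → (List (Fin n) → TwistedSkew σ α) → TwistedSkew σ α := fun x e ν =>
    rewriteValue b ρ κ ν e.1.1 e.1.2.1 e.1.2.2.1 e.1.2.2.2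
  suffices H : ∃ ν : List (Fin n) → TwistedSkew σ α,
      (∀ x, IsEmpty (E x) → ν x = ν₀ x) ∧ ∀ x e, ν x = Φ x e ν by
    obtain ⟨ν, hν₀, hν⟩ := H
    refine ⟨ν, fun x hx => hν₀ x ⟨?_⟩, fun u j k w h => hν _ ⟨(u, j, k, w), h, rfl⟩⟩
    rintro ⟨⟨u, j, k, w⟩, h, hxe⟩
    exact hx u j k w h hxe
  refine exists_of_confluent wordLT_wf Φ ν₀ ?_ ?_
  · rintro x ⟨⟨u, j, k, w⟩, h, rfl⟩ ν ν' hνν'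
    change rewriteValue b ρ κ ν u j k w = rewriteValue b ρ κ ν' u j k w
    rw [rewriteValue, rewriteValue, hνν' _ (wordLT_swap u w h)]
    congr 1
    refine extendWords_congr b (m := u.length + 0 + w.length)
      (fun l hl => hνν' l (Or.inl (by simp; omega))) ?_
    exact degree_le_filtration le_rfl (mul_mem_tensorSkewDegree
      (mul_mem_tensorSkewDegree (skewWord_mem b u) (kap_mem b κ j k)) (skewWord_mem b w))
  · -- It suffices to compare a descent with one further to the right.
    suffices key : ∀ x u j k w u' j' k' w' a (ν : List (Fin n) → TwistedSkew σ α), k < j → k' < j' →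
        x = u ++ j :: k :: w → u' = u ++ a → j :: k :: w = a ++ j' :: k' :: w' →
        (∀ y, wordLT y x → ∀ e : E y, ν y = Φ y e ν) →
        rewriteValue b ρ κ ν u j k w = rewriteValue b ρ κ ν u' j' k' w' by
      rintro x ⟨⟨u, j, k, w⟩, h, hx⟩ ⟨⟨u', j', k', w'⟩, h', hx'⟩ ν hν
      change k < j at h
      change k' < j' at h'
      change x = u ++ j :: k :: w at hx
      change x = u' ++ j' :: k' :: w' at hx'
      change rewriteValue b ρ κ ν u j k w = rewriteValue b ρ κ ν u' j' k' w'
      rcases List.append_eq_append_iff.1 (hx.symm.trans hx') with ⟨a, ha, ha'⟩ | ⟨a, ha, ha'⟩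
      · exact key x u j k w u' j' k' w' a ν h h' hx ha ha' hν
      · exact (key x u' j' k' w' u j k w a ν h' h hx' ha ha' hν).symm
    rintro x u j k w u' j' k' w' a ν h h' rfl rfl ha hν
    have step : ∀ u₁ j₁ k₁ w₁, k₁ < j₁ → wordLT (u₁ ++ j₁ :: k₁ :: w₁) (u ++ j :: k :: w) →
        ν (u₁ ++ j₁ :: k₁ :: w₁) = rewriteValue b ρ κ ν u₁ j₁ k₁ w₁ :=
      fun u₁ j₁ k₁ w₁ h₁ hlt => hν _ hlt ⟨(u₁, j₁, k₁, w₁), h₁, rfl⟩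
    rcases a with _ | ⟨a₁, _ | ⟨a₂, m⟩⟩
    · simp only [List.nil_append, List.cons.injEq] at ha
      obtain ⟨rfl, rfl, rfl⟩ := ha
      rw [List.append_nil]
    · simp only [List.cons_append, List.nil_append, List.cons.injEq] at ha
      obtain ⟨rfl, rfl, rfl⟩ := ha
      have s1 : wordLT (u ++ k :: j :: k' :: w') (u ++ j :: k :: k' :: w') := wordLT_swap u _ h
      have s2 : wordLT (u ++ k :: k' :: j :: w') (u ++ j :: k :: k' :: w') := by
        have := wordLT_swap (u ++ [k]) w' (h'.trans h)
        simp only [List.append_assoc, List.cons_append, List.nil_append] at this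
        exact wordLT_trans this s1
      have s3 : wordLT (u ++ j :: k' :: k :: w') (u ++ j :: k :: k' :: w') := by
        have := wordLT_swap (u ++ [j]) w' h'
        simpa only [List.append_assoc, List.cons_append, List.nil_append] using this
      have s4 : wordLT (u ++ k' :: j :: k :: w') (u ++ j :: k :: k' :: w') :=
        wordLT_trans (wordLT_swap u (k :: w') (h'.trans h)) s3
      refine rewriteValue_eq_of_overlap b hκ ?_ ?_ ?_ ?_
      · refine step _ _ _ _ (h'.trans h) ?_
        simpa only [List.append_assoc, List.cons_append, List.nil_append] using s1
      · exact step _ _ _ _ h' s2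
      · exact step _ _ _ _ (h'.trans h) s3
      · refine step _ _ _ _ h ?_
        simpa only [List.append_assoc, List.cons_append, List.nil_append] using s4
    · simp only [List.cons_append, List.cons.injEq] at ha
      obtain ⟨rfl, rfl, rfl⟩ := ha
      refine rewriteValue_eq_of_disjoint b hq_diag hq_ne hq_inv hκ ?_ ?_ ?_
      · intro u₁ j₁ k₁ w₁ h₁ hl
        exact step _ _ _ _ h₁ (Or.inl (by simp at hl ⊢; omega))
      · refine step _ _ _ _ h' ?_
        have := wordLT_swap u (m ++ j' :: k' :: w') h
        simpa only [List.append_assoc, List.cons_append] using this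
      · refine step _ _ _ _ h ?_
        have := wordLT_swap (u ++ j :: k :: m) w' h'
        simpa only [List.append_assoc, List.cons_append] using this

end Confluence

/-! ### From the overlap conditions to the leading terms -/

section LeadingTerms

open TwistedSkew

variable {G : Type*} [Group G] {V : Type*} [AddCommGroup V] [Module ℂ V] {n : ℕ}
  (b : Module.Basis (Fin n) ℂ V) {ρ : Representation ℂ G V} {q : Fin n → Fin n → ℂ}
  {α : NormalizedTwoCocycle G} {κ : V →ₗ[ℂ] V →ₗ[ℂ] TwistedGroupAlgebra α}
  {σ : G →* (QSym b q ≃ₐ[ℂ] QSym b q)} {ν : List (Fin n) → TwistedSkew σ α}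

theorem mul_t_mem_skewDegree {d : ℕ} {x : TwistedSkew σ α} (hx : x ∈ skewDegree b q σ α d)
    (g : G) : x * t σ α g ∈ skewDegree b q σ α d := fun h => by
  rw [coeff_mul_t]
  exact Submodule.smul_mem _ _ (hx _)

variable (q α σ) in
/-- The elements of `S_q(V) #_α G` all of whose homogeneous components have degree less than `d`. -/
def skewDegreeLT (d : ℕ) : Submodule ℂ (TwistedSkew σ α) :=
  ⨅ e, ⨅ (_ : d ≤ e), LinearMap.ker (homComp (skewDegree b q σ α) e)

theorem mem_skewDegreeLT {d : ℕ} {x : TwistedSkew σ α} :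
    x ∈ skewDegreeLT b q α σ d ↔ ∀ e, d ≤ e → homComp (skewDegree b q σ α) e x = 0 := by
  simp only [skewDegreeLT, Submodule.mem_iInf, LinearMap.mem_ker]

theorem skewDegreeLT_mono {d e : ℕ} (h : d ≤ e) :
    skewDegreeLT b q α σ d ≤ skewDegreeLT b q α σ e := fun x hx => by
  rw [mem_skewDegreeLT] at hx ⊢
  exact fun c hc => hx c (h.trans hc)

theorem skewDegree_le_skewDegreeLT {d e : ℕ} (h : d < e) :
    skewDegree b q σ α d ≤ skewDegreeLT b q α σ e := fun x hx => by
  rw [mem_skewDegreeLT]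
  exact fun c hc => homComp_ne _ hx (by omega)

theorem homComp_mul_t (d : ℕ) (x : TwistedSkew σ α) (g : G) :
    homComp (skewDegree b q σ α) d (x * t σ α g)
      = homComp (skewDegree b q σ α) d x * t σ α g := by
  induction x using DirectSum.Decomposition.inductionOn (skewDegree b q σ α) with
  | zero => simp
  | add x y hx hy => simp only [add_mul, map_add, hx, hy]
  | @homogeneous e x =>
    by_cases h : e = d
    · subst h
      rw [homComp_same _ x.2, homComp_same _ (mul_t_mem_skewDegree b x.2 g)]
    · rw [homComp_ne _ x.2 h, homComp_ne _ (mul_t_mem_skewDegree b x.2 g) h, zero_mul]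

theorem mul_t_mem_skewDegreeLT {d : ℕ} {x : TwistedSkew σ α} (hx : x ∈ skewDegreeLT b q α σ d)
    (g : G) : x * t σ α g ∈ skewDegreeLT b q α σ d := by
  rw [mem_skewDegreeLT] at hx ⊢
  intro e he
  rw [homComp_mul_t, hx e he, zero_mul]

theorem exists_mem_filtration (x : TensorSkew ρ α) :
    ∃ m, x ∈ (tensorSkewFiltration ρ α).F m := by
  induction x using DirectSum.Decomposition.inductionOn (tensorSkewDegree ρ α) with
  | zero => exact ⟨0, Submodule.zero_mem _⟩
  | @homogeneous d x => exact ⟨d, degree_le_filtration le_rfl x.2⟩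
  | add x y hx hy =>
    obtain ⟨c, hx⟩ := hx
    obtain ⟨d, hy⟩ := hy
    exact ⟨max c d, Submodule.add_mem _
      ((tensorSkewFiltration ρ α).mono (le_max_left c d) hx)
      ((tensorSkewFiltration ρ α).mono (le_max_right c d) hy)⟩

/-- A function on words that obeys all rewriting steps descends to `H_{q,κ,α}`. -/
theorem extendWords_eq_zero_of_mem_heckeIdeal (hq_diag : ∀ i, q i i = 1)
    (hq_ne : ∀ i j, q i j ≠ 0) (hq_inv : ∀ i j, q j i = (q i j)⁻¹)
    (hκ : OverlapConditions b ρ q κ)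
    (hν : ∀ u j k w, k < j → ν (u ++ j :: k :: w) = rewriteValue b ρ κ ν u j k w)
    {x : TensorSkew ρ α} (hx : x ∈ heckeIdeal b ρ q α κ) : extendWords b ρ ν x = 0 := by
  let I : TwoSidedIdeal (TensorSkew ρ α) :=
    TwoSidedIdeal.mk' {x | ∀ a c, extendWords b ρ ν (a * x * c) = 0}
      (fun a c => by rw [mul_zero, zero_mul, map_zero])
      (fun {x y} hx hy a c => by rw [mul_add, add_mul, map_add, hx, hy, add_zero])
      (fun {x} hx a c => by rw [mul_neg, neg_mul, map_neg, hx, neg_zero])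
      (fun {y x} hx a c => by rw [← mul_assoc a]; exact hx _ _)
      (fun {x y} hx a c => by rw [← mul_assoc a, mul_assoc (a * x)]; exact hx _ _)
  have hI : heckeIdeal b ρ q α κ ≤ I := by
    rw [heckeIdeal, TwoSidedIdeal.span_le, heckeRelations_eq]
    rintro _ ⟨i, j, rfl⟩
    rw [SetLike.mem_coe, TwoSidedIdeal.mem_mk']
    intro a c
    obtain ⟨d, ha⟩ := exists_mem_filtration a
    obtain ⟨e, hc⟩ := exists_mem_filtration c
    have h : ObeysUpTo b ρ κ ν (d + 2 + e) := fun u j k w hjk _ => hν u j k w hjk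
    exact h.eq_zero b hq_diag hq_ne hq_inv hκ i j ha hc le_rfl
  have h := hI hx
  rw [TwoSidedIdeal.mem_mk'] at h
  have h := h 1 1
  rwa [one_mul, mul_one] at h

variable (hσ : ExtendsAction b q ρ σ)

theorem skewMk_skewWord_swap (u : List (Fin n)) (j k : Fin n) (w : List (Fin n)) :
    skewMk b α hσ (skewWord b ρ α (u ++ j :: k :: w))
      = q j k • skewMk b α hσ (skewWord b ρ α (u ++ k :: j :: w)) := by
  have h : skewMk b α hσ (skewWord b ρ α u * base _ α (quadRel b q j k) * skewWord b ρ α w)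
      = 0 := by
    rw [map_mul, map_mul, skewMk_base, symMk_quadRel, map_zero, mul_zero, zero_mul]
  rw [← sub_eq_zero, ← map_smul, ← map_sub]
  refine Eq.trans (congrArg _ ?_) h
  rw [quadRel, map_sub, map_smul, map_mul, map_mul]
  simp only [skewWord_append, skewWord_cons, skewGen, mul_sub, sub_mul, mul_assoc, mul_smul_comm,
    smul_mul_assoc]

theorem extendWords_mem_skewDegreeLT {m : ℕ}
    (h : ∀ l : List (Fin n), l.length ≤ m →
      ν l - skewMk b α hσ (skewWord b ρ α l) ∈ skewDegreeLT b q α σ l.length)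
    {x : TensorSkew ρ α} (hx : x ∈ (tensorSkewFiltration ρ α).F m) :
    extendWords b ρ ν x ∈ skewDegreeLT b q α σ (m + 1) := by
  have key : (tensorSkewFiltration ρ α).F m
      ≤ (skewDegreeLT b q α σ (m + 1)).comap (extendWords b ρ ν) := by
    refine (filtration_le_span b m).trans (Submodule.span_le.2 ?_)
    rintro _ ⟨l, g, hl, rfl⟩
    change extendWords b ρ ν _ ∈ skewDegreeLT b q α σ (m + 1)
    rw [extendWords_mul_t, extendWords_skewWord]
    refine mul_t_mem_skewDegreeLT b ?_ g
    rw [← sub_add_cancel (ν l) (skewMk b α hσ (skewWord b ρ α l))]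
    exact Submodule.add_mem _ (skewDegreeLT_mono b (by omega) (h l hl))
      (skewDegree_le_skewDegreeLT b (Nat.lt_succ_of_le hl)
        (skewMk_mem_degree b hσ (skewWord_mem b l)))
  exact key hx

/-- The normal form of a word has the image of the word in `S_q(V) #_α G` as leading term. -/
theorem normalForm_sub_mem
    (hν₀ : ∀ x, (∀ u j k w, k < j → x ≠ u ++ j :: k :: w) →
      ν x = skewMk b α hσ (skewWord b ρ α x))
    (hν : ∀ u j k w, k < j → ν (u ++ j :: k :: w) = rewriteValue b ρ κ ν u j k w)
    (x : List (Fin n)) :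
    ν x - skewMk b α hσ (skewWord b ρ α x) ∈ skewDegreeLT b q α σ x.length := by
  induction x using wordLT_wf.induction with
  | _ x ih =>
    by_cases hx : ∃ u j k w, k < j ∧ x = u ++ j :: k :: w
    · obtain ⟨u, j, k, w, hjk, rfl⟩ := hx
      rw [hν u j k w hjk, rewriteValue, skewMk_skewWord_swap, add_sub_right_comm, ← smul_sub]
      refine Submodule.add_mem _ (Submodule.smul_mem _ _ ?_) ?_
      · have := ih _ (wordLT_swap u w hjk)
        simpa only [List.length_append, List.length_cons] using this
      · refine skewDegreeLT_mono b ?_ (extendWords_mem_skewDegreeLT b hσ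
          (m := u.length + 0 + w.length) (fun l hl => ih l (Or.inl ?_))
          (degree_le_filtration le_rfl (mul_mem_tensorSkewDegree
            (mul_mem_tensorSkewDegree (skewWord_mem b u) (kap_mem b κ j k)) (skewWord_mem b w))))
        · simp only [List.length_append, List.length_cons]; omega
        · simp only [List.length_append, List.length_cons]; omega
    · rw [hν₀ x (fun u j k w hjk hxe => hx ⟨u, j, k, w, hjk, hxe⟩), sub_self]
      exact Submodule.zero_mem _

/-- If all overlaps resolve, then the leading terms of the relations of `H_{q,κ,α}` are relations
of `S_q(V) #_α G`: the normal form descends to `H_{q,κ,α}` and preserves leading terms. -/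
theorem leadingTermsVanish_of_overlapConditions (hq_diag : ∀ i, q i i = 1)
    (hq_ne : ∀ i j, q i j ≠ 0) (hq_inv : ∀ i j, q j i = (q i j)⁻¹)
    (hκ : OverlapConditions b ρ q κ) : LeadingTermsVanish b κ hσ := by
  obtain ⟨ν, hν₀, hν⟩ := exists_normalForm b hq_diag hq_ne hq_inv hκ
    (fun x => skewMk b α hσ (skewWord b ρ α x))
  have hlead := normalForm_sub_mem b hσ hν₀ hν
  intro d x hx hxd
  obtain ⟨y, hy, hxy⟩ := mem_map_prev b hxd
  have h1 : extendWords b ρ ν x = extendWords b ρ ν y := by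
    rw [← sub_eq_zero, ← map_sub]
    refine extendWords_eq_zero_of_mem_heckeIdeal b hq_diag hq_ne hq_inv hκ hν ?_
    rw [← heckeMk_eq_zero, map_sub, hxy, sub_self]
  have h2 : extendWords b ρ ν y ∈ skewDegreeLT b q α σ d := by
    cases d with
    | zero =>
      rw [AlgFiltration.prev, Submodule.mem_bot] at hy
      rw [hy, map_zero]
      exact Submodule.zero_mem _
    | succ d => exact extendWords_mem_skewDegreeLT b hσ (fun l _ => hlead l) hy
  have h3 : extendWords b ρ ν x - skewMk b α hσ x ∈ skewDegreeLT b q α σ d := by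
    have key : tensorSkewDegree ρ α d ≤ (skewDegreeLT b q α σ d).comap
        (extendWords b ρ ν - (skewMk b α hσ).toLinearMap) := by
      refine (tensorSkewDegree_le_span b d).trans (Submodule.span_le.2 ?_)
      rintro _ ⟨l, g, rfl, rfl⟩
      change extendWords b ρ ν _ - skewMk b α hσ _ ∈ skewDegreeLT b q α σ l.length
      rw [extendWords_mul_t, extendWords_skewWord, map_mul, skewMk_t, ← sub_mul]
      exact mul_t_mem_skewDegreeLT b (hlead l) g
    exact key hx
  rw [h1] at h3
  have h4 := Submodule.sub_mem _ h2 h3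
  rw [sub_sub_cancel, mem_skewDegreeLT] at h4
  rw [← homComp_same _ (skewMk_mem_degree b hσ hx)]
  exact h4 d le_rfl

/-! ### The parameter space and the defining ideals -/

variable (κ) in
theorem skewMk_kap (i j : Fin n) :
    skewMk b α hσ (kap b ρ α κ i j) = inclGroupAlgebra σ α (κ (b i) (b j)) :=
  skewMk_incl b hσ _

/-- The defining ideal determines the parameter: two relations with the same quadratic part differ
by an element of degree zero, and no such element vanishes in `H_{q,κ,α}`. -/
theorem eq_of_heckeIdeal_eq {κ' : V →ₗ[ℂ] V →ₗ[ℂ] TwistedGroupAlgebra α}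
    (H : LeadingTermsVanish b κ hσ) (h : heckeIdeal b ρ q α κ = heckeIdeal b ρ q α κ') :
    κ = κ' := by
  refine b.ext fun i => b.ext fun j => incl_injective b (σ := σ) ?_
  rw [← skewMk_kap b κ hσ, ← skewMk_kap b κ' hσ, ← sub_eq_zero, ← map_sub]
  refine H 0 _ (Submodule.sub_mem _ (kap_mem b κ i j) (kap_mem b κ' i j)) ?_
  have h1 := heckeMk_quadRel b ρ q α κ i j
  have h2 : heckeMk b ρ q α κ (heckeRel b ρ q α κ' i j) = 0 := by
    rw [heckeMk_eq_zero, h, ← heckeMk_eq_zero, heckeMk_heckeRel]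
  rw [heckeRel, map_sub, h1, ← map_sub] at h2
  rw [h2]
  exact Submodule.zero_mem _

/-! ### Classes of cocycles and parameters -/

variable (q α) in
/-- The quantum skew-symmetrization of a class of constant cocycles. -/
def classSkewSymm : ConstantClasses b q σ α → V →ₗ[ℂ] V →ₗ[ℂ] TwistedGroupAlgebra α :=
  Quotient.lift (skewSymm b) fun _ _ h => skewSymm_eq_of_cohomologous b hσ h

theorem classSkewSymm_injective : Function.Injective (classSkewSymm b q α hσ) := by
  intro x y
  induction x using Quotient.inductionOn with | _ μ =>
  induction y using Quotient.inductionOn with | _ ν =>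
  intro h
  replace h : skewSymm b μ = skewSymm b ν := h
  refine Quotient.sound ?_
  refine mem_coboundaries_of_skewSymmetrization_eq_zero b (μ - ν) hσ fun i j => ?_
  have hμ := isQuantumSkewSymmetrization_skewSymm b μ i j
  have hν := isQuantumSkewSymmetrization_skewSymm b ν i j
  rw [h, hν] at hμ
  rw [Submodule.coe_sub, LinearMap.sub_apply, LinearMap.sub_apply, LinearMap.sub_apply,
    LinearMap.sub_apply, smul_sub, sub_sub_sub_comm, ← hμ, sub_self]

theorem classSkewSymm_bijOn [Finite G] (hq_diag : ∀ i, q i i = 1)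
    (hq_ne : ∀ i j, q i j ≠ 0) (hq_inv : ∀ i j, q j i = (q i j)⁻¹) :
    Set.BijOn (classSkewSymm b q α hσ) Set.univ (parameterSpace b ρ q α σ) := by
  refine ⟨fun x _ => ?_, (classSkewSymm_injective b hσ).injOn, fun κ hκ => ?_⟩
  · induction x using Quotient.inductionOn with | _ μ =>
    have hμ := isQuantumSkewSymmetrization_skewSymm b μ
    exact ⟨kap_antisymm b hq_ne hq_inv hμ, satisfiesPBW_of_leadingTermsVanish b hσ
      (leadingTermsVanish_of_overlapConditions b hσ hq_diag hq_ne hq_inv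
        (overlapConditions b hq_ne hq_inv hσ hμ))⟩
  · obtain ⟨μ, hμ⟩ := exists_constantCocycle b hσ (leadingTermsVanish_of_satisfiesPBW b κ hσ hκ.2)
    exact ⟨Quotient.mk _ μ, trivial, ((isQuantumSkewSymmetrization_iff b μ κ).1 hμ).symm⟩

end LeadingTerms

end TQDHA

end

theorem mainTheorem4 {G : Type*} [Group G] [Finite G]
    {V : Type*} [AddCommGroup V] [Module ℂ V] {n : ℕ} (b : Module.Basis (Fin n) ℂ V)
    (ρ : Representation ℂ G V)
    (q : Fin n → Fin n → ℂ) (hq_ne : ∀ i j, q i j ≠ 0) (hq_diag : ∀ i, q i i = 1)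
    (hq_inv : ∀ i j, q j i = (q i j)⁻¹)
    (α : TQDHA.NormalizedTwoCocycle G)
    (σ : G →* (TQDHA.QSym b q ≃ₐ[ℂ] TQDHA.QSym b q))
    (hσ : TQDHA.ExtendsAction b q ρ σ)
    (hΛ : ∃ τ : G →* (TQDHA.QExt b q ≃ₐ[ℂ] TQDHA.QExt b q),
      TQDHA.ExtendsAction b (fun i j => -q i j) ρ τ) :
    ∃ K : TQDHA.ConstantClasses b q σ α →
        (V →ₗ[ℂ] V →ₗ[ℂ] TQDHA.TwistedGroupAlgebra α),
      (∀ μ : TQDHA.constantCocycles b q σ α, ∀ κ : V →ₗ[ℂ] V →ₗ[ℂ] TQDHA.TwistedGroupAlgebra α,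
        TQDHA.IsQuantumSkewSymmetrization b q σ α μ.1 κ ↔
          κ = K (Quotient.mk (TQDHA.cohomologous b q σ α) μ)) ∧
      Set.BijOn K Set.univ (TQDHA.parameterSpace b ρ q α σ) ∧
      Set.BijOn (fun c => TQDHA.heckeIdeal b ρ q α (K c)) Set.univ
        (TQDHA.heckeQuotients b ρ q α σ) := by
  have hbij := TQDHA.classSkewSymm_bijOn (ρ := ρ) (α := α) b hσ hq_diag hq_ne hq_inv
  refine ⟨TQDHA.classSkewSymm b q α hσ, TQDHA.isQuantumSkewSymmetrization_iff b, hbij, ?_⟩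
  refine Set.BijOn.comp (g := TQDHA.heckeIdeal b ρ q α) ⟨fun κ hκ => ⟨κ, hκ, rfl⟩, ?_, ?_⟩ hbij
  · exact fun κ hκ κ' _ h => TQDHA.eq_of_heckeIdeal_eq b hσ
      (TQDHA.leadingTermsVanish_of_satisfiesPBW b κ hσ hκ.2) h
  · rintro _ ⟨κ, hκ, rfl⟩
    exact ⟨κ, hκ, rfl⟩
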